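/- Let $\mathbb F$ be a field of characteristic zero; all Lie algebras and modules are finite dimensional over $\mathbb F$. Let $V(a)$ denote the irreducible $\mathfrak{sl}(2)$-module of highest weight $a\ge 0$. Let $n\ge 1$, $m=2n-1$, and let $\mathfrak g=\mathfrak{sl}(2)\ltimes\mathfrak h_n$, where $\mathfrak h_n$ is the Heisenberg Lie algebra of dimension $2n+1$ on which $\mathfrak{sl}(2)$ acts by derivations so that $\mathfrak h_n=\mathfrak h_n(m)\oplus\mathbb Fz\simeq V(m)\oplus V(0)$, with $\mathbb Fz$ the center. A $\mathfrak g$-module $V$ is *uniserial* if its socle series $0=\mathrm{soc}^0(V)\subset\mathrm{soc}^1(V)\subset\cdots$, defined by $\mathrm{soc}^{i+1}(V)/\mathrm{soc}^i(V)=\mathrm{soc}(V/\mathrm{soc}^i(V))$, is a composition series. A *socle decomposition* $V=V(a_0)\oplus\cdots\oplus V(a_\ell)$ is a decomposition of $V$ into irreducible $\mathfrak{sl}(2)$-submodules isomorphic to $V(a_0),\dots,V(a_\ell)$ such that the sum of the first $k$ summands is $\mathrm{soc}^k(V)$ for all $k\le \ell+1$. A uniserial $\mathfrak g$-module is *standard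 faithful* if it is faithful and not isomorphic to the exceptional module $FU_{(4,3,4)}$, which exists only for $n=2$: as an $\mathfrak{sl}(2)$-module it is $V(4)\oplus V(3)\oplus V(4)$, and $\mathfrak h_2(3)\simeq V(3)$ acts by $0\leftarrow V(4)\leftarrow V(3)\leftarrow V(4)$ through non-zero $\mathfrak{sl}(2)$-equivariant maps, while $z$ acts by a scalar multiple of the identity from the last summand to the first. If $V(m)$ is a constituent of $\mathrm{Hom}(V(b),V(a))$, let $E(a,b)$ be the $\mathfrak g$-module $V(a)\oplus V(b)$ on which $z$ acts by zero and $\mathfrak h_n(m)\simeq V(m)$ annihilates $V(a)$ and maps $V(b)$ to $V(a)$ through the non-zero $\mathfrak{sl}(2)$-map $V(m)\to\mathrm{Hom}(V(b),V(a))$ (unique up to a scalar). For $\mathfrak g$-modules with given socle decompositions $V_1=V(a_0)\oplus\cdots\oplus V(a_{\ell_1})$ and $V_2=V(b_0)\oplus\cdots\oplus V(b_{\ell_2})$ put, for $t\ge0$, $$S_t=S_t(V_1,V_2)=\Big(\bigoplus_{i+j=t}V(a_i)\otimes V(b_j)\Big)^{\mathfrak h_n}\subset V_1\otimes V_2,$$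 the space of vectors of the sum that are annihilated by $\mathfrak h_n$; it is an $\mathfrak{sl}(2)$-submodule. **Proposition.** Let $V_1=V(a_0)\oplus V(a_1)\oplus V(a_2)$ and $V_2=V(b_0)\oplus\cdots\oplus V(b_\ell)$, $\ell\ge1$, be socle decompositions of two uniserial $\mathfrak g$-modules, where $V_1$ is standard faithful. Then $S_0=V(a_0)\otimes V(b_0)$ and: (i) $S_t=0$ for all $t>\min\{2,\ell\}$. If $t\in\{1,2\}$ and $S_t\neq0$, then $S_t$ is irreducible as an $\mathfrak{sl}(2)$-module, and every (non-zero) highest weight vector $v\in S_t$, of weight $\mu$, is a sum $v=\sum_{i=0}^t v_i$ where, for each $i=0,\dots,t$, $v_i$ is a non-zero highest weight vector of weight $\mu$ in $V(a_i)\otimes V(b_{t-i})$. (ii) If $V_2$ is not faithful, then $S_2=0$. (iii) $S_1(V_1,V_2)\simeq S_1\big(E(a_0,a_1),E(b_0,b_1)\big)$ as $\mathfrak{sl}(2)$-modules. (iv) If $V_2$ is also standard faithful, then $S_2\neq0$ if and only if $V_1\simeq V_2$ as $\mathfrak g$-modules, if and only if $a_i=b_i$ for $i=0,1,2$; in this case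 $S_2\simeq V(0)$ as an $\mathfrak{sl}(2)$-module. -/

import Mathlib

open scoped TensorProduct

noncomputable section

namespace Galilean

/-! ### The Lie algebra `sl(2)` and the modules `V(a)` -/

section Irreducible

variable (F : Type*) [Field F]

/-- The Lie algebra `sl(2)` of traceless `2 × 2` matrices. -/
abbrev SL2 : Type _ := LieAlgebra.SpecialLinear.sl (Fin 2) F

/-- The standard element `e = (0 1; 0 0)`. -/
def eMat : SL2 F := ⟨!![0, 1; 0, 0], by
  change Matrix.trace (_ : Matrix (Fin 2) (Fin 2) F) = 0
  simp [Matrix.trace_fin_two]⟩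

/-- The standard element `h = (1 0; 0 -1)`. -/
def hMat : SL2 F := ⟨!![1, 0; 0, -1], by
  change Matrix.trace (_ : Matrix (Fin 2) (Fin 2) F) = 0
  simp [Matrix.trace_fin_two]⟩

/-- Polynomials in two variables `X 0`, `X 1`. -/
abbrev Poly : Type _ := MvPolynomial (Fin 2) F

variable {F}

/-- The derivation `∑ A i j X_i ∂/∂X_j` of `F[X_0, X_1]`: it extends the natural action of the
matrix `A` on the span of `X_0` and `X_1`. -/
def polyDer (A : SL2 F) : Derivation F (Poly F) (Poly F) :=
  ∑ i, ∑ j, A.1 i j • (MvPolynomial.X i : Poly F) • MvPolynomial.pderiv j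

lemma polyDer_apply (A : SL2 F) (p : Poly F) :
    polyDer A p =
      A.1 0 0 • (MvPolynomial.X 0 * MvPolynomial.pderiv 0 p) +
      A.1 0 1 • (MvPolynomial.X 0 * MvPolynomial.pderiv 1 p) +
      (A.1 1 0 • (MvPolynomial.X 1 * MvPolynomial.pderiv 0 p) +
      A.1 1 1 • (MvPolynomial.X 1 * MvPolynomial.pderiv 1 p)) := by
  simp [polyDer, Fin.sum_univ_two]

lemma polyDer_X (A : SL2 F) (j : Fin 2) :
    polyDer A (MvPolynomial.X j) =
      A.1 0 j • (MvPolynomial.X 0 : Poly F) + A.1 1 j • (MvPolynomial.X 1 : Poly F) := by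
  rw [polyDer_apply]
  fin_cases j <;> simp [MvPolynomial.pderiv_X]

lemma polyDer_add (A B : SL2 F) (p : Poly F) :
    polyDer (A + B) p = polyDer A p + polyDer B p := by
  simp only [polyDer_apply, show (A + B).1 = A.1 + B.1 from rfl,
    Matrix.add_apply]
  module

lemma polyDer_smul (c : F) (A : SL2 F) (p : Poly F) : polyDer (c • A) p = c • polyDer A p := by
  simp only [polyDer_apply, show (c • A).1 = c • A.1 from rfl,
    Matrix.smul_apply, smul_eq_mul]
  module

lemma polyDer_lie (A B : SL2 F) (p : Poly F) :
    polyDer ⁅A, B⁆ p = polyDer A (polyDer B p) - polyDer B (polyDer A p) := by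
  rw [← Derivation.commutator_apply]
  refine DFunLike.congr_fun (MvPolynomial.derivation_ext fun j => ?_) p
  rw [Derivation.commutator_apply]
  simp only [polyDer_X, map_add, Derivation.map_smul, LieAlgebra.SpecialLinear.sl_bracket,
    Matrix.sub_apply, Matrix.mul_apply, Fin.sum_univ_two]
  module

lemma trace_eq (A : SL2 F) : A.1 0 0 + A.1 1 1 = 0 := by
  have h : Matrix.trace A.1 = 0 := A.2
  rwa [Matrix.trace_fin_two] at h

lemma pderiv_comm (i j : Fin 2) (p : Poly F) :
    MvPolynomial.pderiv i (MvPolynomial.pderiv j p) =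
      MvPolynomial.pderiv j (MvPolynomial.pderiv i p) := by
  rw [← sub_eq_zero, ← Derivation.commutator_apply (R := F)]
  have : ⁅(MvPolynomial.pderiv i : Derivation F (Poly F) (Poly F)),
      (MvPolynomial.pderiv j : Derivation F (Poly F) (Poly F))⁆ = 0 := by
    refine MvPolynomial.derivation_ext fun k => ?_
    rw [Derivation.commutator_apply]
    fin_cases i <;> fin_cases j <;> fin_cases k <;> simp [MvPolynomial.pderiv_X]
  rw [this]
  rfl

lemma pderiv_polyDer (A : SL2 F) (k : Fin 2) (p : Poly F) :
    polyDer A (MvPolynomial.pderiv k p) = MvPolynomial.pderiv k (polyDer A p) -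
      (A.1 k 0 • MvPolynomial.pderiv 0 p + A.1 k 1 • MvPolynomial.pderiv 1 p) := by
  simp only [polyDer_apply, map_add, Derivation.map_smul, Derivation.leibniz, smul_eq_mul,
    pderiv_comm k]
  fin_cases k <;> simp [MvPolynomial.pderiv_X] <;> module

lemma polyDer_isHomogeneous (A : SL2 F) {a : ℕ} {p : Poly F} (hp : p.IsHomogeneous a) :
    (polyDer A p).IsHomogeneous a := by
  rcases Nat.eq_zero_or_pos a with rfl | ha
  · have h := MvPolynomial.totalDegree_eq_zero_iff_eq_C.1
      ((MvPolynomial.totalDegree_zero_iff_isHomogeneous _).2 hp)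
    rw [h]
    simpa [polyDer_apply] using MvPolynomial.isHomogeneous_zero (Fin 2) F 0
  · have key (i j : Fin 2) :
        (MvPolynomial.X i * MvPolynomial.pderiv j p : Poly F).IsHomogeneous a := by
      have h := (MvPolynomial.isHomogeneous_X F i).mul (hp.pderiv (i := j))
      rwa [Nat.add_sub_cancel' ha] at h
    have key' (c : F) (i j : Fin 2) :
        c • (MvPolynomial.X i * MvPolynomial.pderiv j p : Poly F) ∈
          MvPolynomial.homogeneousSubmodule (Fin 2) F a :=
      Submodule.smul_mem _ _ (key i j)
    rw [polyDer_apply]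
    exact Submodule.add_mem _ (Submodule.add_mem _ (key' _ _ _) (key' _ _ _))
      (Submodule.add_mem _ (key' _ _ _) (key' _ _ _))

variable (F)

/-- The irreducible `sl(2)`-module `V(a)` of highest weight `a`, realized as the space of binary
forms of degree `a`. -/
abbrev V (a : ℕ) : Type _ := MvPolynomial.homogeneousSubmodule (Fin 2) F a

variable {F}

/-- The action of `sl(2)` on `V(a)`. -/
def act (a : ℕ) (A : SL2 F) : V F a →ₗ[F] V F a :=
  ((polyDer A : Poly F →ₗ[F] Poly F)).restrict fun _ hp => polyDer_isHomogeneous A hp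

lemma coe_act (a : ℕ) (A : SL2 F) (p : V F a) : (act a A p : Poly F) = polyDer A p.1 := rfl

lemma act_add (a : ℕ) (A B : SL2 F) (p : V F a) : act a (A + B) p = act a A p + act a B p :=
  Subtype.ext (polyDer_add A B p.1)

lemma act_smul (a : ℕ) (c : F) (A : SL2 F) (p : V F a) : act a (c • A) p = c • act a A p :=
  Subtype.ext (polyDer_smul c A p.1)

lemma act_lie (a : ℕ) (A B : SL2 F) (p : V F a) :
    act a ⁅A, B⁆ p = act a A (act a B p) - act a B (act a A p) :=
  Subtype.ext (polyDer_lie A B p.1)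

/-! ### Transvectants: the `sl(2)`-maps `V(m) ⊗ V(b) → V(a)` -/

/-- The `k`-th transvectant `∑ (-1)^i (k choose i) (∂₀^(k-i) ∂₁^i p) (∂₀^i ∂₁^(k-i) q)`,
defined by recursion on `k`. -/
def transvectant : ℕ → Poly F →ₗ[F] Poly F →ₗ[F] Poly F
  | 0 => LinearMap.mul F (Poly F)
  | k + 1 =>
    (transvectant k).compl₁₂ (MvPolynomial.pderiv 0 : Derivation F (Poly F) (Poly F)).toLinearMap
        (MvPolynomial.pderiv 1 : Derivation F (Poly F) (Poly F)).toLinearMap -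
      (transvectant k).compl₁₂ (MvPolynomial.pderiv 1 : Derivation F (Poly F) (Poly F)).toLinearMap
        (MvPolynomial.pderiv 0 : Derivation F (Poly F) (Poly F)).toLinearMap

lemma transvectant_zero (p q : Poly F) : transvectant 0 p q = p * q := rfl

lemma transvectant_succ (k : ℕ) (p q : Poly F) :
    transvectant (k + 1) p q =
      transvectant k (MvPolynomial.pderiv 0 p) (MvPolynomial.pderiv 1 q) -
        transvectant k (MvPolynomial.pderiv 1 p) (MvPolynomial.pderiv 0 q) := rfl

lemma polyDer_transvectant (A : SL2 F) (k : ℕ) : ∀ p q : Poly F,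
    polyDer A (transvectant k p q) =
      transvectant k (polyDer A p) q + transvectant k p (polyDer A q) := by
  induction k with
  | zero =>
    intro p q
    simp only [transvectant_zero, Derivation.leibniz, smul_eq_mul]
    ring
  | succ k ih =>
    intro p q
    simp only [transvectant_succ, map_sub, ih, pderiv_polyDer, map_add, map_smul,
      LinearMap.sub_apply, LinearMap.add_apply, LinearMap.smul_apply]
    have h : A.1 1 1 = -A.1 0 0 := eq_neg_of_add_eq_zero_right (trace_eq A)
    rw [h]
    module

lemma transvectant_isHomogeneous (k : ℕ) : ∀ {m b : ℕ} {p q : Poly F},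
    p.IsHomogeneous m → q.IsHomogeneous b →
      (transvectant k p q).IsHomogeneous (m + b - 2 * k) := by
  induction k with
  | zero =>
    intro m b p q hp hq
    exact hp.mul hq
  | succ k ih =>
    intro m b p q hp hq
    have const {r : Poly F} (hr : r.IsHomogeneous 0) (i : Fin 2) : MvPolynomial.pderiv i r = 0 := by
      rw [MvPolynomial.totalDegree_eq_zero_iff_eq_C.1
        ((MvPolynomial.totalDegree_zero_iff_isHomogeneous _).2 hr), MvPolynomial.pderiv_C]
    rw [transvectant_succ]
    rcases Nat.eq_zero_or_pos m with rfl | hm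
    · simpa [const hp] using MvPolynomial.isHomogeneous_zero (Fin 2) F _
    rcases Nat.eq_zero_or_pos b with rfl | hb
    · simpa [const hq] using MvPolynomial.isHomogeneous_zero (Fin 2) F _
    have e : m + b - 2 * (k + 1) = (m - 1) + (b - 1) - 2 * k := by omega
    rw [e]
    exact (ih hp.pderiv hq.pderiv).sub (ih hp.pderiv hq.pderiv)

lemma polyDer_homogeneousComponent (A : SL2 F) {d : ℕ} (a : ℕ) {p : Poly F}
    (hp : p.IsHomogeneous d) :
    MvPolynomial.homogeneousComponent a (polyDer A p) =
      polyDer A (MvPolynomial.homogeneousComponent a p) := by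
  rw [MvPolynomial.homogeneousComponent_of_mem (polyDer_isHomogeneous A hp),
    MvPolynomial.homogeneousComponent_of_mem hp]
  split_ifs <;> simp

/-- The `sl(2)`-equivariant bilinear map `V(m) × V(b) → V(a)`, unique up to a scalar. It is the
transvectant of order `k = (m + b - a) / 2`, which is non-zero (in characteristic zero) exactly if
`a`, `b`, `m` satisfy `a + b ≡ m` mod `2` and `|m - b| ≤ a ≤ m + b`. If `m + b - 2k ≠ a`, the
projection to degree `a` makes it zero. -/
def pairing (m b a : ℕ) : V F m →ₗ[F] V F b →ₗ[F] V F a :=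
  LinearMap.mk₂ F
    (fun p q => ⟨MvPolynomial.homogeneousComponent a (transvectant ((m + b - a) / 2) p.1 q.1),
      MvPolynomial.homogeneousComponent_mem _ _⟩)
    (fun _ _ _ => Subtype.ext (by simp))
    (fun _ _ _ => Subtype.ext (by simp))
    (fun _ _ _ => Subtype.ext (by simp))
    (fun _ _ _ => Subtype.ext (by simp))

lemma coe_pairing (m b a : ℕ) (p : V F m) (q : V F b) :
    (pairing m b a p q : Poly F) =
      MvPolynomial.homogeneousComponent a (transvectant ((m + b - a) / 2) p.1 q.1) := rfl

lemma act_pairing (m b a : ℕ) (A : SL2 F) (p : V F m) (q : V F b) :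
    act a A (pairing m b a p q) = pairing m b a (act m A p) q + pairing m b a p (act b A q) := by
  apply Subtype.ext
  have hp : p.1.IsHomogeneous m := p.2
  have hq : q.1.IsHomogeneous b := q.2
  rw [coe_act, coe_pairing,
    ← polyDer_homogeneousComponent A a (transvectant_isHomogeneous _ hp hq),
    polyDer_transvectant, map_add]
  rfl

/-- The invariant bilinear form `V(m) × V(m) → V(0) = F`. -/
def form (m : ℕ) : V F m →ₗ[F] V F m →ₗ[F] F :=
  (transvectant m).compr₂ (MvPolynomial.lcoeff F 0) |>.compl₁₂
    (Submodule.subtype _) (Submodule.subtype _)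

lemma form_apply (m : ℕ) (p q : V F m) :
    form m p q = MvPolynomial.coeff 0 (transvectant m p.1 q.1) := rfl

lemma form_invariant (m : ℕ) (A : SL2 F) (p q : V F m) :
    form m (act m A p) q + form m p (act m A q) = 0 := by
  rw [form_apply, form_apply, ← MvPolynomial.coeff_add, coe_act, coe_act,
    ← polyDer_transvectant]
  simp [polyDer_apply, MvPolynomial.coeff_X_mul']

end Irreducible

/-! ### The Heisenberg algebra and the Galilean algebra -/

section Algebra

variable (F : Type*) [Field F] (n : ℕ)

/-- The underlying space `V(m) ⊕ V(0)`, `m = 2n - 1`, of the Heisenberg Lie algebra `𝔥_n`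
(for `n ≥ 1`). The second coordinate is the coordinate along the central element `z`. -/
@[ext] structure Heis where
  /-- The component in `𝔥_n(m) ≅ V(m)`. -/
  vec : V F (2 * n - 1)
  /-- The coordinate along `z`. -/
  cen : F

namespace Heis

variable {F n}

/-- The underlying space is a product. -/
def toProd : Heis F n ≃ V F (2 * n - 1) × F where
  toFun x := (x.vec, x.cen)
  invFun x := ⟨x.1, x.2⟩
  left_inv _ := rfl
  right_inv _ := rfl

instance : AddCommGroup (Heis F n) := toProd.addCommGroup

instance : Module F (Heis F n) := toProd.module F

@[simp] lemma zero_vec : (0 : Heis F n).vec = 0 := rfl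
@[simp] lemma zero_cen : (0 : Heis F n).cen = 0 := rfl
@[simp] lemma add_vec (x y : Heis F n) : (x + y).vec = x.vec + y.vec := rfl
@[simp] lemma add_cen (x y : Heis F n) : (x + y).cen = x.cen + y.cen := rfl
@[simp] lemma sub_vec (x y : Heis F n) : (x - y).vec = x.vec - y.vec := rfl
@[simp] lemma sub_cen (x y : Heis F n) : (x - y).cen = x.cen - y.cen := rfl
@[simp] lemma smul_vec (c : F) (x : Heis F n) : (c • x).vec = c • x.vec := rfl
@[simp] lemma smul_cen (c : F) (x : Heis F n) : (c • x).cen = c * x.cen := rfl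

/-- The bracket is `[(p, s), (q, t)] = (0, ω(p, q) - ω(q, p))`, where `ω` is the invariant form
of `V(m)`. As `m` is odd for `n ≥ 1`, `ω` is skew-symmetric and this is `2 ω(p, q)`. -/
instance : Bracket (Heis F n) (Heis F n) where
  bracket x y := ⟨0, form _ x.vec y.vec - form _ y.vec x.vec⟩

@[simp] lemma lie_vec (x y : Heis F n) : ⁅x, y⁆.vec = 0 := rfl
@[simp] lemma lie_cen (x y : Heis F n) :
    ⁅x, y⁆.cen = form _ x.vec y.vec - form _ y.vec x.vec := rfl

instance : LieRing (Heis F n) where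
  add_lie x y z := by
    ext1
    · simp
    · simp only [lie_cen, add_vec, add_cen, map_add, LinearMap.add_apply]; ring
  lie_add x y z := by
    ext1
    · simp
    · simp only [lie_cen, add_vec, add_cen, map_add, LinearMap.add_apply]; ring
  lie_self x := by ext1 <;> simp
  leibniz_lie x y z := by ext1 <;> simp

instance : LieAlgebra F (Heis F n) where
  lie_smul c x y := by
    ext1
    · simp
    · simp only [lie_cen, smul_vec, smul_cen, map_smul, LinearMap.smul_apply, smul_eq_mul]; ring

/-- The derivation of `𝔥_n` given by an element of `sl(2)`. -/
def der (A : SL2 F) : LieDerivation F (Heis F n) (Heis F n) where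
  toFun x := ⟨act _ A x.vec, 0⟩
  map_add' x y := by ext1 <;> simp
  map_smul' c x := by ext1 <;> simp
  leibniz' x y := by
    ext1
    · simp
    · have h1 := form_invariant _ A x.vec y.vec
      have h2 := form_invariant _ A y.vec x.vec
      simp only [LinearMap.coe_mk, AddHom.coe_mk, lie_cen, sub_cen]
      linear_combination h2 - h1

lemma der_vec (A : SL2 F) (x : Heis F n) : (der A x).vec = act _ A x.vec := rfl
lemma der_cen (A : SL2 F) (x : Heis F n) : (der A x).cen = 0 := rfl

variable (F n)

/-- The action of `sl(2)` on `𝔥_n` by derivations. -/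
def derHom : SL2 F →ₗ⁅F⁆ LieDerivation F (Heis F n) (Heis F n) where
  toFun A := der A
  map_add' A B := by
    ext x : 1
    rw [LieDerivation.add_apply]
    ext1
    · simp only [der_vec, add_vec, act_add]
    · simp [der_cen]
  map_smul' c A := by
    ext x : 1
    rw [LieDerivation.smul_apply]
    ext1
    · simp only [der_vec, smul_vec, act_smul, RingHom.id_apply]
    · simp [der_cen]
  map_lie' {A B} := by
    ext x : 1
    rw [LieDerivation.commutator_apply]
    ext1
    · simp only [der_vec, sub_vec, act_lie]
    · simp [der_cen]

end Heis

/-- The Galilean Lie algebra `sl(2) ⋉ 𝔥_n`. -/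
abbrev Gal : Type _ := LieAlgebra.SemiDirectSum (Heis F n) (SL2 F) (Heis.derHom F n)

/-- The inclusion `sl(2) → sl(2) ⋉ 𝔥_n`. -/
abbrev ofSL2 : SL2 F →ₗ⁅F⁆ Gal F n := LieAlgebra.SemiDirectSum.inr (Heis.derHom F n)

/-- The inclusion `𝔥_n → sl(2) ⋉ 𝔥_n`. -/
abbrev ofHeis : Heis F n →ₗ⁅F⁆ Gal F n := LieAlgebra.SemiDirectSum.inl (Heis.derHom F n)

/-- The Levi factor `sl(2)` as a subalgebra of `sl(2) ⋉ 𝔥_n`. Every module over `sl(2) ⋉ 𝔥_n` is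
a module over it by restriction. -/
abbrev levi : LieSubalgebra F (Gal F n) := (ofSL2 F n).range

end Algebra

/-! ### The modules `V(a)`, `E(a, b)` and `FU` over `sl(2) ⋉ 𝔥_n` -/

section Modules

variable (F : Type*) [Field F] (n : ℕ)

/-- `V(a)` as a module over `sl(2) ⋉ 𝔥_n`: the ideal `𝔥_n` acts trivially. -/
instance (a : ℕ) : LieRingModule (Gal F n) (V F a) where
  bracket x p := act a x.right p
  add_lie x y p := act_add a x.right y.right p
  lie_add x p q := map_add (act a x.right) p q
  leibniz_lie x y p := by
    change act a x.right (act a y.right p) =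
      act a ⁅x.right, y.right⁆ p + act a y.right (act a x.right p)
    rw [act_lie]
    abel

lemma lie_V (a : ℕ) (x : Gal F n) (p : V F a) : ⁅x, p⁆ = act a x.right p := rfl

instance (a : ℕ) : LieModule F (Gal F n) (V F a) where
  smul_lie c x p := act_smul a c x.right p
  lie_smul c x p := map_smul (act a x.right) c p

/-- The underlying space `V(a) ⊕ V(b)` of the module `E(a, b)`. -/
def E (a b : ℕ) : Type _ := V F a × V F b

namespace E

variable {F} (a b : ℕ)

instance : AddCommGroup (E F a b) := inferInstanceAs (AddCommGroup (V F a × V F b))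

instance : Module F (E F a b) := inferInstanceAs (Module F (V F a × V F b))

/-- `sl(2)` acts componentwise, `𝔥_n(m) = V(m)` annihilates `V(a)` and maps `V(b)` to `V(a)` by
the `sl(2)`-equivariant pairing, and `z` acts by zero. -/
instance : LieRingModule (Gal F n) (E F a b) where
  bracket x p :=
    (act a x.right p.1 + pairing (2 * n - 1) b a x.left.vec p.2, act b x.right p.2)
  add_lie x y p := by
    apply Prod.ext
    · change act a (x.right + y.right) p.1 + pairing _ b a (x.left.vec + y.left.vec) p.2 =
        act a x.right p.1 + pairing _ b a x.left.vec p.2 +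
          (act a y.right p.1 + pairing _ b a y.left.vec p.2)
      rw [act_add, map_add, LinearMap.add_apply]
      abel
    · exact act_add b x.right y.right p.2
  lie_add x p q := by
    apply Prod.ext
    · change act a x.right (p.1 + q.1) + pairing _ b a x.left.vec (p.2 + q.2) =
        act a x.right p.1 + pairing _ b a x.left.vec p.2 +
          (act a x.right q.1 + pairing _ b a x.left.vec q.2)
      rw [map_add, map_add]
      abel
    · exact map_add (act b x.right) p.2 q.2
  leibniz_lie x y p := by
    apply Prod.ext
    · change act a x.right (act a y.right p.1 + pairing _ b a y.left.vec p.2) +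
          pairing _ b a x.left.vec (act b y.right p.2) =
        act a ⁅x.right, y.right⁆ p.1 +
          pairing _ b a (0 + act _ x.right y.left.vec - act _ y.right x.left.vec) p.2 +
        (act a y.right (act a x.right p.1 + pairing _ b a x.left.vec p.2) +
          pairing _ b a y.left.vec (act b x.right p.2))
      rw [map_add, map_add, act_pairing, act_pairing, act_lie, zero_add, map_sub,
        LinearMap.sub_apply]
      abel
    · change act b x.right (act b y.right p.2) =
        act b ⁅x.right, y.right⁆ p.2 + act b y.right (act b x.right p.2)
      rw [act_lie]
      abel

lemma lie_def (x : Gal F n) (p : E F a b) :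
    ⁅x, p⁆ = ((act a x.right p.1 + pairing (2 * n - 1) b a x.left.vec p.2,
      act b x.right p.2) : V F a × V F b) := rfl

instance : LieModule F (Gal F n) (E F a b) where
  smul_lie c x p := by
    apply Prod.ext
    · change act a (c • x.right) p.1 + pairing _ b a (c • x.left.vec) p.2 =
        c • (act a x.right p.1 + pairing _ b a x.left.vec p.2)
      rw [act_smul, map_smul, LinearMap.smul_apply, smul_add]
    · exact act_smul b c x.right p.2
  lie_smul c x p := by
    apply Prod.ext
    · change act a x.right (c • p.1) + pairing _ b a x.left.vec (c • p.2) =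
        c • (act a x.right p.1 + pairing _ b a x.left.vec p.2)
      rw [map_smul, map_smul, smul_add]
    · exact map_smul (act b x.right) c p.2

/-- The blocks of the decomposition `E(a, b) = V(a) ⊕ V(b)`: block `0` is `V(a)`, block `1` is
`V(b)`, all others are zero. -/
def block : ℕ → LieSubmodule F (levi F n) (E F a b)
  | 0 =>
    { toSubmodule := (LinearMap.ker (LinearMap.snd F (V F a) (V F b)) :
        Submodule F (V F a × V F b))
      lie_mem := by
        rintro ⟨_, A, rfl⟩ p hp
        have hp' : p.2 = 0 := hp
        change act b A p.2 = 0
        rw [hp', map_zero] }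
  | 1 =>
    { toSubmodule := (LinearMap.ker (LinearMap.fst F (V F a) (V F b)) :
        Submodule F (V F a × V F b))
      lie_mem := by
        rintro ⟨_, A, rfl⟩ p hp
        have hp' : p.1 = 0 := hp
        change act a A p.1 + pairing _ b a 0 p.2 = 0
        rw [hp', map_zero, map_zero, LinearMap.zero_apply, add_zero] }
  | _ + 2 => ⊥

end E

/-- `M` is isomorphic to the module `V(a₀) ⊕ V(a₁) ⊕ V(a₀)` on which `sl(2)` acts componentwise,
`𝔥_n(m) = V(m)` acts by the equivariant pairings `V(a₀) ← V(a₁) ← V(a₀)`, and `z` acts as a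
scalar multiple of the identity from the last summand to the first. (The scalar is determined by
the fact that `M` is a module.) -/
def IsFU (a₀ a₁ : ℕ) (M : Type*) [AddCommGroup M] [Module F M] [LieRingModule (Gal F n) M] :
    Prop :=
  ∃ (c : F) (φ : M ≃ₗ[F] V F a₀ × V F a₁ × V F a₀), ∀ (x : Gal F n) (v : M),
    φ ⁅x, v⁆ =
      (act a₀ x.right (φ v).1 + pairing (2 * n - 1) a₁ a₀ x.left.vec (φ v).2.1 +
          (c * x.left.cen) • (φ v).2.2,
        act a₁ x.right (φ v).2.1 + pairing (2 * n - 1) a₀ a₁ x.left.vec (φ v).2.2,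
        act a₀ x.right (φ v).2.2)

end Modules

/-! ### Socle series and uniserial modules -/

section Socle

variable (R L M : Type*) [CommRing R] [LieRing L] [LieAlgebra R L]
  [AddCommGroup M] [Module R M] [LieRingModule L M] [LieModule R L M]

/-- The socle: the sum of all irreducible submodules. -/
def socle : LieSubmodule R L M :=
  sSup {N : LieSubmodule R L M | LieModule.IsIrreducible R L N}

/-- The socle series: `soc⁰ = 0` and `socⁱ⁺¹ / socⁱ = soc(M / socⁱ)`. -/
def socleSeries : ℕ → LieSubmodule R L M
  | 0 => ⊥
  | i + 1 => (socle R L (M ⧸ socleSeries i)).comap (LieSubmodule.Quotient.mk' (socleSeries i))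

/-- A module is uniserial if its socle series is a composition series: it reaches `M`, and its
factors `socⁱ⁺¹ / socⁱ = soc(M / socⁱ)` are irreducible up to there. -/
def IsUniserial : Prop :=
  ∃ N : ℕ, socleSeries R L M N = ⊤ ∧
    ∀ i < N, LieModule.IsIrreducible R L (socle R L (M ⧸ socleSeries R L M i))

end Socle

section Main

variable {F : Type*} [Field F] {n : ℕ}

section

variable (F n) (M : Type*) [AddCommGroup M] [Module F M] [LieRingModule (Gal F n) M]
  [LieModule F (Gal F n) M]

/-- Standard faithful uniserial modules: the faithful uniserial modules that are not isomorphic to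
the exceptional module `FU_(4,3,4)`, which exists only for `n = 2`. -/
def IsStandardFaithful : Prop :=
  IsUniserial F (Gal F n) M ∧ LieModule.IsFaithful F (Gal F n) M ∧ ¬ (n = 2 ∧ IsFU F n 4 3 M)

end

/-- `M = V(a 0) ⊕ ⋯ ⊕ V(a ℓ)` is a socle decomposition: the `C i`, `i ≤ ℓ`, are `sl(2)`-submodules
isomorphic to `V(a i)`, their sum is direct and equal to `M`, and the sum of the first `k` of them
is the `k`-th term of the socle series (so that `C i` is a complement of `socⁱ` in `socⁱ⁺¹`).
For convenience `C i = 0` for `i > ℓ`. -/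
structure IsSocleDecomposition {M : Type*} [AddCommGroup M] [Module F M]
    [LieRingModule (Gal F n) M] [LieModule F (Gal F n) M]
    (ℓ : ℕ) (a : ℕ → ℕ) (C : ℕ → LieSubmodule F (levi F n) M) : Prop where
  equiv : ∀ i ≤ ℓ, Nonempty (C i ≃ₗ⁅F, levi F n⁆ V F (a i))
  eq_bot : ∀ i, ℓ < i → C i = ⊥
  indep : iSupIndep C
  iSup_eq_top : ⨆ i, C i = ⊤
  partial_sum : ∀ k ≤ ℓ + 1,
    ((⨆ i, ⨆ _ : i < k, C i : LieSubmodule F (levi F n) M) : Submodule F M) =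
      (socleSeries F (Gal F n) M k : Submodule F M)

variable {M N : Type*} [AddCommGroup M] [Module F M] [LieRingModule (Gal F n) M]
  [LieModule F (Gal F n) M] [AddCommGroup N] [Module F N] [LieRingModule (Gal F n) N]
  [LieModule F (Gal F n) N]

variable (n) in
/-- The subspace `M^{𝔥_n}` of `𝔥_n`-invariants, as an `sl(2)`-submodule. -/
def heisInvariants (M : Type*) [AddCommGroup M] [Module F M] [LieRingModule (Gal F n) M]
    [LieModule F (Gal F n) M] : LieSubmodule F (levi F n) M where
  carrier := {u | ∀ x : Heis F n, ⁅ofHeis F n x, u⁆ = 0}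
  zero_mem' := fun x => lie_zero _
  add_mem' := fun {u v} hu hv x => by rw [lie_add, hu x, hv x, add_zero]
  smul_mem' := fun c u hu x => by rw [lie_smul, hu x, smul_zero]
  lie_mem := by
    rintro ⟨_, A, rfl⟩ u hu x
    change ⁅ofHeis F n x, ⁅ofSL2 F n A, u⁆⁆ = 0
    have h : ⁅ofHeis F n x, ofSL2 F n A⁆ = ofHeis F n (-Heis.derHom F n A x) := by
      simp
    rw [leibniz_lie, h, hu, hu x, lie_zero, add_zero]

/-- `V(a_i) ⊗ V(b_j)` inside `M ⊗ N`. -/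
def tensorBlock (C : LieSubmodule F (levi F n) M) (D : LieSubmodule F (levi F n) N) :
    LieSubmodule F (levi F n) (M ⊗[F] N) :=
  (TensorProduct.LieModule.mapIncl C D).range

/-- `S_t = (⨁_{i + j = t} V(a_i) ⊗ V(b_j))^{𝔥_n}`, as an `sl(2)`-submodule of `M ⊗ N`. -/
def S (C : ℕ → LieSubmodule F (levi F n) M) (D : ℕ → LieSubmodule F (levi F n) N) (t : ℕ) :
    LieSubmodule F (levi F n) (M ⊗[F] N) :=
  (⨆ i, ⨆ j, ⨆ _ : i + j = t, tensorBlock (C i) (D j)) ⊓ heisInvariants n (M ⊗[F] N)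

variable (n) in
/-- `v` is a (non-zero) highest weight vector of weight `μ` for `sl(2)`. -/
def IsHighestWeightVector (μ : F) (v : M) : Prop :=
  v ≠ 0 ∧ ⁅ofSL2 F n (eMat F), v⁆ = 0 ∧ ⁅ofSL2 F n (hMat F), v⁆ = μ • v

end Main

end Galilean

end

noncomputable section

namespace Galilean

/-! ### Coordinates on binary forms -/

section Coordinates

variable {F : Type*} [Field F]

/-! In coordinates adapted to a socle decomposition (`Frame`), `𝔥_n` acts by strictly upper
triangular block matrices: diagonal blocks of `V(m)` vanish because `m` is odd, and `z` is a
commutator. The blocks `X i (i+1)` of `V(m)` next to the diagonal are non-zero, since otherwise the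
socle series would grow faster (`Frame.X_ne_zero`). The blocks `Z i j` of `z` vanish for `j ≤ i +
1`, so for a faithful module of length three `Z 0 2 ≠ 0`, and by Schur `a 0 = a 2`.

Let `u ∈ S_t` have components `u_ij`, `i + j = t`. Invariance under `V(m)` gives `(X_{i,i+1}(p) ⊗ 1)
u_{i+1,j} + (1 ⊗ X_{j,j+1}(p)) u_{i,j+1} = 0` for `i + j + 1 = t`. No non-zero vector is killed by
all `X_{i,i+1}(p)`, so a single vanishing component forces `u = 0` (`eq_zero_of_comp_eq_zero`).
Hence `S_t` embeds in each of its blocks, it vanishes for large `t`, and all components of a highest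
weight vector are non-zero.

The main point is that an adjacent pair of highest weight vectors satisfying this equation can exist
only for one weight `μ`. A mixed Casimir operator acts on each of the two vectors by a scalar;
transporting both identities to `V(a_i) ⊗ V(b_j)` gives relations so rigid that one of `m, μ, a_i,
b_j` is zero or the sum of the other three (`degenerate_of_chain`, `isLink_of_highestWeight`).
Together with the Clebsch-Gordan inequalities this determines `μ` (`IsLink.unique`). As highest
weight vectors of a given weight in `V(a) ⊗ V(b)` are unique up to a scalar, `S_t` is irreducible
for `t ≥ 1` (`le_of_stable`, `S_isIrreducible`).

For `S_2` the equation for `z` reads `(Z ⊗ 1) u_20 + (1 ⊗ Z) u_02 = 0`, so `S_2 ≠ 0` forces `Z 0 2 ≠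
0` on the second module too, which makes that module faithful. Then `a 0 = a 2` and `b 0 = b 2`, and
the two adjacent pairs give the numerical conditions twice with the roles of the blocks exchanged;
this forces `μ = 0` and `a_i = b_i` (`IsLink.eq_of_double`). Conversely, if the `a_i` and `b_i`
agree, uniqueness of equivariant bilinear maps makes the blocks proportional, a trace argument rules
out a fourth block (`Frame.length_le_two`), rescaling gives an isomorphism, and suitable multiples
of the invariants of `V(a_i) ⊗ V(a_i)` add up to an element of `S_2` (`S_two_ne_bot`). Finally,
`S_1` only involves the first superdiagonal blocks, which up to scalars are those of `E(a_0, a_1)`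
and `E(b_0, b_1)`. -/

variable (F) in
/-- The standard element `f = (0 0; 1 0)`. -/
def fMat : SL2 F := ⟨!![0, 0; 1, 0], by
  change Matrix.trace (_ : Matrix (Fin 2) (Fin 2) F) = 0
  simp [Matrix.trace_fin_two]⟩

lemma sl2_eq (A : SL2 F) :
    A = A.1 0 1 • eMat F + A.1 1 0 • fMat F + A.1 0 0 • hMat F := by
  have h := trace_eq A
  apply Subtype.ext
  change A.1 = A.1 0 1 • !![0, 1; 0, 0] + A.1 1 0 • !![0, 0; 1, 0] + A.1 0 0 • !![1, 0; 0, -1]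
  ext i j
  fin_cases i <;> fin_cases j <;> simp
  linear_combination h

lemma lie_e_f : ⁅eMat F, fMat F⁆ = hMat F := by
  apply Subtype.ext
  rw [LieAlgebra.SpecialLinear.sl_bracket]
  change !![0, 1; 0, 0] * !![0, 0; 1, 0] - !![0, 0; 1, 0] * !![0, 1; 0, 0] = !![1, 0; 0, -1]
  ext i j
  fin_cases i <;> fin_cases j <;> simp

lemma lie_h_f : ⁅hMat F, fMat F⁆ = (-2 : F) • fMat F := by
  apply Subtype.ext
  rw [LieAlgebra.SpecialLinear.sl_bracket]
  change !![1, 0; 0, -1] * !![0, 0; 1, 0] - !![0, 0; 1, 0] * !![1, 0; 0, -1] =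
    (-2 : F) • !![0, 0; 1, 0]
  ext i j
  fin_cases i <;> fin_cases j <;> simp
  ring

/-- The exponent of the monomial `X₀^(a-i) X₁^i`. -/
def expo (a i : ℕ) : Fin 2 →₀ ℕ := Finsupp.single 0 (a - i) + Finsupp.single 1 i

@[simp] lemma expo_zero (a i : ℕ) : expo a i 0 = a - i := by simp [expo]
@[simp] lemma expo_one (a i : ℕ) : expo a i 1 = i := by simp [expo]

lemma degree_expo {a i : ℕ} (h : i ≤ a) : (expo a i).degree = a := by
  simp [expo, Finsupp.degree_eq_sum, Fin.sum_univ_two, h]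

lemma expo_inj {a i j : ℕ} : expo a i = expo a j ↔ i = j := by
  refine ⟨fun h => ?_, fun h => h ▸ rfl⟩
  simpa using DFunLike.congr_fun h 1

lemma eq_expo {a : ℕ} {d : Fin 2 →₀ ℕ} (h : d.degree = a) : d = expo a (d 1) := by
  simp only [Finsupp.degree_eq_sum, Fin.sum_univ_two] at h
  ext i
  fin_cases i <;> simp
  omega

/-- The coefficient of `X₀^(a-i) X₁^i`. -/
def cf (a i : ℕ) : V F a →ₗ[F] F :=
  (MvPolynomial.lcoeff F (expo a i)).comp (Submodule.subtype _)

lemma cf_apply (a i : ℕ) (p : V F a) : cf a i p = MvPolynomial.coeff (expo a i) p.1 := rfl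

lemma cf_eq_zero {a i : ℕ} (h : a < i) (p : V F a) : cf a i p = 0 := by
  have hp : p.1.IsHomogeneous a := p.2
  refine hp.coeff_eq_zero ?_
  simp [expo, Finsupp.degree_eq_sum, Fin.sum_univ_two]
  omega

lemma V_ext {a : ℕ} {p q : V F a} (h : ∀ i ≤ a, cf a i p = cf a i q) : p = q := by
  apply Subtype.ext
  ext d
  have hp : p.1.IsHomogeneous a := p.2
  have hq : q.1.IsHomogeneous a := q.2
  by_cases hd : d.degree = a
  · rw [eq_expo hd]
    refine h _ ?_
    simp only [Finsupp.degree_eq_sum, Fin.sum_univ_two] at hd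
    omega
  · rw [hp.coeff_eq_zero hd, hq.coeff_eq_zero hd]

/-- The monomial `X₀^(a-i) X₁^i`, or zero if `i > a`. -/
def mono (a i : ℕ) : V F a :=
  if h : i ≤ a then ⟨MvPolynomial.monomial (expo a i) 1,
    MvPolynomial.isHomogeneous_monomial _ (degree_expo h)⟩ else 0

lemma coe_mono {a i : ℕ} (h : i ≤ a) :
    (mono a i : V F a).1 = MvPolynomial.monomial (expo a i) 1 := by
  simp [mono, h]

lemma mono_eq_zero {a i : ℕ} (h : a < i) : (mono a i : V F a) = 0 := by
  simp [mono, h]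

lemma cf_mono {a i : ℕ} (h : i ≤ a) (j : ℕ) :
    cf a j (mono a i : V F a) = if j = i then 1 else 0 := by
  classical
  rw [cf_apply, coe_mono h, MvPolynomial.coeff_monomial]
  simp only [expo_inj, eq_comm]

lemma coeff_X_mul_pderiv_same (i : Fin 2) (p : Poly F) (d : Fin 2 →₀ ℕ) :
    MvPolynomial.coeff d (MvPolynomial.X i * MvPolynomial.pderiv i p) =
      d i * MvPolynomial.coeff d p := by
  classical
  rw [MvPolynomial.coeff_X_mul']
  split_ifs with h
  · have h1 : 1 ≤ d i := Nat.one_le_iff_ne_zero.2 (by simpa using h)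
    have h2 : d - Finsupp.single i 1 + Finsupp.single i 1 = d :=
      tsub_add_cancel_of_le (by simpa using h1)
    rw [MvPolynomial.coeff_pderiv, h2]
    simp [Nat.cast_sub h1, mul_comm]
  · have : d i = 0 := by simpa using h
    simp [this]

lemma cf_act_e {a : ℕ} (i : ℕ) (p : V F a) :
    cf a i (act a (eMat F) p) = (i + 1) * cf a (i + 1) p := by
  rcases lt_or_ge a (i + 1) with h | h
  · rw [cf_eq_zero h, mul_zero]
    rcases lt_or_ge a i with h' | h'
    · exact cf_eq_zero h' _
    have : i = a := by omega
    subst this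
    classical
    rw [cf_apply, coe_act, polyDer_apply]
    simp [eMat, MvPolynomial.coeff_X_mul', expo]
  · classical
    rw [cf_apply, coe_act, polyDer_apply, cf_apply]
    have h1 : expo a i - Finsupp.single 0 1 + Finsupp.single 1 1 = expo a (i + 1) := by
      ext j
      fin_cases j <;> simp
      omega
    have h0 : a - i ≠ 0 := by omega
    simp [eMat, MvPolynomial.coeff_X_mul', MvPolynomial.coeff_pderiv, h1, h0, mul_comm]

lemma cf_act_f_zero {a : ℕ} (p : V F a) : cf a 0 (act a (fMat F) p) = 0 := by
  classical
  rw [cf_apply, coe_act, polyDer_apply]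
  simp [fMat, MvPolynomial.coeff_X_mul']

lemma cf_act_f {a : ℕ} (i : ℕ) (p : V F a) :
    cf a (i + 1) (act a (fMat F) p) = (a - i) * cf a i p := by
  rcases lt_trichotomy a i with h | h | h
  · rw [cf_eq_zero h, cf_eq_zero (by omega), mul_zero]
  · subst h
    rw [cf_eq_zero (Nat.lt_succ_self _), sub_self, zero_mul]
  · classical
    rw [cf_apply, coe_act, polyDer_apply, cf_apply]
    have h1 : expo a (i + 1) - Finsupp.single 1 1 + Finsupp.single 0 1 = expo a i := by
      ext j
      fin_cases j <;> simp
      omega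
    have h2 : ((a - (i + 1) : ℕ) : F) + 1 = a - i := by
      rw [Nat.cast_sub (by omega)]
      push_cast
      ring
    simp [fMat, MvPolynomial.coeff_X_mul', MvPolynomial.coeff_pderiv, h1, h2, mul_comm]

lemma cf_act_h {a : ℕ} (i : ℕ) (p : V F a) :
    cf a i (act a (hMat F) p) = (a - 2 * i) * cf a i p := by
  rcases lt_or_ge a i with h | h
  · rw [cf_eq_zero h, cf_eq_zero h, mul_zero]
  · rw [cf_apply, coe_act, polyDer_apply, cf_apply]
    simp only [hMat, MvPolynomial.coeff_add, MvPolynomial.coeff_smul, coeff_X_mul_pderiv_same]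
    simp [Nat.cast_sub h]
    ring

end Coordinates

/-! ### Binary forms as an abstract module

`Bin F a` is a copy of `V F a` whose module structure is sealed, so that tensor products and spaces
of linear maps built from it carry only one additive structure up to reducible unfolding. -/

section Bin

variable {F : Type*} [Field F]

variable (F) in
/-- The space of binary forms of degree `a`. -/
def Bin (a : ℕ) : Type _ := V F a

instance (a : ℕ) : AddCommGroup (Bin F a) := inferInstanceAs (AddCommGroup (V F a))

instance (a : ℕ) : Module F (Bin F a) := inferInstanceAs (Module F (V F a))

/-- The identity map `V(a) → Bin(a)`. -/
def toBin (a : ℕ) : V F a ≃ₗ[F] Bin F a where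
  toFun p := p
  invFun p := p
  left_inv _ := rfl
  right_inv _ := rfl
  map_add' _ _ := rfl
  map_smul' _ _ := rfl

/-- The action of `sl(2)` on binary forms. -/
def bact (a : ℕ) (A : SL2 F) : Bin F a →ₗ[F] Bin F a :=
  (toBin a).toLinearMap ∘ₗ act a A ∘ₗ (toBin a).symm.toLinearMap

lemma bact_add (a : ℕ) (A B : SL2 F) (p : Bin F a) : bact a (A + B) p = bact a A p + bact a B p :=
  act_add a A B p

lemma bact_smul (a : ℕ) (c : F) (A : SL2 F) (p : Bin F a) : bact a (c • A) p = c • bact a A p :=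
  act_smul a c A p

lemma bact_lie (a : ℕ) (A B : SL2 F) (p : Bin F a) :
    bact a ⁅A, B⁆ p = bact a A (bact a B p) - bact a B (bact a A p) :=
  act_lie a A B p

/-- The coefficient of `X₀^(a-i) X₁^i`. -/
def bcf (a i : ℕ) : Bin F a →ₗ[F] F := cf a i ∘ₗ (toBin a).symm.toLinearMap

/-- The monomial `X₀^(a-i) X₁^i`, or zero if `i > a`. -/
def bmono (a i : ℕ) : Bin F a := toBin a (mono a i)

lemma bcf_eq_zero {a i : ℕ} (h : a < i) (p : Bin F a) : bcf a i p = 0 := cf_eq_zero h p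

lemma Bin_ext {a : ℕ} {p q : Bin F a} (h : ∀ i ≤ a, bcf a i p = bcf a i q) : p = q := V_ext h

lemma bmono_eq_zero {a i : ℕ} (h : a < i) : (bmono a i : Bin F a) = 0 := mono_eq_zero h

lemma bcf_bmono {a i : ℕ} (h : i ≤ a) (j : ℕ) :
    bcf a j (bmono a i : Bin F a) = if j = i then 1 else 0 := cf_mono h j

lemma eq_sum_bmono {a : ℕ} (p : Bin F a) :
    p = ∑ i ∈ Finset.range (a + 1), bcf a i p • bmono a i := by
  refine Bin_ext fun j hj => ?_
  rw [map_sum, Finset.sum_eq_single j]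
  · simp [bcf_bmono hj]
  · intro i hi hij
    rw [map_smul, bcf_bmono (by simpa [Nat.lt_succ_iff] using hi), if_neg (Ne.symm hij), smul_zero]
  · intro h
    simp at h
    omega

lemma bcf_bact_e {a : ℕ} (i : ℕ) (p : Bin F a) :
    bcf a i (bact a (eMat F) p) = (i + 1) * bcf a (i + 1) p := cf_act_e i p

lemma bcf_bact_f_zero {a : ℕ} (p : Bin F a) : bcf a 0 (bact a (fMat F) p) = 0 := cf_act_f_zero p

lemma bcf_bact_f {a : ℕ} (i : ℕ) (p : Bin F a) :
    bcf a (i + 1) (bact a (fMat F) p) = (a - i) * bcf a i p := cf_act_f i p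

lemma bcf_bact_h {a : ℕ} (i : ℕ) (p : Bin F a) :
    bcf a i (bact a (hMat F) p) = (a - 2 * i) * bcf a i p := cf_act_h i p

end Bin

/-! ### Equivariant maps between the modules `V(a)` -/

section Equivariant

variable {F : Type*} [Field F]

lemma bact_e_bmono_zero (a : ℕ) : bact a (eMat F) (bmono a 0) = 0 :=
  Bin_ext fun i _ => by rw [bcf_bact_e, bcf_bmono (Nat.zero_le _)]; simp

lemma bact_e_bmono {a i : ℕ} (h : i + 1 ≤ a) :
    bact a (eMat F) (bmono a (i + 1)) = ((i : F) + 1) • bmono a i := by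
  refine Bin_ext fun j _ => ?_
  rw [bcf_bact_e, bcf_bmono h, map_smul, bcf_bmono (by omega)]
  by_cases hj : j = i <;> simp [hj]

lemma bact_f_bmono {a i : ℕ} (h : i ≤ a) :
    bact a (fMat F) (bmono a i) = ((a : F) - i) • bmono a (i + 1) := by
  refine Bin_ext fun j _ => ?_
  rcases eq_or_lt_of_le h with rfl | h'
  · rw [sub_self, zero_smul, map_zero]
    rcases j with _ | j
    · rw [bcf_bact_f_zero]
    · rw [bcf_bact_f, bcf_bmono le_rfl]
      split_ifs with hj <;> simp [hj]
  · rcases j with _ | j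
    · rw [bcf_bact_f_zero, map_smul, bcf_bmono h']
      simp
    · rw [bcf_bact_f, bcf_bmono h, map_smul, bcf_bmono h']
      by_cases hj : j = i <;> simp [hj]

lemma bact_h_bmono {a i : ℕ} (h : i ≤ a) :
    bact a (hMat F) (bmono a i) = ((a : F) - 2 * i) • bmono a i := by
  refine Bin_ext fun j _ => ?_
  rw [bcf_bact_h, bcf_bmono h, map_smul, bcf_bmono h]
  by_cases hj : j = i <;> simp [hj]

lemma bmono_zero_ne_zero (a : ℕ) : (bmono a 0 : Bin F a) ≠ 0 := fun h => by
  have := bcf_bmono (F := F) (Nat.zero_le a) 0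
  rw [h] at this
  simp at this

lemma exists_bcf_ne_zero {a : ℕ} {p : Bin F a} (hp : p ≠ 0) : ∃ i ≤ a, bcf a i p ≠ 0 := by
  by_contra! h
  exact hp (Bin_ext fun i hi => by rw [h i hi, map_zero])

variable [CharZero F]

lemma eq_top_of_f_stable {a : ℕ} {W : Submodule F (Bin F a)}
    (hf : ∀ p ∈ W, bact a (fMat F) p ∈ W) (h0 : bmono a 0 ∈ W) : W = ⊤ := by
  have key : ∀ i ≤ a, bmono a i ∈ W := by
    intro i
    induction i with
    | zero => exact fun _ => h0
    | succ i ih =>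
      intro hi
      have h := hf _ (ih (by omega))
      rw [bact_f_bmono (by omega)] at h
      refine (W.smul_mem_iff ?_).1 h
      rw [sub_ne_zero, Ne, Nat.cast_inj]
      omega
  refine eq_top_iff.2 fun p _ => ?_
  rw [eq_sum_bmono p]
  exact W.sum_mem fun i hi => W.smul_mem _ (key i (by simpa [Nat.lt_succ_iff] using hi))

lemma eq_top_of_e_stable {a : ℕ} {W : Submodule F (Bin F a)}
    (he : ∀ p ∈ W, bact a (eMat F) p ∈ W) (h0 : bmono a a ∈ W) : W = ⊤ := by
  have key : ∀ i ≤ a, bmono a (a - i) ∈ W := by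
    intro i
    induction i with
    | zero => exact fun _ => h0
    | succ i ih =>
      intro hi
      have h := he _ (ih (by omega))
      rw [show a - i = (a - (i + 1)) + 1 by omega, bact_e_bmono (by omega)] at h
      exact (W.smul_mem_iff (Nat.cast_add_one_ne_zero _)).1 h
  refine eq_top_iff.2 fun p _ => ?_
  rw [eq_sum_bmono p]
  refine W.sum_mem fun i hi => W.smul_mem _ ?_
  have hi' : i ≤ a := by simpa [Nat.lt_succ_iff] using hi
  simpa [Nat.sub_sub_self hi'] using key (a - i) (Nat.sub_le _ _)

/-- Irreducibility of `V(a)`. Applying `e` repeatedly to a non-zero element lowers its degree in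
`X₁` until only a multiple of `X₀^a` is left, and `f` regenerates everything from there. -/
lemma eq_top_of_stable {a : ℕ} {W : Submodule F (Bin F a)}
    (hs : ∀ A, ∀ p ∈ W, bact a A p ∈ W) (h : W ≠ ⊥) : W = ⊤ := by
  refine eq_top_of_f_stable (hs _) ?_
  have key : ∀ N : ℕ, ∀ q ∈ W, q ≠ 0 → (∀ j, N < j → bcf a j q = 0) → bmono a 0 ∈ W := by
    intro N
    induction N with
    | zero =>
      intro q hq hq0 hj
      have h1 : q = bcf a 0 q • bmono a 0 := Bin_ext fun i _ => by
        rw [map_smul, bcf_bmono (Nat.zero_le _)]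
        rcases i with _ | i
        · simp
        · simp [hj (i + 1) (by omega)]
      have h2 : bcf a 0 q ≠ 0 := fun h0 => hq0 (by rw [h1, h0, zero_smul])
      rw [h1] at hq
      exact (W.smul_mem_iff h2).1 hq
    | succ N ih =>
      intro q hq hq0 hj
      by_cases h1 : bcf a (N + 1) q = 0
      · refine ih q hq hq0 fun j hj' => ?_
        rcases eq_or_lt_of_le (Nat.succ_le_of_lt hj') with rfl | h2
        · exact h1
        · exact hj j h2
      · refine ih _ (hs (eMat F) q hq) (fun h0 => ?_) fun j hj' => ?_
        · have h2 := bcf_bact_e N q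
          rw [h0, map_zero] at h2
          exact mul_ne_zero (Nat.cast_add_one_ne_zero N) h1 h2.symm
        · rw [bcf_bact_e, hj _ (by omega), mul_zero]
  obtain ⟨q, hq, hq0⟩ := W.ne_bot_iff.1 h
  exact key a q hq hq0 fun j hj => bcf_eq_zero hj q

lemma eq_smul_bmono_zero {a : ℕ} {p : Bin F a} (h : bact a (eMat F) p = 0) :
    p = bcf a 0 p • bmono a 0 := by
  refine Bin_ext fun i _ => ?_
  rw [map_smul, bcf_bmono (Nat.zero_le _)]
  rcases i with _ | i
  · simp
  · have h1 := bcf_bact_e i p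
    rw [h, map_zero] at h1
    simpa [Nat.cast_add_one_ne_zero] using h1.symm

/-! ### Schur's lemma for the modules `V(a)` -/

section Linear

variable {a b : ℕ} {T : Bin F a →ₗ[F] Bin F b}

lemma equivariant_injective (hT : ∀ A p, T (bact a A p) = bact b A (T p)) (h0 : T ≠ 0) {p : Bin F a}
    (hp : T p = 0) : p = 0 := by
  by_contra h
  refine h0 (LinearMap.ker_eq_top.1 (eq_top_of_stable (W := LinearMap.ker T) ?_ ?_))
  · intro A q hq
    rw [LinearMap.mem_ker] at hq ⊢
    rw [hT, hq, map_zero]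
  · exact (Submodule.ne_bot_iff _).2 ⟨p, hp, h⟩

lemma equivariant_eq_zero (hT : ∀ A p, T (bact a A p) = bact b A (T p)) (h0 : T (bmono a 0) = 0) :
    T = 0 := by
  by_contra h
  exact bmono_zero_ne_zero a (equivariant_injective hT h h0)

lemma equivariant_bmono_zero (hT : ∀ A p, T (bact a A p) = bact b A (T p)) :
    T (bmono a 0) = bcf b 0 (T (bmono a 0)) • bmono b 0 :=
  eq_smul_bmono_zero (by rw [← hT, bact_e_bmono_zero, map_zero])

lemma equivariant_degree_eq (hT : ∀ A p, T (bact a A p) = bact b A (T p)) (h0 : T ≠ 0) : a = b := by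
  have h1 : bcf b 0 (T (bmono a 0)) ≠ 0 := fun h => h0 (equivariant_eq_zero hT (by
    rw [equivariant_bmono_zero hT, h, zero_smul]))
  have h2 := bcf_bact_h 0 (T (bmono a 0))
  rw [← hT, bact_h_bmono (Nat.zero_le _), map_smul, map_smul, smul_eq_mul] at h2
  simpa using mul_right_cancel₀ h1 h2

end Linear

/-! ### Equivariant bilinear maps: uniqueness and Clebsch-Gordan conditions -/

section Bilinear

variable {m b c : ℕ} {B B' : Bin F m →ₗ[F] Bin F b →ₗ[F] Bin F c}

/-- A lowest weight vector tensor a highest weight vector generates the tensor product: `f` kills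
the first factor, so the kernel in the second variable is `f`-stable and hence everything; after
that the kernel in the first variable is `e`-stable. -/
lemma bilinear_eq_zero (hB : ∀ A p q, bact c A (B p q) = B (bact m A p) q + B p (bact b A q))
    (h0 : B (bmono m m) (bmono b 0) = 0) : B = 0 := by
  have h1 : LinearMap.ker (B (bmono m m)) = ⊤ := by
    refine eq_top_of_f_stable (fun q hq => ?_) h0
    rw [LinearMap.mem_ker] at hq ⊢
    have h := hB (fMat F) (bmono m m) q
    rw [hq, bact_f_bmono le_rfl, sub_self, zero_smul, map_zero, map_zero, LinearMap.zero_apply,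
      zero_add] at h
    exact h.symm
  refine LinearMap.ker_eq_top.1 (eq_top_of_e_stable (fun p hp => ?_) (LinearMap.ker_eq_top.1 h1))
  rw [LinearMap.mem_ker] at hp ⊢
  ext1 q
  have h := hB (eMat F) p q
  rw [hp, LinearMap.zero_apply, LinearMap.zero_apply, map_zero, add_zero] at h
  rw [← h, LinearMap.zero_apply]

lemma bilinear_weight (hB : ∀ A p q, bact c A (B p q) = B (bact m A p) q + B p (bact b A q))
    {i j k : ℕ} (hi : i ≤ m) (hj : j ≤ b) (h : bcf c k (B (bmono m i) (bmono b j)) ≠ 0) :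
    (c : ℤ) - 2 * k = (m - 2 * i) + (b - 2 * j) := by
  have h1 := congrArg (bcf c k) (hB (hMat F) (bmono m i) (bmono b j))
  rw [bcf_bact_h, bact_h_bmono hi, bact_h_bmono hj, map_smul, map_smul, LinearMap.smul_apply,
    ← add_smul, map_smul, smul_eq_mul] at h1
  have h2 := mul_right_cancel₀ h h1
  exact_mod_cast h2

/-- The value at the pair (lowest, highest) determines the map and is a weight vector, so it has
only one possibly non-zero coefficient. The scalar is the ratio of these coefficients. -/
lemma bilinear_unique (hB : ∀ A p q, bact c A (B p q) = B (bact m A p) q + B p (bact b A q))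
    (hB' : ∀ A p q, bact c A (B' p q) = B' (bact m A p) q + B' p (bact b A q)) (h : B ≠ 0) :
    ∃ k : F, B' = k • B := by
  obtain ⟨i, hi, hi0⟩ := exists_bcf_ne_zero fun h0 => h (bilinear_eq_zero hB h0)
  refine ⟨bcf c i (B' (bmono m m) (bmono b 0)) / bcf c i (B (bmono m m) (bmono b 0)), ?_⟩
  set k := bcf c i (B' (bmono m m) (bmono b 0)) / bcf c i (B (bmono m m) (bmono b 0)) with hk
  have hD : ∀ A p q, bact c A ((B' + (-k) • B) p q) =
      (B' + (-k) • B) (bact m A p) q + (B' + (-k) • B) p (bact b A q) := by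
    intro A p q
    simp only [LinearMap.add_apply, LinearMap.smul_apply, map_add, map_smul, hB, hB', smul_add]
    abel
  have h0 : B' + (-k) • B = 0 := by
    refine bilinear_eq_zero hD (Bin_ext fun j _ => ?_)
    by_contra hj
    rw [map_zero] at hj
    have e1 := bilinear_weight hD le_rfl (Nat.zero_le _) hj
    have e2 := bilinear_weight hB le_rfl (Nat.zero_le _) hi0
    have : j = i := by omega
    subst this
    refine hj ?_
    simp only [LinearMap.add_apply, LinearMap.smul_apply, map_add, map_smul, smul_eq_mul, hk]
    field_simp
    ring
  ext1 p
  ext1 q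
  have h1 := LinearMap.congr_fun (LinearMap.congr_fun h0 p) q
  rw [LinearMap.add_apply, LinearMap.add_apply, LinearMap.smul_apply, LinearMap.smul_apply,
    LinearMap.zero_apply, LinearMap.zero_apply, neg_smul, add_neg_eq_zero] at h1
  exact h1

/-- The Clebsch-Gordan conditions for `V(c)` to be a constituent of `V(a) ⊗ V(b)`. -/
def Triangle (a b c : ℕ) : Prop :=
  (a + b + c) % 2 = 0 ∧ a ≤ b + c ∧ b ≤ a + c ∧ c ≤ a + b

lemma bilinear_triangle (hB : ∀ A p q, bact c A (B p q) = B (bact m A p) q + B p (bact b A q))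
    (h : B ≠ 0) : Triangle m b c := by
  obtain ⟨i, hi, hi0⟩ := exists_bcf_ne_zero fun h0 => h (bilinear_eq_zero hB h0)
  have e := bilinear_weight hB le_rfl (Nat.zero_le _) hi0
  refine ⟨by omega, by omega, by omega, ?_⟩
  by_contra! hc
  -- The other inequalities come from the weight of one value. If `c > m + b`, the weight `c` does
  -- not occur in `V(m) ⊗ V(b)`, so coefficient `0` always vanishes; equivariance under `e` passes
  -- this on to all further coefficients.
  have key : ∀ k p q, bcf c k (B p q) = 0 := by
    intro k
    induction k with
    | zero =>
      intro p q
      rw [eq_sum_bmono p, eq_sum_bmono q]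
      simp only [map_sum, map_smul, LinearMap.sum_apply, LinearMap.smul_apply]
      refine Finset.sum_eq_zero fun j hj => ?_
      rw [Finset.smul_sum]
      refine Finset.sum_eq_zero fun i hi => ?_
      rw [Finset.mem_range] at hi hj
      have : bcf c 0 (B (bmono m i) (bmono b j)) = 0 := by
        by_contra h0
        have := bilinear_weight hB (by omega) (by omega) h0
        omega
      rw [this, smul_zero, smul_zero]
    | succ k ih =>
      intro p q
      have h1 := bcf_bact_e k (B p q)
      rw [hB, map_add, ih, ih, add_zero] at h1
      simpa [Nat.cast_add_one_ne_zero] using h1.symm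
  exact hi0 (key _ _ _)

end Bilinear

end Equivariant

/-! ### Non-vanishing of transvectants -/

section Transvectant

variable {F : Type*} [Field F]

lemma transvectant_swap (k : ℕ) : ∀ p q : Poly F,
    transvectant k q p = (-1 : F) ^ k • transvectant k p q := by
  induction k with
  | zero =>
    intro p q
    simp [transvectant_zero, mul_comm]
  | succ k ih =>
    intro p q
    rw [transvectant_succ, transvectant_succ, ih, ih (MvPolynomial.pderiv 0 p), pow_succ]
    module

lemma form_swap {m : ℕ} (hm : Odd m) (p q : V F m) : form m q p = -form m p q := by
  rw [form_apply, form_apply, transvectant_swap, hm.neg_one_pow]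
  simp

/-- On powers of a single variable only one of the two terms of the recursion survives, so nothing
can cancel; the scalar is, up to sign, a product of falling factorials. -/
lemma transvectant_pow_pow [CharZero F] (k : ℕ) : ∀ m b : ℕ, k ≤ m → k ≤ b → ∃ c : F, c ≠ 0 ∧
    transvectant k ((MvPolynomial.X 1 : Poly F) ^ m) ((MvPolynomial.X 0 : Poly F) ^ b) =
      c • ((MvPolynomial.X 1 : Poly F) ^ (m - k) * (MvPolynomial.X 0 : Poly F) ^ (b - k)) := by
  induction k with
  | zero =>
    intro m b _ _
    exact ⟨1, one_ne_zero, by simp [transvectant_zero]⟩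
  | succ k ih =>
    intro m b hm hb
    obtain ⟨m, rfl⟩ : ∃ m', m = m' + 1 := ⟨m - 1, by omega⟩
    obtain ⟨b, rfl⟩ : ∃ b', b = b' + 1 := ⟨b - 1, by omega⟩
    obtain ⟨c, hc, h⟩ := ih m b (by omega) (by omega)
    refine ⟨-((m + 1) * (b + 1) * c), neg_ne_zero.2 (mul_ne_zero (mul_ne_zero
      (Nat.cast_add_one_ne_zero _) (Nat.cast_add_one_ne_zero _)) hc), ?_⟩
    have d0 : MvPolynomial.pderiv 0 ((MvPolynomial.X 1 : Poly F) ^ (m + 1)) = 0 := by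
      rw [Derivation.leibniz_pow, MvPolynomial.pderiv_X_of_ne (by decide)]
      simp
    have d1 : MvPolynomial.pderiv 1 ((MvPolynomial.X 1 : Poly F) ^ (m + 1)) =
        ((m : F) + 1) • (MvPolynomial.X 1 : Poly F) ^ m := by
      rw [Derivation.leibniz_pow, MvPolynomial.pderiv_X_self, MvPolynomial.smul_eq_C_mul]
      simp
    have d2 : MvPolynomial.pderiv 0 ((MvPolynomial.X 0 : Poly F) ^ (b + 1)) =
        ((b : F) + 1) • (MvPolynomial.X 0 : Poly F) ^ b := by
      rw [Derivation.leibniz_pow, MvPolynomial.pderiv_X_self, MvPolynomial.smul_eq_C_mul]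
      simp
    rw [transvectant_succ, d0, d1, d2, map_zero, LinearMap.zero_apply, map_smul, map_smul,
      LinearMap.smul_apply, h, Nat.add_sub_add_right, Nat.add_sub_add_right]
    module

lemma coe_mono_zero (a : ℕ) : (mono a 0 : V F a).1 = (MvPolynomial.X 0 : Poly F) ^ a := by
  rw [coe_mono (Nat.zero_le _), MvPolynomial.X_pow_eq_monomial]
  simp [expo]

lemma coe_mono_self (a : ℕ) : (mono a a : V F a).1 = (MvPolynomial.X 1 : Poly F) ^ a := by
  rw [coe_mono le_rfl, MvPolynomial.X_pow_eq_monomial]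
  simp [expo]

lemma pairing_ne_zero [CharZero F] {m b c : ℕ} (h : Triangle m b c) :
    (pairing m b c : V F m →ₗ[F] V F b →ₗ[F] V F c) ≠ 0 := by
  obtain ⟨h1, h2, h3, h4⟩ := h
  intro h0
  have h5 := congrArg (Subtype.val) (LinearMap.congr_fun (LinearMap.congr_fun h0 (mono m m))
    (mono b 0))
  obtain ⟨d, hd, h6⟩ := transvectant_pow_pow (F := F) ((m + b - c) / 2) m b (by omega) (by omega)
  have h7 : ((MvPolynomial.X 1 : Poly F) ^ (m - (m + b - c) / 2) *
      (MvPolynomial.X 0 : Poly F) ^ (b - (m + b - c) / 2)).IsHomogeneous c := by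
    have := (MvPolynomial.isHomogeneous_X_pow (R := F) (1 : Fin 2) (m - (m + b - c) / 2)).mul
      (MvPolynomial.isHomogeneous_X_pow (R := F) (0 : Fin 2) (b - (m + b - c) / 2))
    rwa [show m - (m + b - c) / 2 + (b - (m + b - c) / 2) = c by omega] at this
  rw [coe_pairing, coe_mono_zero, coe_mono_self, h6, map_smul,
    MvPolynomial.homogeneousComponent_of_mem h7, if_pos rfl] at h5
  refine smul_ne_zero hd ?_ h5
  exact mul_ne_zero (pow_ne_zero _ (MvPolynomial.X_ne_zero _))
    (pow_ne_zero _ (MvPolynomial.X_ne_zero _))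

lemma exists_form_ne_zero [CharZero F] (m : ℕ) : ∃ p q : V F m, form m p q ≠ 0 := by
  obtain ⟨d, hd, h⟩ := transvectant_pow_pow (F := F) m m m le_rfl le_rfl
  refine ⟨mono m m, mono m 0, ?_⟩
  rw [form_apply, coe_mono_zero, coe_mono_self, h]
  simpa using hd

end Transvectant

/-! ### Coordinates on tensor products -/

section Tensor

variable {F : Type*} [Field F] {a b : ℕ}

/-- The coordinate along `X₀^(a-i) X₁^i ⊗ X₀^(b-j) X₁^j`. -/
def cf₂ (a b i j : ℕ) : Bin F a ⊗[F] Bin F b →ₗ[F] F :=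
  (TensorProduct.lid F F).toLinearMap ∘ₗ TensorProduct.map (bcf a i) (bcf b j)

lemma cf₂_tmul (i j : ℕ) (p : Bin F a) (q : Bin F b) :
    cf₂ a b i j (p ⊗ₜ q) = bcf a i p * bcf b j q := by
  simp [cf₂]

lemma tensor_eq_sum (u : Bin F a ⊗[F] Bin F b) :
    u = ∑ i ∈ Finset.range (a + 1), ∑ j ∈ Finset.range (b + 1),
      cf₂ a b i j u • (bmono a i ⊗ₜ[F] bmono b j) := by
  induction u using TensorProduct.induction_on with
  | zero => simp
  | tmul p q =>
    conv_lhs => rw [eq_sum_bmono p, eq_sum_bmono q]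
    simp only [TensorProduct.sum_tmul, TensorProduct.tmul_sum, TensorProduct.smul_tmul_smul,
      cf₂_tmul]
    exact Finset.sum_comm
  | add u v hu hv =>
    conv_lhs => rw [hu, hv]
    simp only [map_add, add_smul, Finset.sum_add_distrib]

lemma tensor_ext {u v : Bin F a ⊗[F] Bin F b} (h : ∀ i j, cf₂ a b i j u = cf₂ a b i j v) :
    u = v := by
  rw [tensor_eq_sum u, tensor_eq_sum v]
  simp only [h]

lemma cf₂_eq_zero_left {i : ℕ} (h : a < i) (j : ℕ) (u : Bin F a ⊗[F] Bin F b) :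
    cf₂ a b i j u = 0 := by
  induction u using TensorProduct.induction_on with
  | zero => simp
  | tmul p q => rw [cf₂_tmul, bcf_eq_zero h, zero_mul]
  | add u v hu hv => rw [map_add, hu, hv, add_zero]

lemma cf₂_eq_zero_right {j : ℕ} (h : b < j) (i : ℕ) (u : Bin F a ⊗[F] Bin F b) :
    cf₂ a b i j u = 0 := by
  induction u using TensorProduct.induction_on with
  | zero => simp
  | tmul p q => rw [cf₂_tmul, bcf_eq_zero h, mul_zero]
  | add u v hu hv => rw [map_add, hu, hv, add_zero]

variable (a b) in
/-- The action of `sl(2)` on the first factor of `V(a) ⊗ V(b)`. -/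
def actL (A : SL2 F) : Bin F a ⊗[F] Bin F b →ₗ[F] Bin F a ⊗[F] Bin F b :=
  (bact a A).rTensor (Bin F b)

variable (a b) in
/-- The action of `sl(2)` on the second factor of `V(a) ⊗ V(b)`. -/
def actR (A : SL2 F) : Bin F a ⊗[F] Bin F b →ₗ[F] Bin F a ⊗[F] Bin F b :=
  (bact b A).lTensor (Bin F a)

variable (a b) in
/-- The diagonal action of `sl(2)` on `V(a) ⊗ V(b)`. -/
def actT (A : SL2 F) : Bin F a ⊗[F] Bin F b →ₗ[F] Bin F a ⊗[F] Bin F b :=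
  actL a b A + actR a b A

lemma actL_tmul (A : SL2 F) (p : Bin F a) (q : Bin F b) :
    actL a b A (p ⊗ₜ q) = bact a A p ⊗ₜ q := rfl

lemma actR_tmul (A : SL2 F) (p : Bin F a) (q : Bin F b) :
    actR a b A (p ⊗ₜ q) = p ⊗ₜ bact b A q := rfl

lemma actT_apply (A : SL2 F) (u : Bin F a ⊗[F] Bin F b) :
    actT a b A u = actL a b A u + actR a b A u := rfl

lemma actT_tmul (A : SL2 F) (p : Bin F a) (q : Bin F b) :
    actT a b A (p ⊗ₜ q) = bact a A p ⊗ₜ q + p ⊗ₜ bact b A q := rfl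

lemma actT_lie (A B : SL2 F) (u : Bin F a ⊗[F] Bin F b) :
    actT a b ⁅A, B⁆ u = actT a b A (actT a b B u) - actT a b B (actT a b A u) := by
  induction u using TensorProduct.induction_on with
  | zero => simp
  | tmul p q =>
    simp only [actT_tmul, map_add, bact_lie, TensorProduct.sub_tmul, TensorProduct.tmul_sub]
    abel
  | add u v hu hv =>
    simp only [map_add, hu, hv]
    abel

lemma actT_smul (c : F) (A : SL2 F) (u : Bin F a ⊗[F] Bin F b) :
    actT a b (c • A) u = c • actT a b A u := by
  induction u using TensorProduct.induction_on with
  | zero => simp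
  | tmul p q =>
    simp only [actT_tmul, bact_smul, smul_add, TensorProduct.smul_tmul', TensorProduct.tmul_smul]
  | add u v hu hv => rw [map_add, hu, hv, map_add, smul_add]

lemma actT_e_f (u : Bin F a ⊗[F] Bin F b) : actT a b (eMat F) (actT a b (fMat F) u) =
    actT a b (fMat F) (actT a b (eMat F) u) + actT a b (hMat F) u := by
  rw [← lie_e_f, actT_lie]
  abel

section

variable (i j : ℕ) (u : Bin F a ⊗[F] Bin F b)

lemma cf₂_actL_e : cf₂ a b i j (actL a b (eMat F) u) = (i + 1) * cf₂ a b (i + 1) j u := by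
  induction u using TensorProduct.induction_on with
  | zero => simp
  | tmul p q => rw [actL_tmul, cf₂_tmul, cf₂_tmul, bcf_bact_e]; ring
  | add u v hu hv => simp only [map_add, hu, hv]; ring

lemma cf₂_actR_e : cf₂ a b i j (actR a b (eMat F) u) = (j + 1) * cf₂ a b i (j + 1) u := by
  induction u using TensorProduct.induction_on with
  | zero => simp
  | tmul p q => rw [actR_tmul, cf₂_tmul, cf₂_tmul, bcf_bact_e]; ring
  | add u v hu hv => simp only [map_add, hu, hv]; ring

lemma cf₂_actL_h : cf₂ a b i j (actL a b (hMat F) u) = (a - 2 * i) * cf₂ a b i j u := by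
  induction u using TensorProduct.induction_on with
  | zero => simp
  | tmul p q => rw [actL_tmul, cf₂_tmul, cf₂_tmul, bcf_bact_h]; ring
  | add u v hu hv => simp only [map_add, hu, hv]; ring

lemma cf₂_actR_h : cf₂ a b i j (actR a b (hMat F) u) = (b - 2 * j) * cf₂ a b i j u := by
  induction u using TensorProduct.induction_on with
  | zero => simp
  | tmul p q => rw [actR_tmul, cf₂_tmul, cf₂_tmul, bcf_bact_h]; ring
  | add u v hu hv => simp only [map_add, hu, hv]; ring

lemma cf₂_actL_f : cf₂ a b (i + 1) j (actL a b (fMat F) u) = (a - i) * cf₂ a b i j u := by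
  induction u using TensorProduct.induction_on with
  | zero => simp
  | tmul p q => rw [actL_tmul, cf₂_tmul, cf₂_tmul, bcf_bact_f]; ring
  | add u v hu hv => simp only [map_add, hu, hv]; ring

lemma cf₂_actR_f : cf₂ a b i (j + 1) (actR a b (fMat F) u) = (b - j) * cf₂ a b i j u := by
  induction u using TensorProduct.induction_on with
  | zero => simp
  | tmul p q => rw [actR_tmul, cf₂_tmul, cf₂_tmul, bcf_bact_f]; ring
  | add u v hu hv => simp only [map_add, hu, hv]; ring

lemma cf₂_actL_f_zero : cf₂ a b 0 j (actL a b (fMat F) u) = 0 := by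
  induction u using TensorProduct.induction_on with
  | zero => simp
  | tmul p q => rw [actL_tmul, cf₂_tmul, bcf_bact_f_zero, zero_mul]
  | add u v hu hv => rw [map_add, map_add, hu, hv, add_zero]

lemma cf₂_actR_f_zero : cf₂ a b i 0 (actR a b (fMat F) u) = 0 := by
  induction u using TensorProduct.induction_on with
  | zero => simp
  | tmul p q => rw [actR_tmul, cf₂_tmul, bcf_bact_f_zero, mul_zero]
  | add u v hu hv => rw [map_add, map_add, hu, hv, add_zero]

end

/-! ### Highest weight vectors in tensor products -/

lemma cf₂_weight {μ : F} {u : Bin F a ⊗[F] Bin F b} (h : actT a b (hMat F) u = μ • u) {i j : ℕ}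
    (h0 : cf₂ a b i j u ≠ 0) : μ = a + b - 2 * (i + j) := by
  have h1 := congrArg (cf₂ a b i j) h
  rw [actT_apply, map_add, cf₂_actL_h, cf₂_actR_h, map_smul, smul_eq_mul, ← add_mul] at h1
  rw [← mul_right_cancel₀ h0 h1]
  ring

lemma cf₂_of_e_eq_zero {u : Bin F a ⊗[F] Bin F b} (h : actT a b (eMat F) u = 0) (i j : ℕ) :
    (i + 1) * cf₂ a b (i + 1) j u + (j + 1) * cf₂ a b i (j + 1) u = 0 := by
  rw [← cf₂_actL_e, ← cf₂_actR_e, ← map_add, ← actT_apply, h, map_zero]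

variable [CharZero F]

/-- The equation `e u = 0` is a two-term recurrence along each antidiagonal of coefficients, so the
end coefficient controls the whole antidiagonal. -/
lemma cf₂_eq_zero_of_e {u : Bin F a ⊗[F] Bin F b} (h : actT a b (eMat F) u = 0) :
    ∀ i j : ℕ, cf₂ a b 0 (i + j) u = 0 → cf₂ a b i j u = 0 := by
  intro i
  induction i with
  | zero =>
    intro j h0
    rwa [Nat.zero_add] at h0
  | succ i ih =>
    intro j h0
    have h1 := cf₂_of_e_eq_zero h i j
    rw [ih (j + 1) (by rwa [show i + (j + 1) = i + 1 + j by omega]), mul_zero, add_zero] at h1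
    simpa [Nat.cast_add_one_ne_zero] using h1

lemma cf₂_eq_zero_of_e' {u : Bin F a ⊗[F] Bin F b} (h : actT a b (eMat F) u = 0) :
    ∀ j i : ℕ, cf₂ a b (i + j) 0 u = 0 → cf₂ a b i j u = 0 := by
  intro j
  induction j with
  | zero =>
    intro j h0
    exact h0
  | succ j ih =>
    intro i h0
    have h1 := cf₂_of_e_eq_zero h i j
    rw [ih (i + 1) (by rwa [show i + 1 + j = i + (j + 1) by omega]), mul_zero, zero_add] at h1
    simpa [Nat.cast_add_one_ne_zero] using h1

/-- The shape of a highest weight vector in `V(a) ⊗ V(b)`. -/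
lemma highestWeight_shape {μ : F} {u : Bin F a ⊗[F] Bin F b} (he : actT a b (eMat F) u = 0)
    (hh : actT a b (hMat F) u = μ • u) (h0 : u ≠ 0) :
    ∃ l, l ≤ a ∧ l ≤ b ∧ μ = a + b - 2 * l ∧ cf₂ a b 0 l u ≠ 0 ∧ cf₂ a b l 0 u ≠ 0 := by
  obtain ⟨i, j, hij⟩ : ∃ i j, cf₂ a b i j u ≠ 0 := by
    by_contra! h
    exact h0 (tensor_ext fun i j => by rw [h i j, map_zero])
  have h1 : cf₂ a b 0 (i + j) u ≠ 0 := fun h => hij (cf₂_eq_zero_of_e he i j h)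
  have h2 : cf₂ a b (i + j) 0 u ≠ 0 := fun h => hij (cf₂_eq_zero_of_e' he j i h)
  refine ⟨i + j, ?_, ?_, by rw [cf₂_weight hh hij]; push_cast; ring, h1, h2⟩
  · by_contra! h
    exact h2 (cf₂_eq_zero_left h _ _)
  · by_contra! h
    exact h1 (cf₂_eq_zero_right h _ _)

/-- Multiplicity one in Clebsch-Gordan: the weight fixes the antidiagonal `l`, and a highest weight
vector whose coefficient at `(0, l)` is zero must vanish. -/
lemma highestWeight_unique {μ : F} {u v : Bin F a ⊗[F] Bin F b} (he : actT a b (eMat F) u = 0)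
    (hh : actT a b (hMat F) u = μ • u) (h0 : u ≠ 0) (he' : actT a b (eMat F) v = 0)
    (hh' : actT a b (hMat F) v = μ • v) : ∃ c : F, v = c • u := by
  obtain ⟨l, -, -, hμ, h1, -⟩ := highestWeight_shape he hh h0
  refine ⟨cf₂ a b 0 l v / cf₂ a b 0 l u, ?_⟩
  set c := cf₂ a b 0 l v / cf₂ a b 0 l u with hc
  by_contra hne
  have e1 : actT a b (eMat F) (v - c • u) = 0 := by rw [map_sub, map_smul, he, he']; simp
  have e2 : actT a b (hMat F) (v - c • u) = μ • (v - c • u) := by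
    rw [map_sub, map_smul, hh, hh']
    module
  obtain ⟨l', -, -, hμ', h2, -⟩ := highestWeight_shape e1 e2 (sub_ne_zero.2 hne)
  have : l' = l := by
    rw [hμ] at hμ'
    have : (l' : F) = l := by linear_combination (1 / 2) * hμ'
    exact_mod_cast this
  subst this
  refine h2 ?_
  rw [map_sub, map_smul, smul_eq_mul, hc, div_mul_cancel₀ _ h1, sub_self]

/-- The mixed Casimir operator of the first factor and the diagonal acts on a highest weight
vector by a scalar. -/
lemma mixed_casimir_left {μ : F} {u : Bin F a ⊗[F] Bin F b} (he : actT a b (eMat F) u = 0)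
    (hh : actT a b (hMat F) u = μ • u) :
    actL a b (eMat F) (actT a b (fMat F) u) + (μ / 2) • actL a b (hMat F) u =
      ((a * (a + 2) + μ * (μ + 2) - b * (b + 2)) / 4 : F) • u := by
  -- The scalar is `(C_a + C_μ - C_b) / 2` with `C_d = d (d + 2) / 2`. For each coefficient, the
  -- weight equation eliminates `μ` if the coefficient is non-zero, and the recurrence from `e u =
  -- 0` eliminates its neighbour on the antidiagonal.
  refine tensor_ext fun i j => ?_
  by_cases h0 : cf₂ a b i j u = 0
  · rcases j with _ | j
    · simp only [map_add, map_smul, cf₂_actL_e, actT_apply, cf₂_actL_f, cf₂_actR_f_zero,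
        cf₂_actL_h, h0, smul_eq_mul]
      ring
    · have h1 := cf₂_of_e_eq_zero he i j
      rw [h0, mul_zero, add_zero] at h1
      simp only [map_add, map_smul, cf₂_actL_e, actT_apply, cf₂_actL_f, cf₂_actR_f,
        cf₂_actL_h, h0, smul_eq_mul]
      linear_combination (b - j : F) * h1
  · have hw := cf₂_weight hh h0
    rcases j with _ | j
    · simp only [map_add, map_smul, cf₂_actL_e, actT_apply, cf₂_actL_f, cf₂_actR_f_zero,
        cf₂_actL_h, smul_eq_mul]
      rw [hw]
      push_cast
      ring
    · have h1 := cf₂_of_e_eq_zero he i j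
      simp only [map_add, map_smul, cf₂_actL_e, actT_apply, cf₂_actL_f, cf₂_actR_f,
        cf₂_actL_h, smul_eq_mul]
      rw [hw]
      push_cast
      linear_combination (b - j : F) * h1

lemma mixed_casimir_right {μ : F} {u : Bin F a ⊗[F] Bin F b} (he : actT a b (eMat F) u = 0)
    (hh : actT a b (hMat F) u = μ • u) :
    actR a b (eMat F) (actT a b (fMat F) u) + (μ / 2) • actR a b (hMat F) u =
      ((b * (b + 2) + μ * (μ + 2) - a * (a + 2)) / 4 : F) • u := by
  refine tensor_ext fun i j => ?_
  by_cases h0 : cf₂ a b i j u = 0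
  · rcases i with _ | i
    · simp only [map_add, map_smul, cf₂_actR_e, actT_apply, cf₂_actR_f, cf₂_actL_f_zero,
        cf₂_actR_h, h0, smul_eq_mul]
      ring
    · have h1 := cf₂_of_e_eq_zero he i j
      rw [h0, mul_zero, zero_add] at h1
      simp only [map_add, map_smul, cf₂_actR_e, actT_apply, cf₂_actL_f, cf₂_actR_f,
        cf₂_actR_h, h0, smul_eq_mul]
      linear_combination (a - i : F) * h1
  · have hw := cf₂_weight hh h0
    rcases i with _ | i
    · simp only [map_add, map_smul, cf₂_actR_e, actT_apply, cf₂_actR_f, cf₂_actL_f_zero,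
        cf₂_actR_h, smul_eq_mul]
      rw [hw]
      push_cast
      ring
    · have h1 := cf₂_of_e_eq_zero he i j
      simp only [map_add, map_smul, cf₂_actR_e, actT_apply, cf₂_actL_f, cf₂_actR_f,
        cf₂_actR_h, smul_eq_mul]
      rw [hw]
      push_cast
      linear_combination (a - i : F) * h1

end Tensor

/-! ### The tensor product of two adjacent links -/

section Links

variable {F : Type*} [Field F] [CharZero F] {a b m μ : ℕ} {τ : ℕ → Bin F a ⊗[F] Bin F b}

/-- The sum of the two Casimir identities at `j + 1` contains only the diagonal action. Moving `e`
past `f` in `e f τ (j+1)` produces a multiple of `f τ j`, and every other term is a multiple of `τ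
(j+1)`. -/
lemma chain_step {lam lam' : F}
    (he : ∀ j : ℕ, actT a b (eMat F) (τ (j + 1)) = ((j + 1) * (m - j) : F) • τ j)
    (hh : ∀ j : ℕ, actT a b (hMat F) (τ j) = (m + μ - 2 * j : F) • τ j)
    (hL : ∀ j, actL a b (eMat F) (actT a b (fMat F) (τ j) - τ (j + 1)) +
      (μ / 2 : F) • actL a b (hMat F) (τ j) = lam • τ j)
    (hR : ∀ j, actR a b (eMat F) (actT a b (fMat F) (τ j) - τ (j + 1)) +
      (μ / 2 : F) • actR a b (hMat F) (τ j) = lam' • τ j) (j : ℕ) :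
    ∃ c : F, ((j + 1) * (m - j) : F) • actT a b (fMat F) (τ j) = c • τ (j + 1) := by
  have h1 : actT a b (eMat F) (actT a b (fMat F) (τ (j + 1)) - τ (j + 2)) +
      (μ / 2 : F) • actT a b (hMat F) (τ (j + 1)) = (lam + lam') • τ (j + 1) := by
    rw [actT_apply (eMat F), actT_apply (hMat F), add_smul, ← hL (j + 1), ← hR (j + 1)]
    module
  rw [map_sub, actT_e_f, he j, map_smul, he (j + 1), hh (j + 1)] at h1
  refine ⟨lam + lam' - (μ / 2 + 1) * (m + μ - 2 * ((j + 1 : ℕ) : F)) +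
    (((j + 1 : ℕ) : F) + 1) * (m - ((j + 1 : ℕ) : F)), ?_⟩
  rw [add_smul, sub_smul, ← h1]
  module

/-- If two families of links `V(m) ⊗ V(μ) → V(a) ⊗ V(b)`, one of them acting on the first factor
and one of them on the second factor, are proportional, then the space of invariants of
`V(m) ⊗ V(μ) ⊗ V(a) ⊗ V(b)` is one-dimensional. -/
lemma degenerate_of_chain (hm : 1 ≤ m) {lam lam' : F}
    (he0 : actT a b (eMat F) (τ 0) = 0)
    (he : ∀ j : ℕ, actT a b (eMat F) (τ (j + 1)) = ((j + 1) * (m - j) : F) • τ j)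
    (hh : ∀ j : ℕ, actT a b (hMat F) (τ j) = (m + μ - 2 * j : F) • τ j)
    (hz : ∀ j, m < j → τ j = 0) (hne : ∃ j, τ j ≠ 0)
    (hL : ∀ j, actL a b (eMat F) (actT a b (fMat F) (τ j) - τ (j + 1)) +
      (μ / 2 : F) • actL a b (hMat F) (τ j) = lam • τ j)
    (hR : ∀ j, actR a b (eMat F) (actT a b (fMat F) (τ j) - τ (j + 1)) +
      (μ / 2 : F) • actR a b (hMat F) (τ j) = lam' • τ j) :
    a = 0 ∨ b = 0 ∨ μ = 0 ∨ m = μ + a + b ∨ μ = m + a + b ∨ a = b + m + μ ∨ b = a + m + μ := by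
  classical
  by_contra! hcon
  obtain ⟨ha, hb, hμ, hA, hB, hC, hD⟩ := hcon
  have ha' : (a : F) ≠ 0 := Nat.cast_ne_zero.2 ha
  have hb' : (b : F) ≠ 0 := Nat.cast_ne_zero.2 hb
  have hμ' : (μ : F) ≠ 0 := Nat.cast_ne_zero.2 hμ
  -- the first nonzero vector
  obtain ⟨k, hk0, hkmin⟩ : ∃ k, τ k ≠ 0 ∧ ∀ j < k, τ j = 0 :=
    ⟨Nat.find hne, Nat.find_spec hne, fun j hj => by simpa using Nat.find_min hne hj⟩
  have hkm : k ≤ m := by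
    by_contra! h
    exact hk0 (hz k h)
  set y := τ k with hy
  have hey : actT a b (eMat F) y = 0 := by
    rcases k with _ | k
    · exact he0
    · rw [hy, he k, hkmin k (Nat.lt_succ_self _), smul_zero]
  have hhy := hh k
  rw [← hy] at hhy
  obtain ⟨l, hla, hlb, hν, hq0, hql⟩ := highestWeight_shape hey hhy hk0
  have hνZ : (m : ℤ) + μ - 2 * k = a + b - 2 * l := by exact_mod_cast hν
  -- either `k = 0` or `l = 0`
  have hkl : k = 0 ∨ l = 0 := by
    rcases k with _ | k
    · exact Or.inl rfl
    rcases l with _ | l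
    · exact Or.inr rfl
    exfalso
    -- With `τ k = 0` the left identity says that `e` on the first factor kills `y = τ (k+1)`, but
    -- the coefficient of `y` at `(l+1, 0)` is non-zero.
    have h1 := hL k
    rw [hkmin k (Nat.lt_succ_self _), ← hy] at h1
    simp only [map_zero, zero_sub, map_neg, smul_zero, add_zero, neg_eq_zero] at h1
    have h2 := cf₂_actL_e l 0 y
    rw [h1, map_zero] at h2
    exact mul_ne_zero (Nat.cast_add_one_ne_zero l) hql h2.symm
  have hlt : k < m := by
    rcases eq_or_lt_of_le hkm with h | h
    · exfalso
      omega
    · exact h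
  have hla' : l < a := by omega
  have hlb' : l < b := by omega
  -- The weight of `y` is `w + 2 ≥ 2`, since `l < a` and `l < b`. Hence `f y` and `f² y` are
  -- non-zero.
  obtain ⟨w, hw⟩ : ∃ w : ℕ, a + b = 2 * l + w + 2 := ⟨a + b - 2 * l - 2, by omega⟩
  have hwF : (a : F) + b = 2 * l + w + 2 := by exact_mod_cast hw
  have hν2 : (m : F) + μ - 2 * k = w + 2 := by rw [hν, hwF]; ring
  set Y := actT a b (fMat F) y with hY
  set Z := actT a b (fMat F) Y with hZ
  have heY : actT a b (eMat F) Y = (w + 2 : F) • y := by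
    rw [hY, actT_e_f, hey, map_zero, zero_add, hhy, hν2]
  have hw2 : (w + 2 : F) ≠ 0 := by exact_mod_cast (by omega : w + 2 ≠ 0)
  have hw1 : (w + 1 : F) ≠ 0 := Nat.cast_add_one_ne_zero w
  have hY0 : Y ≠ 0 := fun h => by
    rw [h, map_zero] at heY
    exact smul_ne_zero hw2 hk0 heY.symm
  have hhY : actT a b (hMat F) Y = (w : F) • Y := by
    have h1 := actT_lie (hMat F) (fMat F) y
    rw [lie_h_f, actT_smul, hhy, map_smul, ← hY, hν2] at h1
    have h2 : actT a b (hMat F) Y = (w + 2 : F) • Y + (-2 : F) • Y := by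
      rw [h1]
      abel
    rw [h2]
    module
  have heZ : actT a b (eMat F) Z = (2 * (w + 1) : F) • Y := by
    rw [hZ, actT_e_f, heY, map_smul, ← hY, hhY]
    module
  have hZ0 : Z ≠ 0 := fun h => by
    rw [h, map_zero] at heZ
    exact smul_ne_zero (mul_ne_zero two_ne_zero hw1) hY0 heZ.symm
  have hc1 : ((k + 1) * (m - k) : F) ≠ 0 := by
    refine mul_ne_zero (Nat.cast_add_one_ne_zero k) ?_
    rw [sub_ne_zero, Ne, Nat.cast_inj]
    omega
  -- `chain_step` makes `τ (k+1)` a multiple of `f y`; applying `e` to both sides evaluates the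
  -- factor. The same is done below for `τ (k+2)` and `f² y`.
  obtain ⟨θ, hθ, hθ0⟩ : ∃ θ : F, τ (k + 1) = θ • Y ∧ θ * (w + 2) = (k + 1) * (m - k) := by
    obtain ⟨c, hc⟩ := chain_step he hh hL hR k
    rw [← hy, ← hY] at hc
    have hc0 : c ≠ 0 := fun h => by
      rw [h, zero_smul] at hc
      exact smul_ne_zero hc1 hY0 hc
    have h1 : τ (k + 1) = (c⁻¹ * ((k + 1) * (m - k))) • Y := by
      rw [mul_smul, hc, smul_smul, inv_mul_cancel₀ hc0, one_smul]
    refine ⟨_, h1, ?_⟩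
    have h2 := he k
    rw [h1, map_smul, heY, smul_smul, ← hy] at h2
    exact (smul_left_injective F hk0 h2 :)
  have hθne : θ ≠ 0 := fun h => by
    rw [h, zero_mul] at hθ0
    exact hc1 hθ0.symm
  obtain ⟨η, hη, hη0⟩ : ∃ η : F, τ (k + 2) = η • Z ∧
      η * (2 * (w + 1)) = (k + 2) * (m - k - 1) * θ := by
    have key : ∀ η : F, τ (k + 2) = η • Z → η * (2 * (w + 1)) = (k + 2) * (m - k - 1) * θ := by
      intro η h1
      have h2 := he (k + 1)
      rw [h1, map_smul, heZ, hθ, smul_smul, smul_smul] at h2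
      rw [(smul_left_injective F hY0 h2 :)]
      push_cast
      ring
    -- If `k + 1 = m` the factor in `chain_step` is zero, but then `τ (k+2) = 0` and `η = 0` serves.
    rcases eq_or_ne (k + 1) m with h | h
    · have h1 : τ (k + 2) = (0 : F) • Z := by rw [hz (k + 2) (by omega), zero_smul]
      exact ⟨0, h1, key 0 h1⟩
    · obtain ⟨c, hc⟩ := chain_step he hh hL hR (k + 1)
      rw [hθ, map_smul, ← hZ, smul_smul] at hc
      have hc2 : ((((k + 1 : ℕ) : F) + 1) * (m - ((k + 1 : ℕ) : F))) * θ ≠ 0 := by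
        refine mul_ne_zero (mul_ne_zero (Nat.cast_add_one_ne_zero _) ?_) hθne
        rw [sub_ne_zero, Ne, Nat.cast_inj]
        omega
      have hc0 : c ≠ 0 := fun h => by
        rw [h, zero_smul] at hc
        exact smul_ne_zero hc2 hZ0 hc
      have h1 : τ (k + 2) =
          (c⁻¹ * ((((k + 1 : ℕ) : F) + 1) * (m - ((k + 1 : ℕ) : F)) * θ)) • Z := by
        rw [mul_smul, hc, smul_smul, inv_mul_cancel₀ hc0, one_smul]
      exact ⟨_, h1, key _ h1⟩
  -- compare the extreme coefficients
  have hLk := hL (k + 1)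
  rw [hη, hθ, map_smul, ← hZ, ← sub_smul, map_smul, map_smul] at hLk
  set q₀ := cf₂ a b 0 l y with hq₀
  set q₁ := cf₂ a b l 0 y with hq₁
  have y1 : cf₂ a b 0 (l + 1) Y = (b - l) * q₀ := by
    rw [hY, actT_apply, map_add, cf₂_actL_f_zero, cf₂_actR_f, zero_add]
  have y2 : cf₂ a b (l + 1) 0 Y = (a - l) * q₁ := by
    rw [hY, actT_apply, map_add, cf₂_actL_f, cf₂_actR_f_zero, add_zero]
  have z1 : cf₂ a b 1 (l + 1) Z = (2 * a - l * (b - l + 1)) * ((b - l) * q₀) := by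
    have y3 : cf₂ a b 1 l Y = a * q₀ - l * (b - l + 1) * q₀ := by
      have h1 := cf₂_actL_f 0 l y
      rw [Nat.cast_zero, sub_zero, zero_add] at h1
      rw [hY, actT_apply, map_add, h1]
      rcases l with _ | l
      · rw [cf₂_actR_f_zero]
        simp [hq₀]
      · have h2 := cf₂_of_e_eq_zero hey 0 l
        rw [cf₂_actR_f]
        push_cast at h2 ⊢
        linear_combination (b - l : F) * h2
    have h1 := cf₂_actL_f 0 (l + 1) Y
    rw [Nat.cast_zero, sub_zero, zero_add] at h1
    rw [hZ, actT_apply, map_add, h1, cf₂_actR_f, y1, y3]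
    ring
  have z2 : cf₂ a b (l + 2) 0 Z = (a - l - 1) * ((a - l) * q₁) := by
    rw [hZ, actT_apply, map_add, cf₂_actL_f, cf₂_actR_f_zero, add_zero, y2]
    push_cast
    ring
  have hbl : (b - l : F) ≠ 0 := by
    rw [sub_ne_zero, Ne, Nat.cast_inj]
    omega
  have hal : (a - l : F) ≠ 0 := by
    rw [sub_ne_zero, Ne, Nat.cast_inj]
    omega
  have r1 : (θ - η) * (2 * a - l * (b - l + 1)) + (μ / 2) * θ * a = lam * θ := by
    have h1 := congrArg (cf₂ a b 0 (l + 1)) hLk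
    simp only [map_add, map_smul, cf₂_actL_e, cf₂_actL_h, smul_eq_mul, y1, zero_add, z1,
      Nat.cast_zero] at h1
    refine mul_right_cancel₀ (mul_ne_zero hbl hq0) ?_
    linear_combination h1
  have r2 : (θ - η) * ((l + 2) * (a - l - 1)) + (μ / 2) * θ * (a - 2 * (l + 1)) = lam * θ := by
    have h1 := congrArg (cf₂ a b (l + 1) 0) hLk
    simp only [map_add, map_smul, cf₂_actL_e, cf₂_actL_h, smul_eq_mul, y2, z2] at h1
    refine mul_right_cancel₀ (mul_ne_zero hal hql) ?_
    push_cast at h1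
    linear_combination h1
  -- Subtracting the relations from the two ends of the antidiagonal eliminates the unknown
  -- eigenvalue `lam`.
  have r3 : (θ - η) * (2 * (l + 1) - l * (w + 2)) + μ * θ * (l + 1) = 0 := by
    linear_combination r1 - r2 + (θ - η) * l * hwF
  -- For `k = 0` the relations reduce to `μ θ (w + l + 3) = 0`, which is impossible. For `l = 0`
  -- they give `μ = k`, and then comparing weights yields the excluded equality `m = μ + a + b`.
  rcases hkl with rfl | rfl
  · have h1 : (θ - η) * (w + 1) = θ * μ := by
      refine mul_left_cancel₀ (two_ne_zero (α := F)) ?_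
      push_cast at hη0 hν2
      linear_combination (-1 : F) * hη0 - 2 * θ * hν2
    have h2 : μ * θ * ((w + l + 3 : ℕ) : F) = 0 := by
      push_cast
      linear_combination (w + 1 : F) * r3 - (2 * (l + 1) - l * (w + 2) : F) * h1
    exact mul_ne_zero (mul_ne_zero hμ' hθne) (Nat.cast_ne_zero.2 (by omega)) h2
  · obtain ⟨d, rfl⟩ : ∃ d, m = k + 1 + d := ⟨m - k - 1, by omega⟩
    have h1 : ((μ : F) - k) * ((d + 2 + μ : ℕ) : F) = 0 := by
      refine mul_left_cancel₀ hθne ?_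
      push_cast at r3 hη0 hν2 ⊢
      linear_combination (w + 1 : F) * r3 + hη0 + (μ + 2) * θ * hν2
    have h2 : μ = k := by
      have := (mul_eq_zero.1 h1).resolve_right (Nat.cast_ne_zero.2 (by omega))
      exact_mod_cast sub_eq_zero.1 this
    omega

end Links

section LinkCases

variable {F : Type*} [Field F]

/-! ### Equivariant maps on one factor of a tensor product -/

section Factor

variable {m a b c : ℕ} {g : Bin F m →ₗ[F] Bin F b →ₗ[F] Bin F c}

lemma actL_lTensor (A : SL2 F) (T : Bin F b →ₗ[F] Bin F c) (u : Bin F a ⊗[F] Bin F b) :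
    actL a c A (T.lTensor (Bin F a) u) = T.lTensor (Bin F a) (actL a b A u) := by
  induction u using TensorProduct.induction_on with
  | zero => simp
  | tmul p q => simp only [LinearMap.lTensor_tmul, actL_tmul]
  | add u v hu hv => simp only [map_add, hu, hv]

lemma actR_rTensor (A : SL2 F) (T : Bin F b →ₗ[F] Bin F c) (u : Bin F b ⊗[F] Bin F a) :
    actR c a A (T.rTensor (Bin F a) u) = T.rTensor (Bin F a) (actR b a A u) := by
  induction u using TensorProduct.induction_on with
  | zero => simp
  | tmul p q => simp only [LinearMap.rTensor_tmul, actR_tmul]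
  | add u v hu hv => simp only [map_add, hu, hv]

lemma actT_lTensor (hg : ∀ A p q, bact c A (g p q) = g (bact m A p) q + g p (bact b A q))
    (A : SL2 F) (p : Bin F m) (u : Bin F a ⊗[F] Bin F b) :
    actT a c A ((g p).lTensor (Bin F a) u) =
      (g (bact m A p)).lTensor (Bin F a) u + (g p).lTensor (Bin F a) (actT a b A u) := by
  induction u using TensorProduct.induction_on with
  | zero => simp
  | tmul x y =>
    simp only [LinearMap.lTensor_tmul, actT_tmul, hg, TensorProduct.tmul_add, map_add]
    abel
  | add u v hu hv =>
    simp only [map_add, hu, hv]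
    abel

lemma actT_rTensor (hg : ∀ A p q, bact c A (g p q) = g (bact m A p) q + g p (bact b A q))
    (A : SL2 F) (p : Bin F m) (u : Bin F b ⊗[F] Bin F a) :
    actT c a A ((g p).rTensor (Bin F a) u) =
      (g (bact m A p)).rTensor (Bin F a) u + (g p).rTensor (Bin F a) (actT b a A u) := by
  induction u using TensorProduct.induction_on with
  | zero => simp
  | tmul x y =>
    simp only [LinearMap.rTensor_tmul, actT_tmul, hg, TensorProduct.add_tmul, map_add]
    abel
  | add u v hu hv =>
    simp only [map_add, hu, hv]
    abel

variable [CharZero F]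

/-- The vectors killed by all `g p` form an `sl(2)`-stable subspace of the irreducible module
`V(b)`. -/
lemma bilinear_faithful (hg : ∀ A p q, bact c A (g p q) = g (bact m A p) q + g p (bact b A q))
    (h0 : g ≠ 0) {q : Bin F b} (hq : ∀ p, g p q = 0) : q = 0 := by
  by_contra hne
  have h1 : LinearMap.ker g.flip = ⊤ := by
    refine eq_top_of_stable (fun A r hr => ?_) ((Submodule.ne_bot_iff _).2 ⟨q, ?_, hne⟩)
    · rw [LinearMap.mem_ker] at hr ⊢
      ext1 p
      have hr' : ∀ p, g p r = 0 := fun p => LinearMap.congr_fun hr p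
      have h2 := hg A p r
      rw [hr', hr', map_zero, zero_add] at h2
      rw [LinearMap.flip_apply, ← h2, LinearMap.zero_apply]
    · rw [LinearMap.mem_ker]
      ext1 p
      rw [LinearMap.flip_apply, hq, LinearMap.zero_apply]
  refine h0 ?_
  ext1 p
  ext1 r
  exact LinearMap.congr_fun (LinearMap.congr_fun (LinearMap.ker_eq_top.1 h1) r) p

/-- Coefficient functionals on the untouched factor commute with `g p`, which reduces the claim to a
single factor. -/
lemma lTensor_faithful (hg : ∀ A p q, bact c A (g p q) = g (bact m A p) q + g p (bact b A q))
    (h0 : g ≠ 0) {u : Bin F a ⊗[F] Bin F b} (hu : ∀ p, (g p).lTensor (Bin F a) u = 0) : u = 0 := by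
  have key : ∀ i, (TensorProduct.lid F (Bin F b)) ((bcf a i).rTensor (Bin F b) u) = 0 := by
    intro i
    refine bilinear_faithful hg h0 fun p => ?_
    have h1 : ∀ u : Bin F a ⊗[F] Bin F b,
        g p ((TensorProduct.lid F (Bin F b)) ((bcf a i).rTensor (Bin F b) u)) =
        (TensorProduct.lid F (Bin F c)) ((bcf a i).rTensor (Bin F c)
          ((g p).lTensor (Bin F a) u)) := by
      intro u
      induction u using TensorProduct.induction_on with
      | zero => simp
      | tmul x y => simp
      | add u v hu hv => simp only [map_add, hu, hv]
    rw [h1, hu, map_zero, map_zero]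
  have h2 : ∀ i j, ∀ u : Bin F a ⊗[F] Bin F b, cf₂ a b i j u =
      bcf b j ((TensorProduct.lid F (Bin F b)) ((bcf a i).rTensor (Bin F b) u)) := by
    intro i j u
    induction u using TensorProduct.induction_on with
    | zero => simp
    | tmul x y => simp [cf₂_tmul]
    | add u v hu hv => simp only [map_add, hu, hv]
  exact tensor_ext fun i j => by rw [h2, key, map_zero, map_zero]

lemma rTensor_faithful (hg : ∀ A p q, bact c A (g p q) = g (bact m A p) q + g p (bact b A q))
    (h0 : g ≠ 0) {u : Bin F b ⊗[F] Bin F a} (hu : ∀ p, (g p).rTensor (Bin F a) u = 0) : u = 0 := by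
  have h1 : TensorProduct.comm F _ _ u = 0 := by
    refine lTensor_faithful hg h0 fun p => ?_
    rw [← LinearMap.comm_comp_rTensor_comp_comm_eq]
    simp [hu]
  simpa using h1

end Factor

/-! ### The weights of `S_1` -/

lemma highestWeight_triangle [CharZero F] {a b μ : ℕ} {u : Bin F a ⊗[F] Bin F b}
    (he : actT a b (eMat F) u = 0)
    (hh : actT a b (hMat F) u = (μ : F) • u) (h0 : u ≠ 0) : Triangle a b μ := by
  obtain ⟨l, hla, hlb, hμ, -⟩ := highestWeight_shape he hh h0
  have : (μ : ℤ) = a + b - 2 * l := by exact_mod_cast hμ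
  refine ⟨?_, ?_, ?_, ?_⟩ <;> omega

/-- The numerical conditions for `V(μ)` to occur in `S_1(E(a₀, a₁), E(b₀, b₁))`. -/
def IsLink (m a₀ a₁ b₀ b₁ μ : ℕ) : Prop :=
  Triangle m a₁ a₀ ∧ Triangle m b₁ b₀ ∧ Triangle a₀ b₁ μ ∧ Triangle a₁ b₀ μ ∧
    (a₀ = 0 ∨ b₀ = 0 ∨ μ = 0 ∨ m = μ + a₀ + b₀ ∨ μ = m + a₀ + b₀ ∨ a₀ = b₀ + m + μ ∨
      b₀ = a₀ + m + μ)

/-- Geometrically, `m, a₀, μ, b₀` are the sides of a quadrilateral with diagonals `a₁` and `b₁`, and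
the last condition says that it is flat or has a side of length zero. That flat shapes with the same
data agree is a finite check in linear arithmetic. -/
lemma IsLink.unique {m a₀ a₁ b₀ b₁ μ ν : ℕ} (h : IsLink m a₀ a₁ b₀ b₁ μ)
    (h' : IsLink m a₀ a₁ b₀ b₁ ν) (hm : 1 ≤ m) : μ = ν := by
  obtain ⟨⟨-, h1, h2, h3⟩, ⟨-, h4, h5, h6⟩, ⟨-, h7, h8, h9⟩, ⟨-, h10, h11, h12⟩, hc⟩ := h
  obtain ⟨-, -, ⟨-, k7, k8, k9⟩, ⟨-, k10, k11, k12⟩, kc⟩ := h'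
  rcases hc with h | h | h | h | h | h | h <;> rcases kc with k | k | k | k | k | k | k <;> omega

/-- These are the conditions imposed by the two adjacent pairs of blocks in `S_2` when the third
block has the same degree as the first in both modules. -/
lemma IsLink.eq_of_double {m a₀ a₁ b₀ b₁ μ : ℕ} (h : IsLink m a₀ a₁ b₁ b₀ μ)
    (h' : IsLink m a₁ a₀ b₀ b₁ μ) (hm : 1 ≤ m) : μ = 0 ∧ a₀ = b₀ ∧ a₁ = b₁ := by
  obtain ⟨⟨-, h1, h2, h3⟩, ⟨-, h4, h5, h6⟩, ⟨-, h7, h8, h9⟩, ⟨-, h10, h11, h12⟩, hc⟩ := h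
  obtain ⟨-, -, ⟨-, k7, k8, k9⟩, ⟨-, k10, k11, k12⟩, kc⟩ := h'
  rcases hc with h | h | h | h | h | h | h <;> rcases kc with k | k | k | k | k | k | k <;> omega

/-! ### The vectors `f^j X₀^m` -/

section

variable (m : ℕ)

variable (F) in
/-- The vector `f^j X₀^m`. -/
def lowered (j : ℕ) : Bin F m := (bact m (fMat F))^[j] (bmono m 0)

lemma lowered_succ (j : ℕ) : lowered F m (j + 1) = bact m (fMat F) (lowered F m j) :=
  Function.iterate_succ_apply' _ _ _

lemma lowered_h (j : ℕ) : bact m (hMat F) (lowered F m j) = (m - 2 * j : F) • lowered F m j := by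
  induction j with
  | zero => exact bact_h_bmono (Nat.zero_le _)
  | succ j ih =>
    have h := bact_lie m (hMat F) (fMat F) (lowered F m j)
    rw [lie_h_f, bact_smul, ih, map_smul, ← lowered_succ, eq_comm, sub_eq_iff_eq_add] at h
    rw [h]
    push_cast
    module

lemma lowered_e_zero : bact m (eMat F) (lowered F m 0) = 0 := bact_e_bmono_zero m

lemma lowered_e (j : ℕ) :
    bact m (eMat F) (lowered F m (j + 1)) = ((j + 1) * (m - j) : F) • lowered F m j := by
  induction j with
  | zero =>
    have h := bact_lie m (eMat F) (fMat F) (lowered F m 0)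
    rw [lie_e_f, lowered_e_zero, map_zero, sub_zero, lowered_h, ← lowered_succ] at h
    rw [← h]
    simp
  | succ j ih =>
    have h := bact_lie m (eMat F) (fMat F) (lowered F m (j + 1))
    rw [lie_e_f, ih, map_smul, lowered_h, ← lowered_succ, ← lowered_succ, eq_comm,
      sub_eq_iff_eq_add] at h
    rw [h]
    push_cast
    module

lemma lowered_eq_smul (j : ℕ) : ∃ c : F, lowered F m j = c • bmono m j := by
  induction j with
  | zero => exact ⟨1, (one_smul _ _).symm⟩
  | succ j ih =>
    obtain ⟨c, hc⟩ := ih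
    rcases le_or_gt j m with h | h
    · exact ⟨c * (m - j), by rw [lowered_succ, hc, map_smul, bact_f_bmono h, smul_smul]⟩
    · exact ⟨0, by rw [lowered_succ, hc, bmono_eq_zero h, smul_zero, map_zero, zero_smul]⟩

lemma lowered_eq_zero {j : ℕ} (h : m < j) : lowered F m j = 0 := by
  obtain ⟨c, hc⟩ := lowered_eq_smul (F := F) m j
  rw [hc, bmono_eq_zero h, smul_zero]

lemma linear_eq_zero_of_lowered [CharZero F] {M : Type*} [AddCommGroup M] [Module F M]
    {T : Bin F m →ₗ[F] M} (h : ∀ j, T (lowered F m j) = 0) : T = 0 := by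
  have key : Submodule.span F (Set.range (lowered F m)) = ⊤ := by
    refine eq_top_of_f_stable (fun p hp => ?_) (Submodule.subset_span ⟨0, rfl⟩)
    have h1 : Submodule.span F (Set.range (lowered F m)) ≤
        (Submodule.span F (Set.range (lowered F m))).comap (bact m (fMat F)) := by
      rw [Submodule.span_le]
      rintro _ ⟨j, rfl⟩
      exact Submodule.subset_span ⟨j + 1, lowered_succ m j⟩
    exact h1 hp
  refine LinearMap.ext_on key ?_
  rintro _ ⟨j, rfl⟩
  rw [h, LinearMap.zero_apply]

end

/-- The vectors `τ j = (1 ⊗ g(f^j X₀^m)) u = -(f(f^j X₀^m) ⊗ 1) w` live in `V(a₀) ⊗ V(b₀)`. In the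
first form the factor `V(a₀)` is untouched, so the left Casimir identity for `u` passes to `τ`; in
the second form `V(b₀)` is untouched and the right identity for `w` passes to `τ`. -/
lemma isLink_of_highestWeight [CharZero F] {m a₀ a₁ b₀ b₁ μ : ℕ} (hm : 1 ≤ m)
    {f : Bin F m →ₗ[F] Bin F a₁ →ₗ[F] Bin F a₀} {g : Bin F m →ₗ[F] Bin F b₁ →ₗ[F] Bin F b₀}
    (hf : ∀ A p q, bact a₀ A (f p q) = f (bact m A p) q + f p (bact a₁ A q))
    (hg : ∀ A p q, bact b₀ A (g p q) = g (bact m A p) q + g p (bact b₁ A q))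
    (hf0 : f ≠ 0) (hg0 : g ≠ 0)
    {u : Bin F a₀ ⊗[F] Bin F b₁} {w : Bin F a₁ ⊗[F] Bin F b₀}
    (hue : actT a₀ b₁ (eMat F) u = 0) (huh : actT a₀ b₁ (hMat F) u = (μ : F) • u) (hu0 : u ≠ 0)
    (hwe : actT a₁ b₀ (eMat F) w = 0) (hwh : actT a₁ b₀ (hMat F) w = (μ : F) • w) (hw0 : w ≠ 0)
    (huw : ∀ p, (f p).rTensor (Bin F b₀) w + (g p).lTensor (Bin F a₀) u = 0) :
    IsLink m a₀ a₁ b₀ b₁ μ := by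
  refine ⟨bilinear_triangle hf hf0, bilinear_triangle hg hg0, highestWeight_triangle hue huh hu0,
    highestWeight_triangle hwe hwh hw0, ?_⟩
  set τ : ℕ → Bin F a₀ ⊗[F] Bin F b₀ := fun j => (g (lowered F m j)).lTensor (Bin F a₀) u with hτ
  have hτ' : ∀ j, τ j = -(f (lowered F m j)).rTensor (Bin F b₀) w := fun j => by
    rw [← add_eq_zero_iff_eq_neg, add_comm]
    exact huw _
  refine degenerate_of_chain (τ := τ) hm
    (lam := (a₀ * (a₀ + 2) + μ * (μ + 2) - b₁ * (b₁ + 2)) / 4)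
    (lam' := (b₀ * (b₀ + 2) + μ * (μ + 2) - a₁ * (a₁ + 2)) / 4) ?_ ?_ ?_ ?_ ?_ ?_ ?_
  · simp only [hτ]
    rw [actT_lTensor hg, lowered_e_zero, hue]
    simp
  · intro j
    simp only [hτ]
    rw [actT_lTensor hg, lowered_e, hue, map_smul, LinearMap.lTensor_smul, map_zero, add_zero,
      LinearMap.smul_apply]
  · intro j
    simp only [hτ]
    rw [actT_lTensor hg, lowered_h, huh, map_smul, LinearMap.lTensor_smul, map_smul,
      LinearMap.smul_apply]
    module
  · intro j hj
    simp only [hτ]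
    rw [lowered_eq_zero m hj]
    simp
  · by_contra! h
    refine hu0 (lTensor_faithful hg hg0 fun p => ?_)
    have h1 : ((LinearMap.lTensorHom (Bin F a₀) ∘ₗ g).flip u) = 0 :=
      linear_eq_zero_of_lowered m h
    exact LinearMap.congr_fun h1 p
  · intro j
    have h1 := congrArg ((g (lowered F m j)).lTensor (Bin F a₀)) (mixed_casimir_left hue huh)
    rw [map_add, map_smul, map_smul, ← actL_lTensor, ← actL_lTensor] at h1
    -- The correction `τ (j+1)` is the Leibniz term in which `f` acts on the argument of `g`.
    have h2 : (g (lowered F m j)).lTensor (Bin F a₀) (actT a₀ b₁ (fMat F) u) =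
        actT a₀ b₀ (fMat F) (τ j) - τ (j + 1) := by
      simp only [hτ]
      rw [actT_lTensor hg, ← lowered_succ]
      abel
    rw [← h2, ← h1]
  · intro j
    have h1 := congrArg ((f (lowered F m j)).rTensor (Bin F b₀)) (mixed_casimir_right hwe hwh)
    rw [map_add, map_smul, map_smul, ← actR_rTensor, ← actR_rTensor] at h1
    have h2 : (f (lowered F m j)).rTensor (Bin F b₀) (actT a₁ b₀ (fMat F) w) =
        -(actT a₀ b₀ (fMat F) (τ j) - τ (j + 1)) := by
      rw [hτ', hτ', map_neg, actT_rTensor hf, ← lowered_succ]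
      abel
    rw [h2] at h1
    rw [hτ' j] at h1 ⊢
    simp only [map_neg, smul_neg] at h1 ⊢
    rw [← h1]
    abel

end LinkCases

/-! ### The Heisenberg algebra -/

section Heisenberg

variable {F : Type*} [Field F] {n : ℕ}

variable (F n) in
/-- The inclusion `V(m) → 𝔥_n`. -/
def hvec : Bin F (2 * n - 1) →ₗ[F] Heis F n where
  toFun p := ⟨(toBin _).symm p, 0⟩
  map_add' p q := by ext1 <;> simp
  map_smul' c p := by ext1 <;> simp

variable (F n) in
/-- The central element `z` of `𝔥_n`. -/
def hcen : Heis F n := ⟨0, 1⟩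

lemma heis_eq (x : Heis F n) : x = hvec F n (toBin _ x.vec) + x.cen • hcen F n := by
  ext1 <;> simp [hvec, hcen]

lemma lie_hvec (p q : Bin F (2 * n - 1)) : ⁅hvec F n p, hvec F n q⁆ =
    (form _ ((toBin _).symm p) ((toBin _).symm q) -
      form _ ((toBin _).symm q) ((toBin _).symm p)) • hcen F n := by
  ext1 <;> simp [hvec, hcen]

lemma derHom_hvec (A : SL2 F) (p : Bin F (2 * n - 1)) :
    Heis.derHom F n A (hvec F n p) = hvec F n (bact _ A p) := rfl

lemma derHom_hcen (A : SL2 F) : Heis.derHom F n A (hcen F n) = 0 := by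
  change (⟨act _ A 0, 0⟩ : Heis F n) = 0
  rw [map_zero]
  rfl

lemma lie_ofSL2_ofHeis (A : SL2 F) (x : Heis F n) :
    ⁅ofSL2 F n A, ofHeis F n x⁆ = ofHeis F n (Heis.derHom F n A x) := by
  simp

lemma gal_eq (x : Gal F n) : x = ofHeis F n x.left + ofSL2 F n x.right := by
  simp

/-- The form on `V(m)` is non-zero and, as `m` is odd, skew-symmetric. So `V(m)` generates `𝔥_n`,
and vanishing statements for `z` can be deduced from those for `V(m)`. -/
lemma exists_hcen_eq [CharZero F] (hn : 1 ≤ n) :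
    ∃ (p q : Bin F (2 * n - 1)) (c : F), hcen F n = c • ⁅hvec F n p, hvec F n q⁆ := by
  obtain ⟨p, q, h⟩ := exists_form_ne_zero (F := F) (2 * n - 1)
  have hodd : Odd (2 * n - 1) := ⟨n - 1, by omega⟩
  refine ⟨toBin _ p, toBin _ q, (2 * form _ p q)⁻¹, ?_⟩
  have h2 : (2 * form _ p q : F) ≠ 0 := mul_ne_zero two_ne_zero h
  rw [lie_hvec]
  simp only [LinearEquiv.symm_apply_apply]
  rw [form_swap hodd p q, sub_neg_eq_add, ← two_mul, smul_smul, inv_mul_cancel₀ h2, one_smul]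

end Heisenberg

/-! ### Frames: socle decompositions in coordinates -/

section Frame

variable {F : Type*} [Field F] {n : ℕ} {M : Type*} [AddCommGroup M] [Module F M]
  [LieRingModule (Gal F n) M]

/-- A decomposition of a module into `sl(2)`-submodules `C i ≅ V(a i)`, `i ≤ ℓ`, in terms of the
inclusions and projections. -/
structure Coordinates (ℓ : ℕ) (a : ℕ → ℕ) (C : ℕ → LieSubmodule F (levi F n) M) where
  /-- The inclusions. -/
  ι : ∀ i, Bin F (a i) →ₗ[F] M
  /-- The projections. -/
  π : ∀ i, M →ₗ[F] Bin F (a i)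
  ι_bact : ∀ i A p, ι i (bact (a i) A p) = ⁅ofSL2 F n A, ι i p⁆
  π_lie : ∀ i A v, π i ⁅ofSL2 F n A, v⁆ = bact (a i) A (π i v)
  π_ι : ∀ i ≤ ℓ, ∀ p, π i (ι i p) = p
  π_ι_ne : ∀ i j, i ≠ j → ∀ p, π i (ι j p) = 0
  ι_zero : ∀ i, ℓ < i → ι i = 0
  π_zero : ∀ i, ℓ < i → π i = 0
  sum_ι_π : ∀ v, ∑ i ∈ Finset.range (ℓ + 1), ι i (π i v) = v
  range_ι : ∀ i, LinearMap.range (ι i) = (C i : Submodule F M)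

/-- Coordinates in which `𝔥_n` acts by strictly upper triangular block matrices. -/
structure Frame (ℓ : ℕ) (a : ℕ → ℕ) (C : ℕ → LieSubmodule F (levi F n) M) extends
    Coordinates ℓ a C where
  upper : ∀ i j, j ≤ i → ∀ x p, π i ⁅ofHeis F n x, ι j p⁆ = 0

namespace Coordinates

variable {ℓ : ℕ} {a : ℕ → ℕ} {C : ℕ → LieSubmodule F (levi F n) M} (fr : Coordinates ℓ a C)

lemma mem_iff (i : ℕ) (v : M) : v ∈ C i ↔ ∃ p, fr.ι i p = v := by
  rw [← LieSubmodule.mem_toSubmodule, ← fr.range_ι]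
  rfl

lemma ext_π {v w : M} (h : ∀ i ≤ ℓ, fr.π i v = fr.π i w) : v = w := by
  rw [← fr.sum_ι_π v, ← fr.sum_ι_π w]
  exact Finset.sum_congr rfl fun i hi => by
    rw [h i (by simpa [Nat.lt_succ_iff] using hi)]

end Coordinates

namespace Frame

variable [LieModule F (Gal F n) M] {ℓ : ℕ} {a : ℕ → ℕ} {C : ℕ → LieSubmodule F (levi F n) M}
  (fr : Frame ℓ a C)

/-- The matrix blocks of the action of `𝔥_n`. -/
def H (fr : Frame ℓ a C) (i j : ℕ) : Heis F n →ₗ[F] Bin F (a j) →ₗ[F] Bin F (a i) :=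
  LinearMap.mk₂ F (fun x p => fr.π i ⁅ofHeis F n x, fr.ι j p⁆)
    (fun x y p => by rw [map_add, add_lie, map_add])
    (fun c x p => by rw [map_smul, smul_lie, map_smul])
    (fun x p q => by rw [map_add, lie_add, map_add])
    (fun c x p => by rw [map_smul, lie_smul, map_smul])

lemma H_apply (i j : ℕ) (x : Heis F n) (p : Bin F (a j)) :
    fr.H i j x p = fr.π i ⁅ofHeis F n x, fr.ι j p⁆ := rfl

lemma H_bact (i j : ℕ) (A : SL2 F) (x : Heis F n) (p : Bin F (a j)) :
    bact (a i) A (fr.H i j x p) =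
      fr.H i j (Heis.derHom F n A x) p + fr.H i j x (bact (a j) A p) := by
  rw [H_apply, H_apply, H_apply, ← fr.π_lie, leibniz_lie, lie_ofSL2_ofHeis, map_add, fr.ι_bact]

lemma π_lie_heis (i : ℕ) (x : Heis F n) (v : M) :
    fr.π i ⁅ofHeis F n x, v⁆ = ∑ j ∈ Finset.range (ℓ + 1), fr.H i j x (fr.π j v) := by
  conv_lhs => rw [← fr.sum_ι_π v, lie_sum, map_sum]
  rfl

lemma H_lie (i j : ℕ) (x y : Heis F n) (p : Bin F (a j)) :
    fr.H i j ⁅x, y⁆ p = ∑ k ∈ Finset.range (ℓ + 1), fr.H i k x (fr.H k j y p) -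
      ∑ k ∈ Finset.range (ℓ + 1), fr.H i k y (fr.H k j x p) := by
  rw [H_apply, LieHom.map_lie, lie_lie, map_sub, π_lie_heis, π_lie_heis]
  rfl

/-- The matrix blocks of the action of `V(m) ⊂ 𝔥_n`. -/
def X (fr : Frame ℓ a C) (i j : ℕ) : Bin F (2 * n - 1) →ₗ[F] Bin F (a j) →ₗ[F] Bin F (a i) :=
  (fr.H i j).comp (hvec F n)

lemma X_apply (i j : ℕ) (p : Bin F (2 * n - 1)) (q : Bin F (a j)) :
    fr.X i j p q = fr.H i j (hvec F n p) q := rfl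

lemma X_bact (i j : ℕ) (A : SL2 F) (p : Bin F (2 * n - 1)) (q : Bin F (a j)) :
    bact (a i) A (fr.X i j p q) = fr.X i j (bact _ A p) q + fr.X i j p (bact (a j) A q) := by
  rw [X_apply, X_apply, X_apply, H_bact, derHom_hvec]

/-- The matrix blocks of the action of the central element. -/
def Z (fr : Frame ℓ a C) (i j : ℕ) : Bin F (a j) →ₗ[F] Bin F (a i) := fr.H i j (hcen F n)

lemma Z_bact (i j : ℕ) (A : SL2 F) (q : Bin F (a j)) :
    fr.Z i j (bact (a j) A q) = bact (a i) A (fr.Z i j q) := by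
  rw [Z, H_bact, derHom_hcen, map_zero, LinearMap.zero_apply, zero_add]

lemma H_eq_zero_of_lt {j : ℕ} (h : ℓ < j) (i : ℕ) : fr.H i j = 0 := by
  ext1 x
  ext1 p
  rw [H_apply, fr.ι_zero j h, LinearMap.zero_apply, lie_zero, map_zero]
  rfl

lemma H_eq_zero {i j : ℕ} (h : j ≤ i) : fr.H i j = 0 := by
  ext1 x
  ext1 p
  rw [H_apply, fr.upper i j h]
  rfl

lemma H_eq_X_add_Z (i j : ℕ) (x : Heis F n) (p : Bin F (a j)) :
    fr.H i j x p = fr.X i j (toBin _ x.vec) p + x.cen • fr.Z i j p := by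
  conv_lhs => rw [heis_eq x]
  rw [map_add, map_smul]
  rfl

lemma X_eq_zero_of_parity [CharZero F] (hn : 1 ≤ n) {i j : ℕ} (h : (a i + a j) % 2 = 0) :
    fr.X i j = 0 := by
  by_contra h0
  obtain ⟨h1, -⟩ := bilinear_triangle (fr.X_bact i j) h0
  omega

end Frame

variable [LieModule F (Gal F n) M]

/-- The projections and inclusions of a decomposition into blocks. -/
lemma exists_projections {ℓ : ℕ} {a : ℕ → ℕ} {C : ℕ → LieSubmodule F (levi F n) M}
    (hC : IsSocleDecomposition ℓ a C) (i : ℕ) (hi : i ≤ ℓ) :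
    ∃ (ι : Bin F (a i) →ₗ[F] M) (π : M →ₗ[F] Bin F (a i)),
      (∀ A p, ι (bact (a i) A p) = ⁅ofSL2 F n A, ι p⁆) ∧
      (∀ A v, π ⁅ofSL2 F n A, v⁆ = bact (a i) A (π v)) ∧ (∀ p, π (ι p) = p) ∧
      (∀ v ∈ C i, ι (π v) = v) ∧
      (∀ j, j ≠ i → ∀ v ∈ C j, π v = 0) ∧ LinearMap.range ι = (C i : Submodule F M) := by
  obtain ⟨e⟩ := hC.equiv i hi
  set D : LieSubmodule F (levi F n) M := ⨆ j, ⨆ _ : j ≠ i, C j with hD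
  have hcompl : IsCompl (C i : Submodule F M) (D : Submodule F M) := by
    rw [LieSubmodule.isCompl_toSubmodule]
    refine ⟨hC.indep i, codisjoint_iff.2 (eq_top_iff.2 ?_)⟩
    rw [← hC.iSup_eq_top]
    refine iSup_le fun j => ?_
    by_cases hj : j = i
    · subst hj
      exact le_sup_left
    · exact le_sup_of_le_right (le_iSup₂_of_le j hj le_rfl)
  set P := Submodule.projectionOnto (C i : Submodule F M) (D : Submodule F M) hcompl with hP
  have hPleft : ∀ v (hv : v ∈ C i), P v = ⟨v, hv⟩ := fun v hv =>
    Submodule.projectionOnto_apply_of_mem_left hcompl hv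
  have hPright : ∀ v ∈ D, P v = 0 := fun v hv =>
    (Submodule.projectionOnto_apply_eq_zero_iff hcompl).2 hv
  let inc : V F (a i) →ₗ[F] M := (C i : Submodule F M).subtype ∘ₗ (e.symm : V F (a i) →ₗ[F] C i)
  have hinc : ∀ A p, inc (act (a i) A p) = ⁅ofSL2 F n A, inc p⁆ := by
    intro A p
    have h1 := e.symm.toLieModuleHom.map_lie ⟨ofSL2 F n A, ⟨A, rfl⟩⟩ p
    have h2 := congrArg Subtype.val h1
    exact h2
  have heq : ∀ A (c : C i), e ⟨⁅ofSL2 F n A, (c : M)⁆,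
      (C i).lie_mem (x := ⟨ofSL2 F n A, ⟨A, rfl⟩⟩) c.2⟩ = act (a i) A (e c) := by
    intro A c
    exact e.toLieModuleHom.map_lie ⟨ofSL2 F n A, ⟨A, rfl⟩⟩ c
  refine ⟨inc ∘ₗ (toBin (a i)).symm.toLinearMap,
    (toBin (a i)).toLinearMap ∘ₗ (e : C i →ₗ[F] V F (a i)) ∘ₗ P, ?_, ?_, ?_, ?_, ?_, ?_⟩
  · intro A p
    exact hinc A _
  · intro A v
    obtain ⟨c, d, rfl⟩ : ∃ (c : C i) (d : D), v = c + d := by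
      have hv : v ∈ (C i : Submodule F M) ⊔ (D : Submodule F M) := by
        rw [hcompl.sup_eq_top]
        trivial
      obtain ⟨c, hc, d, hd, rfl⟩ := Submodule.mem_sup.1 hv
      exact ⟨⟨c, hc⟩, ⟨d, hd⟩, rfl⟩
    have hc : ⁅ofSL2 F n A, (c : M)⁆ ∈ C i :=
      (C i).lie_mem (x := ⟨ofSL2 F n A, ⟨A, rfl⟩⟩) c.2
    have hd : ⁅ofSL2 F n A, (d : M)⁆ ∈ D := D.lie_mem (x := ⟨ofSL2 F n A, ⟨A, rfl⟩⟩) d.2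
    have h1 : P (c + d : M) = c := by
      rw [map_add, hPright d d.2, hPleft c c.2, add_zero]
      rfl
    have h2 : P ⁅ofSL2 F n A, (c + d : M)⁆ = ⟨_, hc⟩ := by
      rw [lie_add, map_add, hPright _ hd, hPleft _ hc, add_zero]
    rw [LinearMap.comp_apply, LinearMap.comp_apply, LinearMap.comp_apply, LinearMap.comp_apply,
      h1, h2]
    exact congrArg (toBin (a i)) (heq A c)
  · intro p
    rw [LinearMap.comp_apply, LinearMap.comp_apply, LinearMap.comp_apply]
    have h1 : P (inc ((toBin (a i)).symm p)) = e.symm ((toBin (a i)).symm p) :=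
      hPleft _ (e.symm ((toBin (a i)).symm p)).2
    change toBin (a i) (e (P (inc ((toBin (a i)).symm p)))) = p
    rw [h1, LieModuleEquiv.apply_symm_apply, LinearEquiv.apply_symm_apply]
  · intro v hv
    change ((e.symm ((toBin (a i)).symm (toBin (a i) (e (P v)))) : C i) : M) = v
    rw [LinearEquiv.symm_apply_apply, LieModuleEquiv.symm_apply_apply, hPleft v hv]
  · intro j hj v hv
    have h1 : v ∈ D := (le_iSup₂_of_le j hj le_rfl : C j ≤ D) hv
    change toBin (a i) (e (P v)) = 0
    rw [hPright v h1]
    exact map_zero ((toBin (a i)).toLinearMap ∘ₗ (e : C i →ₗ[F] V F (a i)))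
  · apply le_antisymm
    · rintro _ ⟨p, rfl⟩
      exact (e.symm ((toBin (a i)).symm p)).2
    · intro v hv
      refine ⟨toBin (a i) (e ⟨v, hv⟩), ?_⟩
      change ((e.symm ((toBin (a i)).symm (toBin (a i) (e ⟨v, hv⟩))) : C i) : M) = v
      rw [LinearEquiv.symm_apply_apply, LieModuleEquiv.symm_apply_apply]

end Frame

/-! ### Existence of frames -/

section Existence

variable {F : Type*} [Field F] {n : ℕ} {M : Type*} [AddCommGroup M] [Module F M]
  [LieRingModule (Gal F n) M] [LieModule F (Gal F n) M]
  {ℓ : ℕ} {a : ℕ → ℕ} {C : ℕ → LieSubmodule F (levi F n) M}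

lemma exists_coordinates (hC : IsSocleDecomposition ℓ a C) : Nonempty (Coordinates ℓ a C) := by
  classical
  choose ι π h1 h2 h3 h4 h5 h6 using exists_projections hC
  let ι' : ∀ i, Bin F (a i) →ₗ[F] M := fun i => if hi : i ≤ ℓ then ι i hi else 0
  let π' : ∀ i, M →ₗ[F] Bin F (a i) := fun i => if hi : i ≤ ℓ then π i hi else 0
  have eι : ∀ i (hi : i ≤ ℓ), ι' i = ι i hi := fun i hi => dif_pos hi
  have eπ : ∀ i (hi : i ≤ ℓ), π' i = π i hi := fun i hi => dif_pos hi
  have eι0 : ∀ i, ℓ < i → ι' i = 0 := fun i hi => dif_neg (not_le.2 hi)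
  have eπ0 : ∀ i, ℓ < i → π' i = 0 := fun i hi => dif_neg (not_le.2 hi)
  have range : ∀ i, LinearMap.range (ι' i) = (C i : Submodule F M) := by
    intro i
    by_cases hi : i ≤ ℓ
    · rw [eι i hi, h6 i hi]
    · rw [eι0 i (not_le.1 hi), LinearMap.range_zero, hC.eq_bot i (not_le.1 hi)]
      rfl
  have vanish : ∀ i j, i ≠ j → ∀ v ∈ C j, π' i v = 0 := by
    intro i j hij v hv
    by_cases hi : i ≤ ℓ
    · rw [eπ i hi, h5 i hi j hij.symm v hv]
    · rw [eπ0 i (not_le.1 hi), LinearMap.zero_apply]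
  have mem : ∀ j p, ι' j p ∈ C j := fun j p => by
    rw [← LieSubmodule.mem_toSubmodule, ← range]
    exact ⟨p, rfl⟩
  refine ⟨⟨ι', π', ?_, ?_, ?_, fun i j hij p => vanish i j hij _ (mem j p), eι0, eπ0, ?_, range⟩⟩
  · intro i A p
    by_cases hi : i ≤ ℓ
    · rw [eι i hi, h1]
    · rw [eι0 i (not_le.1 hi), LinearMap.zero_apply, LinearMap.zero_apply, lie_zero]
  · intro i A v
    by_cases hi : i ≤ ℓ
    · rw [eπ i hi, h2]
    · rw [eπ0 i (not_le.1 hi), LinearMap.zero_apply, LinearMap.zero_apply, map_zero]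
  · intro i hi p
    rw [eπ i hi, eι i hi, h3]
  · intro v
    have hv : v ∈ ⨆ i, C i := by
      rw [hC.iSup_eq_top]
      trivial
    induction hv using LieSubmodule.iSup_induction' with
    | mem i x hx =>
      by_cases hi : i ≤ ℓ
      · rw [Finset.sum_eq_single i]
        · rw [eι i hi, eπ i hi, h4 i hi x hx]
        · intro j _ hj
          rw [vanish j i hj x hx, map_zero]
        · intro h
          exact absurd (Finset.mem_range.2 (Nat.lt_succ_of_le hi)) h
      · rw [hC.eq_bot i (not_le.1 hi)] at hx
        have hx0 : x = 0 := hx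
        simp [hx0]
    | zero => simp
    | add x y _ _ hx hy =>
      simp only [map_add, Finset.sum_add_distrib]
      rw [hx, hy]

namespace Coordinates

variable (fr : Coordinates ℓ a C)

lemma mem_socleSeries_iff (hC : IsSocleDecomposition ℓ a C) {k : ℕ} (hk : k ≤ ℓ + 1) (v : M) :
    v ∈ socleSeries F (Gal F n) M k ↔ ∀ j, k ≤ j → fr.π j v = 0 := by
  rw [← LieSubmodule.mem_toSubmodule, ← hC.partial_sum k hk]
  constructor
  · intro hv j hj
    have hle : ((⨆ i, ⨆ _ : i < k, C i : LieSubmodule F (levi F n) M) : Submodule F M) ≤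
        LinearMap.ker (fr.π j) := by
      simp only [LieSubmodule.iSup_toSubmodule]
      refine iSup_le fun i => iSup_le fun hi => ?_
      intro w hw
      obtain ⟨p, rfl⟩ := (fr.mem_iff i w).1 hw
      exact fr.π_ι_ne j i (by omega) p
    exact hle hv
  · intro hv
    rw [← fr.sum_ι_π v]
    refine Submodule.sum_mem _ fun i _ => ?_
    by_cases hi : i < k
    · have hle : C i ≤ ⨆ i, ⨆ _ : i < k, C i := le_iSup₂_of_le i hi le_rfl
      exact hle ((fr.mem_iff i _).2 ⟨_, rfl⟩)
    · rw [hv i (not_lt.1 hi), map_zero]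
      exact Submodule.zero_mem _

lemma ι_mem_socleSeries (hC : IsSocleDecomposition ℓ a C) {k j : ℕ} (hk : k ≤ ℓ + 1) (hj : j < k)
    (p : Bin F (a j)) : fr.ι j p ∈ socleSeries F (Gal F n) M k :=
  (fr.mem_socleSeries_iff hC hk _).2 fun i hi => fr.π_ι_ne i j (by omega) p

end Coordinates

variable [CharZero F]

/-- Blocks below the diagonal vanish because the socle terms are submodules. A diagonal block of
`V(m)` is an equivariant map `V(m) ⊗ V(a_j) → V(a_j)`, excluded by parity. The central element then
follows as a commutator. -/
lemma exists_frame (hn : 1 ≤ n) (hC : IsSocleDecomposition ℓ a C) : Nonempty (Frame ℓ a C) := by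
  obtain ⟨fr⟩ := exists_coordinates hC
  have below : ∀ i j, j < i → ∀ x p, fr.π i ⁅ofHeis F n x, fr.ι j p⁆ = 0 := by
    intro i j hij x p
    by_cases hj : j ≤ ℓ
    · exact (fr.mem_socleSeries_iff hC (k := j + 1) (by omega) _).1
        ((socleSeries F (Gal F n) M (j + 1)).lie_mem
          (fr.ι_mem_socleSeries hC (by omega) (by omega) p)) i hij
    · rw [fr.ι_zero j (not_le.1 hj), LinearMap.zero_apply, lie_zero, map_zero]
  have diagVec : ∀ j x p, fr.π j ⁅ofHeis F n (hvec F n x), fr.ι j p⁆ = 0 := by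
    intro j
    let B : Bin F (2 * n - 1) →ₗ[F] Bin F (a j) →ₗ[F] Bin F (a j) :=
      LinearMap.mk₂ F (fun x p => fr.π j ⁅ofHeis F n (hvec F n x), fr.ι j p⁆)
        (fun x y p => by rw [map_add, map_add, add_lie, map_add])
        (fun c x p => by rw [map_smul, map_smul, smul_lie, map_smul])
        (fun x p q => by rw [map_add, lie_add, map_add])
        (fun c x p => by rw [map_smul, lie_smul, map_smul])
    have hB : ∀ A x p, bact (a j) A (B x p) = B (bact _ A x) p + B x (bact (a j) A p) := by
      intro A x p
      change bact (a j) A (fr.π j ⁅ofHeis F n (hvec F n x), fr.ι j p⁆) =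
        fr.π j ⁅ofHeis F n (hvec F n (bact _ A x)), fr.ι j p⁆ +
          fr.π j ⁅ofHeis F n (hvec F n x), fr.ι j (bact (a j) A p)⁆
      rw [← fr.π_lie, leibniz_lie, lie_ofSL2_ofHeis, map_add, fr.ι_bact, derHom_hvec]
    have hB0 : B = 0 := by
      by_contra h0
      obtain ⟨h1, -⟩ := bilinear_triangle hB h0
      omega
    intro x p
    exact LinearMap.congr_fun₂ hB0 x p
  have vec : ∀ j ≤ ℓ, ∀ x p, ⁅ofHeis F n (hvec F n x), fr.ι j p⁆ ∈ socleSeries F (Gal F n) M j := by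
    intro j hj x p
    refine (fr.mem_socleSeries_iff hC (by omega) _).2 fun i hi => ?_
    rcases hi.eq_or_lt with rfl | hi
    · exact diagVec j x p
    · exact below i j hi _ p
  have all : ∀ j ≤ ℓ, ∀ x p, ⁅ofHeis F n x, fr.ι j p⁆ ∈ socleSeries F (Gal F n) M j := by
    intro j hj x p
    have hz : ⁅ofHeis F n (hcen F n), fr.ι j p⁆ ∈ socleSeries F (Gal F n) M j := by
      obtain ⟨y, y', c, h⟩ := exists_hcen_eq (F := F) hn
      rw [h, map_smul, smul_lie, LieHom.map_lie, lie_lie]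
      exact Submodule.smul_mem _ _ (Submodule.sub_mem _
        ((socleSeries F (Gal F n) M j).lie_mem (vec j hj y' p))
        ((socleSeries F (Gal F n) M j).lie_mem (vec j hj y p)))
    rw [heis_eq x, map_add, add_lie, map_smul, smul_lie]
    exact Submodule.add_mem _ (vec j hj _ p) (Submodule.smul_mem _ _ hz)
  refine ⟨⟨fr, fun i j hij x p => ?_⟩⟩
  by_cases hj : j ≤ ℓ
  · exact (fr.mem_socleSeries_iff hC (by omega) _).1 (all j hj x p) i hij
  · rw [fr.ι_zero j (not_le.1 hj), LinearMap.zero_apply, lie_zero, map_zero]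

lemma isIrreducible_of_range {L Q : Type*} [LieRing L] [LieAlgebra F L] [AddCommGroup Q]
    [Module F Q] [LieRingModule L Q] {d : ℕ} (N : LieSubmodule F L Q)
    (j : Bin F d →ₗ[F] Q) (hr : LinearMap.range j = (N : Submodule F Q)) (h0 : j ≠ 0)
    (hj : ∀ A, ∃ x : L, ∀ p, j (bact d A p) = ⁅x, j p⁆) : LieModule.IsIrreducible F L N := by
  have mem : ∀ p, j p ∈ N := fun p => by
    rw [← LieSubmodule.mem_toSubmodule, ← hr]
    exact ⟨p, rfl⟩
  have : Nontrivial N := by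
    obtain ⟨p, hp⟩ := DFunLike.ne_iff.1 h0
    exact ⟨⟨⟨j p, mem p⟩, 0, fun h => hp (congrArg Subtype.val h)⟩⟩
  refine LieModule.IsIrreducible.mk fun K hK => ?_
  have key : ((K : Submodule F N).map (N : Submodule F Q).subtype).comap j = ⊤ := by
    refine eq_top_of_stable ?_ ?_
    · rintro A p ⟨(k : N), hk, hkp⟩
      obtain ⟨x, hx⟩ := hj A
      refine ⟨(⁅x, k⁆ : N), K.lie_mem hk, ?_⟩
      rw [hx, ← hkp]
      rfl
    · obtain ⟨k, hk, hk0⟩ : ∃ k ∈ K, k ≠ 0 := by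
        by_contra! h
        exact hK ((LieSubmodule.eq_bot_iff K).2 h)
      obtain ⟨p, hp⟩ : (k : Q) ∈ LinearMap.range j := by
        rw [hr]
        exact k.2
      refine (Submodule.ne_bot_iff _).2 ⟨p, ⟨k, hk, hp.symm⟩, ?_⟩
      rintro rfl
      rw [map_zero] at hp
      exact hk0 (Subtype.ext hp.symm)
  refine eq_top_iff.2 fun k _ => ?_
  obtain ⟨p, hp⟩ : (k : Q) ∈ LinearMap.range j := by
    rw [hr]
    exact k.2
  obtain ⟨k', hk', h⟩ : p ∈ ((K : Submodule F N).map (N : Submodule F Q).subtype).comap j := by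
    rw [key]
    trivial
  rw [hp] at h
  rwa [← Subtype.ext h]

namespace Frame

variable (fr : Frame ℓ a C)

/-- A commutator of strictly upper triangular block matrices starts two places above the diagonal.
-/
lemma Z_eq_zero (hn : 1 ≤ n) {i j : ℕ} (h : j ≤ i + 1) : fr.Z i j = 0 := by
  obtain ⟨x, y, c, hz⟩ := exists_hcen_eq (F := F) hn
  ext1 p
  rw [Z, hz, map_smul, LinearMap.smul_apply, fr.H_lie]
  have key : ∀ x y, ∀ k ∈ Finset.range (ℓ + 1), fr.H i k x (fr.H k j y p) = 0 := by
    intro x y k _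
    by_cases hk : k ≤ i
    · rw [fr.H_eq_zero hk]
      rfl
    · rw [fr.H_eq_zero (show j ≤ k by omega)]
      simp
  rw [Finset.sum_eq_zero (key _ _), Finset.sum_eq_zero (key _ _), sub_zero, smul_zero]
  rfl

/-- If the block vanished, `𝔥_n` would map `V(a_{i+1})` into `socⁱ`. Its image in the quotient by
`socⁱ` would be an irreducible submodule, so `V(a_{i+1})` would already lie in `socⁱ⁺¹`. -/
lemma X_ne_zero (hn : 1 ≤ n) (hC : IsSocleDecomposition ℓ a C) {i : ℕ} (hi : i + 1 ≤ ℓ) :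
    fr.X i (i + 1) ≠ 0 := by
  intro h0
  set L := socleSeries F (Gal F n) M i with hL
  let j : Bin F (a (i + 1)) →ₗ[F] M ⧸ L :=
    (LieSubmodule.Quotient.mk' L : M →ₗ[F] M ⧸ L) ∘ₗ fr.ι (i + 1)
  have hH : ∀ x p, ⁅ofHeis F n x, fr.ι (i + 1) p⁆ ∈ L := by
    intro x p
    refine (fr.mem_socleSeries_iff hC (by omega) _).2 fun k hk => ?_
    rw [← H_apply]
    rcases hk.eq_or_lt with rfl | hk
    · rw [H_eq_X_add_Z, h0, fr.Z_eq_zero hn le_rfl]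
      simp
    · rw [fr.H_eq_zero hk]
      rfl
  have hj : ∀ x p, ⁅(x : Gal F n), j p⁆ = j (bact _ x.right p) := by
    intro x p
    change ⁅x, LieSubmodule.Quotient.mk' L (fr.ι (i + 1) p)⁆ =
      LieSubmodule.Quotient.mk' L (fr.ι (i + 1) (bact _ x.right p))
    rw [← LieModuleHom.map_lie, gal_eq x, add_lie, map_add,
      (LieSubmodule.Quotient.mk_eq_zero (N := L)).2 (hH _ p), zero_add]
    simp [fr.ι_bact]
  let N : LieSubmodule F (Gal F n) (M ⧸ L) :=
    { toSubmodule := LinearMap.range j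
      lie_mem := by
        rintro x _ ⟨p, rfl⟩
        exact ⟨_, (hj x p).symm⟩ }
  have not_mem : ∀ p, p ≠ 0 → fr.ι (i + 1) p ∉ socleSeries F (Gal F n) M (i + 1) := by
    intro p hp h
    have h1 := (fr.mem_socleSeries_iff hC (by omega) _).1 h (i + 1) le_rfl
    rw [fr.π_ι _ hi] at h1
    exact hp h1
  have hj0 : j ≠ 0 := by
    intro h
    have h1 := LinearMap.congr_fun h (bmono _ 0)
    have h2 := (fr.mem_socleSeries_iff hC (by omega) _).1
      ((LieSubmodule.Quotient.mk_eq_zero (N := L)).1 h1) (i + 1) (by omega)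
    rw [fr.π_ι _ hi] at h2
    exact bmono_zero_ne_zero _ h2
  have hirr : LieModule.IsIrreducible F (Gal F n) N :=
    isIrreducible_of_range N j rfl hj0 fun A => ⟨ofSL2 F n A, fun p => by rw [hj]; simp⟩
  have hle : N ≤ socle F (Gal F n) (M ⧸ L) := le_sSup hirr
  exact not_mem _ (bmono_zero_ne_zero _) (hle ⟨bmono _ 0, rfl⟩)

end Frame

end Existence

/-! ### Block components of tensor products -/

section Blocks

variable {F : Type*} [Field F] {n : ℕ} {M N : Type*} [AddCommGroup M] [Module F M]
  [LieRingModule (Gal F n) M] [AddCommGroup N] [Module F N] [LieRingModule (Gal F n) N]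
  {k ℓ : ℕ} {a b : ℕ → ℕ} {C : ℕ → LieSubmodule F (levi F n) M}
  {D : ℕ → LieSubmodule F (levi F n) N}

/-- The projection of `M ⊗ N` to a block. -/
def comp (fr : Frame k a C) (gr : Frame ℓ b D) (i j : ℕ) :
    M ⊗[F] N →ₗ[F] Bin F (a i) ⊗[F] Bin F (b j) := TensorProduct.map (fr.π i) (gr.π j)

/-- The inclusion of a block into `M ⊗ N`. -/
def emb (fr : Frame k a C) (gr : Frame ℓ b D) (i j : ℕ) :
    Bin F (a i) ⊗[F] Bin F (b j) →ₗ[F] M ⊗[F] N := TensorProduct.map (fr.ι i) (gr.ι j)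

variable (fr : Frame k a C) (gr : Frame ℓ b D)

lemma comp_emb {i j : ℕ} (hi : i ≤ k) (hj : j ≤ ℓ) (u : Bin F (a i) ⊗[F] Bin F (b j)) :
    comp fr gr i j (emb fr gr i j u) = u := by
  induction u using TensorProduct.induction_on with
  | zero => simp
  | tmul p q => rw [comp, emb, TensorProduct.map_tmul, TensorProduct.map_tmul, fr.π_ι i hi,
      gr.π_ι j hj]
  | add u v hu hv => rw [map_add, map_add, hu, hv]

lemma comp_emb_of_ne {i j i' j' : ℕ} (h : i ≠ i' ∨ j ≠ j')
    (u : Bin F (a i') ⊗[F] Bin F (b j')) : comp fr gr i j (emb fr gr i' j' u) = 0 := by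
  induction u using TensorProduct.induction_on with
  | zero => simp
  | tmul p q =>
    rw [comp, emb, TensorProduct.map_tmul, TensorProduct.map_tmul]
    rcases h with h | h
    · rw [fr.π_ι_ne i i' h, TensorProduct.zero_tmul]
    · rw [gr.π_ι_ne j j' h, TensorProduct.tmul_zero]
  | add u v hu hv => rw [map_add, map_add, hu, hv, add_zero]

lemma comp_eq_zero {i j : ℕ} (h : k < i ∨ ℓ < j) (u : M ⊗[F] N) : comp fr gr i j u = 0 := by
  rcases h with h | h
  · rw [comp, fr.π_zero i h, TensorProduct.map_zero_left, LinearMap.zero_apply]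
  · rw [comp, gr.π_zero j h, TensorProduct.map_zero_right, LinearMap.zero_apply]

lemma sum_emb_comp (u : M ⊗[F] N) : ∑ i ∈ Finset.range (k + 1), ∑ j ∈ Finset.range (ℓ + 1),
    emb fr gr i j (comp fr gr i j u) = u := by
  induction u using TensorProduct.induction_on with
  | zero => simp
  | tmul v w =>
    simp only [comp, emb, TensorProduct.map_tmul, ← TensorProduct.tmul_sum]
    rw [← TensorProduct.sum_tmul, fr.sum_ι_π, gr.sum_ι_π]
  | add u v hu hv =>
    simp only [map_add, Finset.sum_add_distrib]
    rw [hu, hv]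

lemma eq_of_comp_eq {u v : M ⊗[F] N} (h : ∀ i j, comp fr gr i j u = comp fr gr i j v) :
    u = v := by
  rw [← sum_emb_comp fr gr u, ← sum_emb_comp fr gr v]
  simp only [h]

variable [LieModule F (Gal F n) M] [LieModule F (Gal F n) N]

lemma lie_gal_tmul (x : Gal F n) (v : M) (w : N) : ⁅x, v ⊗ₜ[F] w⁆ = ⁅x, v⁆ ⊗ₜ w + v ⊗ₜ ⁅x, w⁆ :=
  TensorProduct.LieModule.lie_tmul_right x v w

lemma comp_lie (A : SL2 F) (i j : ℕ) (u : M ⊗[F] N) :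
    comp fr gr i j ⁅ofSL2 F n A, u⁆ = actT (a i) (b j) A (comp fr gr i j u) := by
  induction u using TensorProduct.induction_on with
  | zero => simp
  | tmul v w => rw [lie_gal_tmul, map_add, comp, TensorProduct.map_tmul, TensorProduct.map_tmul,
      TensorProduct.map_tmul, fr.π_lie, gr.π_lie, actT_tmul]
  | add u v hu hv => rw [lie_add, map_add, map_add, map_add, hu, hv]

lemma emb_actT (A : SL2 F) (i j : ℕ) (u : Bin F (a i) ⊗[F] Bin F (b j)) :
    emb fr gr i j (actT (a i) (b j) A u) = ⁅ofSL2 F n A, emb fr gr i j u⁆ := by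
  induction u using TensorProduct.induction_on with
  | zero => simp
  | tmul p q => rw [actT_tmul, map_add, emb, TensorProduct.map_tmul, TensorProduct.map_tmul,
      TensorProduct.map_tmul, lie_gal_tmul, fr.ι_bact, gr.ι_bact]
  | add u v hu hv => rw [map_add, map_add, map_add, lie_add, hu, hv]

lemma comp_lie_heis (x : Heis F n) (i j : ℕ) (u : M ⊗[F] N) :
    comp fr gr i j ⁅ofHeis F n x, u⁆ =
      ∑ i' ∈ Finset.range (k + 1), (fr.H i i' x).rTensor (Bin F (b j)) (comp fr gr i' j u) +
      ∑ j' ∈ Finset.range (ℓ + 1), (gr.H j j' x).lTensor (Bin F (a i)) (comp fr gr i j' u) := by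
  induction u using TensorProduct.induction_on with
  | zero => simp
  | tmul v w =>
    rw [lie_gal_tmul, map_add]
    simp only [comp, TensorProduct.map_tmul, LinearMap.rTensor_tmul, LinearMap.lTensor_tmul]
    rw [fr.π_lie_heis, gr.π_lie_heis, TensorProduct.sum_tmul, TensorProduct.tmul_sum]
  | add u v hu hv =>
    simp only [lie_add, map_add, Finset.sum_add_distrib, hu, hv]
    abel

lemma range_emb (i j : ℕ) :
    LinearMap.range (emb fr gr i j) = (tensorBlock (C i) (D j) : Submodule F (M ⊗[F] N)) := by
  have h1 : (tensorBlock (C i) (D j) : Submodule F (M ⊗[F] N)) = LinearMap.range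
      (TensorProduct.map (C i : Submodule F M).subtype (D j : Submodule F N).subtype) := by
    rw [tensorBlock, LieModuleHom.toSubmodule_range]
    rfl
  rw [h1, emb, TensorProduct.range_map, TensorProduct.range_map, fr.range_ι, gr.range_ι,
    Submodule.range_subtype, Submodule.range_subtype]

lemma mem_tensorBlock_iff (i j : ℕ) (u : M ⊗[F] N) :
    u ∈ tensorBlock (C i) (D j) ↔ ∃ w, emb fr gr i j w = u := by
  rw [← LieSubmodule.mem_toSubmodule, ← range_emb fr gr]
  rfl

lemma mem_iSup_tensorBlock_iff (t : ℕ) (u : M ⊗[F] N) :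
    u ∈ (⨆ i, ⨆ j, ⨆ _ : i + j = t, tensorBlock (C i) (D j)) ↔
      ∀ i j, i + j ≠ t → comp fr gr i j u = 0 := by
  constructor
  · intro hu i j hij
    have hle : ((⨆ i, ⨆ j, ⨆ _ : i + j = t, tensorBlock (C i) (D j) :
        LieSubmodule F (levi F n) (M ⊗[F] N)) : Submodule F (M ⊗[F] N)) ≤
        LinearMap.ker (comp fr gr i j) := by
      simp only [LieSubmodule.iSup_toSubmodule]
      refine iSup_le fun i' => iSup_le fun j' => iSup_le fun h => ?_
      rw [← range_emb fr gr]
      rintro _ ⟨w, rfl⟩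
      exact comp_emb_of_ne fr gr (by omega) w
    exact hle hu
  · intro hu
    rw [← sum_emb_comp fr gr u]
    refine sum_mem fun i _ => sum_mem fun j _ => ?_
    by_cases h : i + j = t
    · have hle : tensorBlock (C i) (D j) ≤ ⨆ i, ⨆ j, ⨆ _ : i + j = t, tensorBlock (C i) (D j) :=
        le_iSup_of_le i (le_iSup_of_le j (le_iSup_of_le h le_rfl))
      exact hle ((mem_tensorBlock_iff fr gr i j _).2 ⟨_, rfl⟩)
    · rw [hu i j h, map_zero]
      exact zero_mem _

/-- Each of the two sums has a single term of total degree `t`, possibly outside the range and then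
zero. -/
lemma comp_lie_heis_of_mem {t : ℕ} {u : M ⊗[F] N} (hu : ∀ i j, i + j ≠ t → comp fr gr i j u = 0)
    (x : Heis F n) {i j i' j' : ℕ} (hi : i' + j = t) (hj : i + j' = t) :
    comp fr gr i j ⁅ofHeis F n x, u⁆ =
      (fr.H i i' x).rTensor (Bin F (b j)) (comp fr gr i' j u) +
        (gr.H j j' x).lTensor (Bin F (a i)) (comp fr gr i j' u) := by
  rw [comp_lie_heis]
  congr 1
  · refine Finset.sum_eq_single i' (fun i'' _ h => ?_) fun h => ?_
    · rw [hu i'' j (by omega), map_zero]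
    · rw [comp_eq_zero fr gr (Or.inl (by rw [Finset.mem_range] at h; omega)), map_zero]
  · refine Finset.sum_eq_single j' (fun j'' _ h => ?_) fun h => ?_
    · rw [hu i j'' (by omega), map_zero]
    · rw [comp_eq_zero fr gr (Or.inr (by rw [Finset.mem_range] at h; omega)), map_zero]

/-- Since `i' = t - j` and `j' = t - i`, the condition `i < i'` means `i + j < t`. In the remaining
blocks invariance is automatic by strict triangularity. -/
lemma mem_S_iff (t : ℕ) (u : M ⊗[F] N) : u ∈ S C D t ↔
    (∀ i j, i + j ≠ t → comp fr gr i j u = 0) ∧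
      ∀ i j i' j', i' + j = t → i + j' = t → i < i' → ∀ x : Heis F n,
        (fr.H i i' x).rTensor (Bin F (b j)) (comp fr gr i' j u) +
          (gr.H j j' x).lTensor (Bin F (a i)) (comp fr gr i j' u) = 0 := by
  have h1 : u ∈ S C D t ↔ u ∈ (⨆ i, ⨆ j, ⨆ _ : i + j = t, tensorBlock (C i) (D j)) ∧
    ∀ x : Heis F n, ⁅ofHeis F n x, u⁆ = 0 := Iff.rfl
  rw [h1, mem_iSup_tensorBlock_iff fr gr]
  refine and_congr_right fun hu => ⟨fun h i j i' j' hi hj _ x => ?_, fun h x => ?_⟩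
  · rw [← comp_lie_heis_of_mem fr gr hu x hi hj, h, map_zero]
  · refine eq_of_comp_eq fr gr fun i j => ?_
    rw [map_zero]
    by_cases hij : i + j < t
    · obtain ⟨i', hi⟩ : ∃ i', i' + j = t := ⟨t - j, by omega⟩
      obtain ⟨j', hj⟩ : ∃ j', i + j' = t := ⟨t - i, by omega⟩
      rw [comp_lie_heis_of_mem fr gr hu x hi hj, h i j i' j' hi hj (by omega)]
    · rw [comp_lie_heis, Finset.sum_eq_zero, Finset.sum_eq_zero, add_zero]
      · intro j' _
        by_cases hj : j' ≤ j
        · rw [gr.H_eq_zero hj]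
          simp
        · rw [hu i j' (by omega), map_zero]
      · intro i' _
        by_cases hi : i' ≤ i
        · rw [fr.H_eq_zero hi]
          simp
        · rw [hu i' j (by omega), map_zero]

lemma isHighestWeightVector_iff {μ : F} {u : M ⊗[F] N} (hu : u ≠ 0) :
    IsHighestWeightVector n μ u ↔ ∀ i j, actT (a i) (b j) (eMat F) (comp fr gr i j u) = 0 ∧
      actT (a i) (b j) (hMat F) (comp fr gr i j u) = μ • comp fr gr i j u := by
  constructor
  · rintro ⟨-, he, hh⟩ i j
    rw [← comp_lie, ← comp_lie, he, hh, map_zero, map_smul]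
    exact ⟨rfl, rfl⟩
  · intro h
    refine ⟨hu, eq_of_comp_eq fr gr fun i j => ?_, eq_of_comp_eq fr gr fun i j => ?_⟩
    · rw [comp_lie, (h i j).1, map_zero]
    · rw [comp_lie, (h i j).2, map_smul]

end Blocks

/-! ### Stable subspaces of `V(a) ⊗ V(b)` -/

section Stable

variable {F : Type*} [Field F]

lemma lie_h_e : ⁅hMat F, eMat F⁆ = (2 : F) • eMat F := by
  apply Subtype.ext
  rw [LieAlgebra.SpecialLinear.sl_bracket]
  change !![1, 0; 0, -1] * !![0, 1; 0, 0] - !![0, 1; 0, 0] * !![1, 0; 0, -1] =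
    (2 : F) • !![0, 1; 0, 0]
  ext i j
  fin_cases i <;> fin_cases j <;> norm_num

instance (a : ℕ) : Module.Finite F (Bin F a) := by
  classical
  refine ⟨⟨(Finset.range (a + 1)).image (bmono a), eq_top_iff.2 fun p _ => ?_⟩⟩
  rw [eq_sum_bmono p]
  exact Submodule.sum_mem _ fun i hi => Submodule.smul_mem _ _
    (Submodule.subset_span (Finset.mem_coe.2 (Finset.mem_image_of_mem _ hi)))

variable {a b : ℕ}

/-- `u` is a vector of weight `a + b - 2d`. -/
def HasDepth (d : ℕ) (u : Bin F a ⊗[F] Bin F b) : Prop :=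
  actT a b (hMat F) u = (a + b - 2 * d : F) • u

lemma HasDepth.f {d : ℕ} {u : Bin F a ⊗[F] Bin F b} (h : HasDepth d u) :
    HasDepth (d + 1) (actT a b (fMat F) u) := by
  have h1 := actT_lie (hMat F) (fMat F) u
  rw [lie_h_f, actT_smul, show actT a b (hMat F) u = _ from h, map_smul, eq_comm,
    sub_eq_iff_eq_add] at h1
  rw [HasDepth, h1, ← add_smul]
  push_cast
  congr 1
  ring

lemma HasDepth.e {d : ℕ} {u : Bin F a ⊗[F] Bin F b} (h : HasDepth (d + 1) u) :
    HasDepth d (actT a b (eMat F) u) := by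
  have h1 := actT_lie (hMat F) (eMat F) u
  rw [lie_h_e, actT_smul, show actT a b (hMat F) u = _ from h, map_smul, eq_comm,
    sub_eq_iff_eq_add] at h1
  rw [HasDepth, h1, ← add_smul]
  push_cast
  congr 1
  ring

lemma HasDepth.iterate_f {d : ℕ} {u : Bin F a ⊗[F] Bin F b} (h : HasDepth d u) (j : ℕ) :
    HasDepth (d + j) ((actT a b (fMat F))^[j] u) := by
  induction j with
  | zero => exact h
  | succ j ih =>
    rw [Function.iterate_succ_apply']
    exact ih.f

/-- The operator `h` is diagonalizable on the tensor product, so an `h`-stable subspace is the sum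
of its weight spaces. -/
lemma le_of_hasDepth {W U : Submodule F (Bin F a ⊗[F] Bin F b)}
    (hW : ∀ A, ∀ u ∈ W, actT a b A u ∈ W) (h : ∀ d, ∀ w ∈ W, HasDepth d w → w ∈ U) : W ≤ U := by
  have h1 : ⨆ μ, Module.End.genEigenspace (actT a b (hMat F)) μ 1 = ⊤ := by
    refine eq_top_iff.2 fun u _ => ?_
    rw [tensor_eq_sum u]
    refine Submodule.sum_mem _ fun i hi => Submodule.sum_mem _ fun j hj =>
      Submodule.smul_mem _ _ ?_
    refine Submodule.mem_iSup_of_mem (a - 2 * i + (b - 2 * j) : F) ?_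
    rw [Module.End.mem_genEigenspace_one, actT_tmul,
      bact_h_bmono (by simpa [Nat.lt_succ_iff] using hi),
      bact_h_bmono (by simpa [Nat.lt_succ_iff] using hj), TensorProduct.tmul_smul,
      ← TensorProduct.smul_tmul', ← add_smul]
  have h2 := Submodule.inf_iSup_genEigenspace (p := W) (f := actT a b (hMat F)) (hW (hMat F)) 1
  rw [h1, inf_top_eq] at h2
  rw [h2]
  refine iSup_le fun μ => ?_
  rintro w ⟨hw, hμ⟩
  rw [SetLike.mem_coe, Module.End.mem_genEigenspace_one] at hμ
  by_cases h0 : w = 0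
  · rw [h0]
    exact U.zero_mem
  obtain ⟨i, j, hij⟩ : ∃ i j, cf₂ a b i j w ≠ 0 := by
    by_contra! hc
    exact h0 (tensor_ext fun i j => by rw [hc, map_zero])
  have h3 := cf₂_weight hμ hij
  refine h (i + j) w hw ?_
  rw [HasDepth, hμ, h3]
  push_cast
  rfl

variable [CharZero F]

lemma HasDepth.eq_add {d : ℕ} {u : Bin F a ⊗[F] Bin F b} (h : HasDepth d u) {i j : ℕ}
    (h0 : cf₂ a b i j u ≠ 0) : d = i + j := by
  have h1 := cf₂_weight h h0
  have h2 : (d : F) = (i + j : ℕ) := by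
    have h3 : (2 : F) * d = 2 * (i + j : ℕ) := by
      push_cast
      linear_combination -h1
    exact mul_left_cancel₀ two_ne_zero h3
  exact_mod_cast h2

lemma HasDepth.eq_zero {d : ℕ} {u : Bin F a ⊗[F] Bin F b} (h : HasDepth d u) (hd : a + b < d) :
    u = 0 := by
  refine tensor_ext fun i j => ?_
  rw [map_zero]
  by_contra h0
  have h1 := h.eq_add h0
  rcases lt_or_ge a i with hi | hi
  · exact h0 (cf₂_eq_zero_left hi j u)
  · exact h0 (cf₂_eq_zero_right (by omega) i u)

lemma HasDepth.e_eq_zero {u : Bin F a ⊗[F] Bin F b} (h : HasDepth 0 u) :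
    actT a b (eMat F) u = 0 := by
  have h0 : ∀ i j, i + j ≠ 0 → cf₂ a b i j u = 0 := fun i j hij => by
    by_contra h0
    exact hij (h.eq_add h0).symm
  refine tensor_ext fun i j => ?_
  rw [actT_apply, map_add, cf₂_actL_e, cf₂_actR_e, h0 _ _ (by omega), h0 _ _ (by omega)]
  simp

lemma exists_highestWeight {W : Submodule F (Bin F a ⊗[F] Bin F b)}
    (hW : ∀ A, ∀ u ∈ W, actT a b A u ∈ W) (d : ℕ) :
    ∀ w ∈ W, w ≠ 0 → HasDepth d w →
      ∃ d' ≤ d, ∃ v ∈ W, v ≠ 0 ∧ actT a b (eMat F) v = 0 ∧ HasDepth d' v := by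
  induction d with
  | zero => exact fun w hw h0 h => ⟨0, le_rfl, w, hw, h0, h.e_eq_zero, h⟩
  | succ d ih =>
    intro w hw h0 h
    by_cases he : actT a b (eMat F) w = 0
    · exact ⟨d + 1, le_rfl, w, hw, h0, he, h⟩
    · obtain ⟨d', hd, v⟩ := ih _ (hW _ w hw) he h.e
      exact ⟨d', by omega, v⟩

lemma exists_highestWeight_of_ne_bot {W : Submodule F (Bin F a ⊗[F] Bin F b)}
    (hW : ∀ A, ∀ u ∈ W, actT a b A u ∈ W) (h : W ≠ ⊥) :
    ∃ d, ∃ v ∈ W, v ≠ 0 ∧ actT a b (eMat F) v = 0 ∧ HasDepth d v := by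
  by_contra! hc
  refine h (le_bot_iff.1 (le_of_hasDepth hW fun d w hw hd => ?_))
  by_contra h0
  obtain ⟨d', -, v, hv, hv0, he, hd'⟩ := exists_highestWeight hW d w hw h0 hd
  exact hc d' v hv hv0 he hd'

/-- The usual `sl(2)` computation only needs `f e u = 0`. This weaker hypothesis is what is
available for vectors just below the bottom of a string. -/
lemma actT_e_iterate_f {u : Bin F a ⊗[F] Bin F b} {ν : F}
    (hν : actT a b (hMat F) u = ν • u)
    (hu : actT a b (fMat F) (actT a b (eMat F) u) = 0) (j : ℕ) :
    actT a b (hMat F) ((actT a b (fMat F))^[j] u) = (ν - 2 * j) • (actT a b (fMat F))^[j] u ∧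
    actT a b (eMat F) ((actT a b (fMat F))^[j + 1] u) =
      ((j + 1) * (ν - j)) • (actT a b (fMat F))^[j] u := by
  induction j with
  | zero =>
    refine ⟨by simp [hν], ?_⟩
    rw [Function.iterate_succ_apply', Function.iterate_zero_apply, actT_e_f, hu, hν]
    simp
  | succ j ih =>
    have h1 : actT a b (hMat F) ((actT a b (fMat F))^[j + 1] u) =
        (ν - 2 * (j + 1 : ℕ)) • (actT a b (fMat F))^[j + 1] u := by
      have h2 := actT_lie (hMat F) (fMat F) ((actT a b (fMat F))^[j] u)
      rw [lie_h_f, actT_smul, ih.1, map_smul,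
        ← Function.iterate_succ_apply' (actT a b (fMat F)), eq_comm,
        sub_eq_iff_eq_add] at h2
      rw [h2, ← add_smul]
      push_cast
      congr 1
      ring
    refine ⟨h1, ?_⟩
    rw [Function.iterate_succ_apply', actT_e_f, ih.2, h1, map_smul,
      ← Function.iterate_succ_apply' (actT a b (fMat F)), ← add_smul]
    push_cast
    congr 1
    ring

/-- A vector of negative weight with `f e u = 0` vanishes. -/
lemma HasDepth.eq_zero_of_f_e {d : ℕ} {u : Bin F a ⊗[F] Bin F b} (h : HasDepth d u)
    (hd : a + b < 2 * d) (hu : actT a b (fMat F) (actT a b (eMat F) u) = 0) : u = 0 := by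
  by_contra h0
  have key : ∀ j, (actT a b (fMat F))^[j] u ≠ 0 := by
    intro j
    induction j with
    | zero => exact h0
    | succ j ih =>
      intro h1
      have h2 := (actT_e_iterate_f h hu j).2
      rw [h1, map_zero, eq_comm, smul_eq_zero] at h2
      refine ih (h2.resolve_left (mul_ne_zero (Nat.cast_add_one_ne_zero j) fun h3 => ?_))
      have h4 : ((a + b : ℕ) : F) = (2 * d + j : ℕ) := by
        push_cast
        linear_combination h3
      have h5 : a + b = 2 * d + j := by exact_mod_cast h4
      omega
  exact key (a + b) ((h.iterate_f _).eq_zero (by omega))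

/-- A stable subspace all of whose highest weight vectors have the same weight is irreducible. -/
lemma le_of_stable {U W : Submodule F (Bin F a ⊗[F] Bin F b)}
    (hU : ∀ A, ∀ u ∈ U, actT a b A u ∈ U) (hW : ∀ A, ∀ u ∈ W, actT a b A u ∈ W)
    (hUW : U ≤ W) (h0 : U ≠ ⊥)
    (hw : ∀ d d', ∀ v ∈ W, ∀ v' ∈ W, v ≠ 0 → v' ≠ 0 → actT a b (eMat F) v = 0 →
      actT a b (eMat F) v' = 0 → HasDepth d v → HasDepth d' v' → d = d') : W ≤ U := by
  obtain ⟨l, v, hv, hv0, hve, hvd⟩ := exists_highestWeight_of_ne_bot hU h0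
  have below : ∀ d, d < l → ∀ w ∈ W, HasDepth d w → w = 0 := by
    intro d hd w hwW hwd
    by_contra hw0
    obtain ⟨d', hd', v', hv', hv'0, he', hvd'⟩ := exists_highestWeight hW d w hwW hw0 hwd
    have := hw d' l v' hv' v (hUW hv) hv'0 hv0 he' hve hvd' hvd
    omega
  have inj : ∀ d, l < d → ∀ w ∈ W, HasDepth d w → actT a b (eMat F) w = 0 → w = 0 := by
    intro d hd w hwW hwd he
    by_contra hw0
    have := hw d l w hwW v (hUW hv) hw0 hv0 he hve hwd hvd
    omega
  have iter : ∀ j, (actT a b (fMat F))^[j] v ∈ U := by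
    intro j
    induction j with
    | zero => exact hv
    | succ j ih =>
      rw [Function.iterate_succ_apply']
      exact hU _ _ ih
  have hfe : actT a b (fMat F) (actT a b (eMat F) v) = 0 := by rw [hve, map_zero]
  have key : ∀ j, ∀ w ∈ W, HasDepth (l + j) w → ∃ c : F, w = c • (actT a b (fMat F))^[j] v := by
    intro j
    induction j with
    | zero =>
      intro w hwW hwd
      have he : actT a b (eMat F) w = 0 := by
        rcases Nat.eq_zero_or_pos l with rfl | hl
        · exact hwd.e_eq_zero
        · obtain ⟨l', rfl⟩ : ∃ l', l = l' + 1 := ⟨l - 1, by omega⟩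
          exact below l' (by omega) _ (hW _ w hwW) hwd.e
      exact highestWeight_unique hve hvd hv0 he hwd
    | succ j ih =>
      intro w hwW hwd
      obtain ⟨c, hc⟩ := ih _ (hW _ w hwW) (HasDepth.e hwd)
      -- In this case `f^j v` is the bottom of the string: `f^(j+1) v` is killed by `e`, hence zero
      -- by `inj`, and `w` has negative weight and satisfies `f e w = 0`.
      by_cases hj : (a + b - 2 * l : F) = j
      · have h1 : (actT a b (fMat F))^[j + 1] v = 0 := by
          refine inj (l + (j + 1)) (by omega) _ (hUW (iter _)) (hvd.iterate_f _) ?_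
          rw [(actT_e_iterate_f hvd hfe j).2, hj, sub_self, mul_zero, zero_smul]
        refine ⟨0, ?_⟩
        rw [zero_smul]
        refine HasDepth.eq_zero_of_f_e hwd ?_ ?_
        · have h2 : ((a + b : ℕ) : F) = (2 * l + j : ℕ) := by
            push_cast
            linear_combination hj
          have h3 : a + b = 2 * l + j := by exact_mod_cast h2
          omega
        · rw [hc, map_smul, ← Function.iterate_succ_apply' (actT a b (fMat F)), h1, smul_zero]
      · have hk : ((j + 1) * (a + b - 2 * l - j) : F) ≠ 0 :=
          mul_ne_zero (Nat.cast_add_one_ne_zero j) (sub_ne_zero.2 hj)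
        -- Chosen so that `e` kills the difference between `w` and this multiple of `f^(j+1) v`;
        -- then `inj` applies.
        refine ⟨c / ((j + 1) * (a + b - 2 * l - j)), ?_⟩
        set c' := c / ((j + 1) * (a + b - 2 * l - j) : F) with hc'
        have h1 : w - c' • (actT a b (fMat F))^[j + 1] v = 0 := by
          refine inj (l + (j + 1)) (by omega) _ (W.sub_mem hwW (W.smul_mem _ (hUW (iter _)))) ?_ ?_
          · have h2 : HasDepth (l + (j + 1)) ((actT a b (fMat F))^[j + 1] v) := hvd.iterate_f _
            rw [HasDepth] at h2 hwd ⊢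
            rw [map_sub, map_smul, h2, hwd, smul_sub, smul_comm c']
          · rw [map_sub, map_smul, hc, (actT_e_iterate_f hvd hfe j).2, smul_smul, hc',
              div_mul_cancel₀ _ hk, sub_self]
        exact sub_eq_zero.1 h1
  refine le_of_hasDepth hW fun d w hwW hwd => ?_
  rcases lt_or_ge d l with hd | hd
  · rw [below d hd w hwW hwd]
    exact U.zero_mem
  · obtain ⟨c, hc⟩ := key (d - l) w hwW (by rwa [Nat.add_sub_cancel' hd])
    rw [hc]
    exact U.smul_mem _ (iter _)

end Stable

/-! ### The spaces of invariants `S_t` -/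

section Invariants

variable {F : Type*} [Field F] {n : ℕ} {M N : Type*} [AddCommGroup M] [Module F M]
  [LieRingModule (Gal F n) M] [LieModule F (Gal F n) M] [AddCommGroup N] [Module F N]
  [LieRingModule (Gal F n) N] [LieModule F (Gal F n) N]
  {k ℓ : ℕ} {a b : ℕ → ℕ} {C : ℕ → LieSubmodule F (levi F n) M}
  {D : ℕ → LieSubmodule F (levi F n) N}

lemma S_zero (fr : Frame k a C) (gr : Frame ℓ b D) : S C D 0 = tensorBlock (C 0) (D 0) := by
  apply le_antisymm
  · refine inf_le_left.trans (iSup_le fun i => iSup_le fun j => iSup_le fun h => ?_)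
    obtain ⟨rfl, rfl⟩ : i = 0 ∧ j = 0 := by omega
    exact le_rfl
  · intro u hu
    obtain ⟨w, rfl⟩ := (mem_tensorBlock_iff fr gr 0 0 _).1 hu
    refine (mem_S_iff fr gr 0 _).2 ⟨fun i j hij => comp_emb_of_ne fr gr (by omega) w,
      fun i j i' j' hi hj hlt => ?_⟩
    omega

variable (fr : Frame k a C) (gr : Frame ℓ b D)

lemma adjacent_eq {t : ℕ} {u : M ⊗[F] N} (hu : u ∈ S C D t) {i j : ℕ} (hij : i + j + 1 = t)
    (p : Bin F (2 * n - 1)) :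
    (fr.X i (i + 1) p).rTensor (Bin F (b j)) (comp fr gr (i + 1) j u) +
      (gr.X j (j + 1) p).lTensor (Bin F (a i)) (comp fr gr i (j + 1) u) = 0 :=
  ((mem_S_iff fr gr t u).1 hu).2 i j (i + 1) (j + 1) (by omega) (by omega) (by omega) _

variable (hf : ∀ i, i + 1 ≤ k → fr.X i (i + 1) ≠ 0) (hg : ∀ j, j + 1 ≤ ℓ → gr.X j (j + 1) ≠ 0)

lemma lie_mem_S {t : ℕ} {u : M ⊗[F] N} (hu : u ∈ S C D t) (A : SL2 F) :
    ⁅ofSL2 F n A, u⁆ ∈ S C D t :=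
  (S C D t).lie_mem (x := ⟨ofSL2 F n A, ⟨A, rfl⟩⟩) hu

variable (C D) in
/-- The image of `S_t` in a block. -/
def blockImage (t i j : ℕ) : Submodule F (Bin F (a i) ⊗[F] Bin F (b j)) :=
  (S C D t : Submodule F (M ⊗[F] N)).map (comp fr gr i j)

lemma blockImage_stable (t i j : ℕ) (A : SL2 F) : ∀ w ∈ blockImage C D fr gr t i j,
    actT (a i) (b j) A w ∈ blockImage C D fr gr t i j := by
  rintro _ ⟨u, hu, rfl⟩
  exact ⟨_, lie_mem_S hu A, comp_lie fr gr A i j u⟩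

lemma comp_eq_zero_of_mem {t : ℕ} {u : M ⊗[F] N} (hu : u ∈ S C D t) {i j : ℕ} (h : i + j ≠ t) :
    comp fr gr i j u = 0 := ((mem_S_iff fr gr t u).1 hu).1 i j h

variable [CharZero F]

include hf hg in
-- The equation linking two adjacent components and the faithfulness of the superdiagonal blocks
-- spread a zero in both directions along `i + j = t`; outside the range of blocks there is nothing
-- to show.
lemma eq_zero_of_comp_eq_zero {t : ℕ} {u : M ⊗[F] N} (hu : u ∈ S C D t) {i j : ℕ}
    (hij : i + j = t) (h0 : comp fr gr i j u = 0) : u = 0 := by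
  have up : ∀ i j, i + j + 1 = t → comp fr gr i (j + 1) u = 0 → comp fr gr (i + 1) j u = 0 := by
    intro i j hij h
    by_cases hi : i + 1 ≤ k
    · refine rTensor_faithful (fr.X_bact i (i + 1)) (hf i hi) fun p => ?_
      have h1 := adjacent_eq fr gr hu hij p
      rwa [h, map_zero, add_zero] at h1
    · exact comp_eq_zero fr gr (Or.inl (not_le.1 hi)) u
  have down : ∀ i j, i + j + 1 = t → comp fr gr (i + 1) j u = 0 → comp fr gr i (j + 1) u = 0 := by
    intro i j hij h
    by_cases hj : j + 1 ≤ ℓ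
    · refine lTensor_faithful (gr.X_bact j (j + 1)) (hg j hj) fun p => ?_
      have h1 := adjacent_eq fr gr hu hij p
      rwa [h, map_zero, zero_add] at h1
    · exact comp_eq_zero fr gr (Or.inr (not_le.1 hj)) u
  have first : ∀ i j, i + j = t → comp fr gr i j u = 0 → comp fr gr 0 t u = 0 := by
    intro i
    induction i with
    | zero =>
      intro j hj h
      obtain rfl : j = t := by omega
      exact h
    | succ i ih => exact fun j hj h => ih (j + 1) (by omega) (down i j (by omega) h)
  have all : ∀ i j, i + j = t → comp fr gr i j u = 0 := by
    intro i
    induction i with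
    | zero =>
      intro j hj
      obtain rfl : j = t := by omega
      exact first _ _ hij h0
    | succ i ih => exact fun j hj => up i j (by omega) (ih (j + 1) (by omega))
  refine eq_of_comp_eq fr gr fun i j => ?_
  rw [map_zero]
  by_cases h : i + j = t
  · exact all i j h
  · exact ((mem_S_iff fr gr t u).1 hu).1 i j h

include hf hg in
lemma S_eq_bot {t : ℕ} (ht : min k ℓ < t) : S C D t = ⊥ := by
  refine (LieSubmodule.eq_bot_iff _).2 fun u hu => ?_
  rcases lt_or_ge k t with h | h
  · exact eq_zero_of_comp_eq_zero fr gr hf hg hu (add_zero t) (comp_eq_zero fr gr (Or.inl h) u)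
  · exact eq_zero_of_comp_eq_zero fr gr hf hg hu (zero_add t)
      (comp_eq_zero fr gr (Or.inr (by omega)) u)

include hf hg in
lemma blockImage_ne_bot {t i j : ℕ} (hij : i + j = t) (h : S C D t ≠ ⊥) :
    blockImage C D fr gr t i j ≠ ⊥ := by
  intro h0
  refine h ((LieSubmodule.eq_bot_iff _).2 fun u hu =>
    eq_zero_of_comp_eq_zero fr gr hf hg hu hij ?_)
  have h1 : comp fr gr i j u ∈ blockImage C D fr gr t i j := ⟨u, hu, rfl⟩
  rwa [h0, Submodule.mem_bot] at h1

include hf hg in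
lemma isHighestWeightVector_of_comp {t : ℕ} {u : M ⊗[F] N} (hu : u ∈ S C D t) {i j : ℕ}
    (hij : i + j = t) {μ : F} (h0 : comp fr gr i j u ≠ 0)
    (he : actT (a i) (b j) (eMat F) (comp fr gr i j u) = 0)
    (hh : actT (a i) (b j) (hMat F) (comp fr gr i j u) = μ • comp fr gr i j u) :
    IsHighestWeightVector n μ u := by
  refine ⟨fun h => h0 (by rw [h, map_zero]), ?_, ?_⟩
  · refine eq_zero_of_comp_eq_zero fr gr hf hg (lie_mem_S hu _) hij ?_
    rw [comp_lie, he]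
  · rw [← sub_eq_zero]
    refine eq_zero_of_comp_eq_zero fr gr hf hg
      (sub_mem (lie_mem_S hu _) ((S C D t).smul_mem μ hu)) hij ?_
    rw [map_sub, map_smul, comp_lie, hh, sub_self]

include hf hg in
lemma isLink_of_mem (hn : 1 ≤ n) {t : ℕ} {u : M ⊗[F] N} (hu : u ∈ S C D t) {i j μ : ℕ}
    (hij : i + j + 1 = t) (hi : i + 1 ≤ k) (hj : j + 1 ≤ ℓ)
    (hw : IsHighestWeightVector n (μ : F) u) :
    IsLink (2 * n - 1) (a i) (a (i + 1)) (b j) (b (j + 1)) μ := by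
  have h := (isHighestWeightVector_iff fr gr hw.1).1 hw
  have hne : ∀ i j, i + j = t → comp fr gr i j u ≠ 0 := fun i j hij h0 =>
    hw.1 (eq_zero_of_comp_eq_zero fr gr hf hg hu hij h0)
  exact isLink_of_highestWeight (by omega) (fr.X_bact i (i + 1)) (gr.X_bact j (j + 1)) (hf i hi)
    (hg j hj) (h i (j + 1)).1 (h i (j + 1)).2 (hne _ _ (by omega)) (h (i + 1) j).1
    (h (i + 1) j).2 (hne _ _ (by omega)) (adjacent_eq fr gr hu hij)

include hf hg in
lemma exists_weight {t : ℕ} {u : M ⊗[F] N} (hu : u ∈ S C D t) {μ : F}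
    (hw : IsHighestWeightVector n μ u) : ∃ w : ℕ, μ = w := by
  have h := (isHighestWeightVector_iff fr gr hw.1).1 hw 0 t
  obtain ⟨l, hl, hl', hμ, -⟩ := highestWeight_shape h.1 h.2 fun h0 =>
    hw.1 (eq_zero_of_comp_eq_zero fr gr hf hg hu (zero_add t) h0)
  refine ⟨a 0 + b t - 2 * l, ?_⟩
  rw [hμ, Nat.cast_sub (by omega)]
  push_cast
  rfl

include hf hg in
/-- All highest weight vectors in `S_t`, `t ≥ 1`, have the same weight. -/
lemma weight_unique (hn : 1 ≤ n) {t : ℕ} (ht : 1 ≤ t) {u v : M ⊗[F] N} (hu : u ∈ S C D t)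
    (hv : v ∈ S C D t) {μ ν : F} (hwu : IsHighestWeightVector n μ u)
    (hwv : IsHighestWeightVector n ν v) : μ = ν := by
  obtain ⟨j, rfl⟩ : ∃ j, t = j + 1 := ⟨t - 1, by omega⟩
  obtain ⟨hk, hℓ⟩ : j + 1 ≤ k ∧ j + 1 ≤ ℓ := by
    by_contra h
    have h1 := (LieSubmodule.eq_bot_iff _).1 (S_eq_bot fr gr hf hg (t := j + 1) (by omega)) u hu
    exact hwu.1 h1
  obtain ⟨μ, rfl⟩ := exists_weight fr gr hf hg hu hwu
  obtain ⟨ν, rfl⟩ := exists_weight fr gr hf hg hv hwv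
  have h1 := isLink_of_mem fr gr hf hg hn hu (i := 0) (j := j) (by omega) (by omega) hℓ hwu
  have h2 := isLink_of_mem fr gr hf hg hn hv (i := 0) (j := j) (by omega) (by omega) hℓ hwv
  rw [h1.unique h2 (by omega)]

include hf hg in
lemma exists_isHighestWeightVector {t : ℕ} (h : S C D t ≠ ⊥) :
    ∃ u ∈ S C D t, ∃ μ : F, IsHighestWeightVector n μ u := by
  obtain ⟨d, v, ⟨u, hu, rfl⟩, h0, he, hd⟩ := exists_highestWeight_of_ne_bot
    (blockImage_stable fr gr t 0 t) (blockImage_ne_bot fr gr hf hg (zero_add t) h)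
  exact ⟨u, hu, _, isHighestWeightVector_of_comp fr gr hf hg hu (zero_add t) h0 he hd⟩

include hf hg in
-- The projection to `V(a_0) ⊗ V(b_t)` is injective on `S_t`. There `le_of_stable` applies, because
-- highest weight vectors lift to `S_t` and so have one common weight.
lemma S_isIrreducible (hn : 1 ≤ n) {t : ℕ} (ht : 1 ≤ t) (h : S C D t ≠ ⊥) :
    LieModule.IsIrreducible F (levi F n) (S C D t) := by
  have : Nontrivial (S C D t) := (LieSubmodule.nontrivial_iff_ne_bot F (levi F n) _).2 h
  refine LieModule.IsIrreducible.mk fun K hK => eq_top_iff.2 fun w _ => ?_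
  set U : Submodule F (Bin F (a 0) ⊗[F] Bin F (b t)) :=
    (K : Submodule F (S C D t)).map (comp fr gr 0 t ∘ₗ (S C D t : Submodule F (M ⊗[F] N)).subtype)
    with hU
  have hUW : U ≤ blockImage C D fr gr t 0 t := by
    rintro _ ⟨u, -, rfl⟩
    exact ⟨u, u.2, rfl⟩
  have hU0 : U ≠ ⊥ := by
    obtain ⟨u, hu, hu0⟩ : ∃ u ∈ K, u ≠ 0 := by
      by_contra! hc
      exact hK ((LieSubmodule.eq_bot_iff K).2 hc)
    refine (Submodule.ne_bot_iff _).2 ⟨_, ⟨u, hu, rfl⟩, fun h0 => hu0 (Subtype.ext ?_)⟩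
    exact eq_zero_of_comp_eq_zero fr gr hf hg u.2 (zero_add t) h0
  have hUs : ∀ A, ∀ u ∈ U, actT (a 0) (b t) A u ∈ U := by
    rintro A _ ⟨u, hu, rfl⟩
    exact ⟨_, K.lie_mem (x := ⟨ofSL2 F n A, ⟨A, rfl⟩⟩) hu, comp_lie fr gr A 0 t u⟩
  have hle := le_of_stable hUs (blockImage_stable fr gr t 0 t) hUW hU0 ?_
  · obtain ⟨u, hu, huw⟩ := hle ⟨w, w.2, rfl⟩
    have h1 : (u : M ⊗[F] N) - w = 0 := by
      refine eq_zero_of_comp_eq_zero fr gr hf hg (sub_mem u.2 w.2) (zero_add t) ?_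
      rw [map_sub, ← huw]
      exact sub_self _
    have h2 : u = w := Subtype.ext (sub_eq_zero.1 h1)
    rwa [← h2]
  · rintro d d' _ ⟨u, hu, rfl⟩ _ ⟨v, hv, rfl⟩ hu0 hv0 hue hve hud hvd
    have h1 := weight_unique fr gr hf hg hn ht hu hv
      (isHighestWeightVector_of_comp fr gr hf hg hu (zero_add t) hu0 hue hud)
      (isHighestWeightVector_of_comp fr gr hf hg hv (zero_add t) hv0 hve hvd)
    have h2 : (2 : F) * d = 2 * d' := by linear_combination -h1
    exact_mod_cast mul_left_cancel₀ two_ne_zero h2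

include hf hg in
lemma exists_components {t : ℕ} {μ : F} {v : M ⊗[F] N} (hv : v ∈ S C D t)
    (hw : IsHighestWeightVector n μ v) : ∃ u : ℕ → M ⊗[F] N,
      v = ∑ i ∈ Finset.range (t + 1), u i ∧
        ∀ i ≤ t, u i ∈ tensorBlock (C i) (D (t - i)) ∧ IsHighestWeightVector n μ (u i) := by
  obtain ⟨hk, hℓ⟩ : t ≤ k ∧ t ≤ ℓ := by
    by_contra h
    have h1 := (LieSubmodule.eq_bot_iff _).1 (S_eq_bot fr gr hf hg (t := t) (by omega)) v hv
    exact hw.1 h1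
  refine ⟨fun i => emb fr gr i (t - i) (comp fr gr i (t - i) v), ?_, fun i hi =>
    ⟨(mem_tensorBlock_iff fr gr _ _ _).2 ⟨_, rfl⟩, ?_⟩⟩
  · refine eq_of_comp_eq fr gr fun i j => ?_
    rw [map_sum]
    by_cases hij : i + j = t
    · obtain rfl : j = t - i := by omega
      rw [Finset.sum_eq_single i, comp_emb fr gr (by omega) (by omega)]
      · intro i' _ h
        exact comp_emb_of_ne fr gr (Or.inl h.symm) _
      · intro h
        exact absurd (Finset.mem_range.2 (by omega)) h
    · rw [comp_eq_zero_of_mem fr gr hv hij, Finset.sum_eq_zero]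
      intro i' hi'
      rw [Finset.mem_range] at hi'
      exact comp_emb_of_ne fr gr (by omega) _
  · have h := (isHighestWeightVector_iff fr gr hw.1).1 hw i (t - i)
    refine ⟨fun h0 => hw.1 (eq_zero_of_comp_eq_zero fr gr hf hg hv
      (Nat.add_sub_cancel' hi) ?_), ?_, ?_⟩
    · rw [← comp_emb fr gr (show i ≤ k by omega) (show t - i ≤ ℓ by omega) (comp fr gr i (t - i) v),
        show emb fr gr i (t - i) (comp fr gr i (t - i) v) = 0 from h0, map_zero]
    · rw [← emb_actT, h.1, map_zero]
    · rw [← emb_actT, h.2, map_smul]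

end Invariants

/-! ### The action of the central element and faithfulness -/

section Faithful

variable {F : Type*} [Field F]

lemma eq_zero_of_bact_eq_zero [CharZero F] {m : ℕ} (hm : 1 ≤ m) {A : SL2 F}
    (h : ∀ p, bact m A p = 0) : A = 0 := by
  have hm0 : (m : F) ≠ 0 := Nat.cast_ne_zero.2 (by omega)
  have key : ∀ i ≤ m, ∀ l, bcf m l (A.1 0 1 • bact m (eMat F) (bmono m i) +
      A.1 1 0 • bact m (fMat F) (bmono m i) + A.1 0 0 • bact m (hMat F) (bmono m i)) = 0 := by
    intro i _ l
    rw [← bact_smul, ← bact_smul, ← bact_smul, ← bact_add, ← bact_add, ← sl2_eq A, h, map_zero]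
  -- The three coefficients isolate, in turn, the entries of `A` along `h`, `f` and `e`.
  have h1 := key 0 (by omega) 0
  have h2 := key 0 (by omega) (0 + 1)
  have h3 := key 1 hm 0
  simp only [map_add, map_smul, smul_eq_mul, bcf_bact_e, bcf_bact_h, bcf_bact_f_zero] at h1 h3
  simp only [map_add, map_smul, smul_eq_mul, bcf_bact_e, bcf_bact_h, bcf_bact_f] at h2
  simp [bcf_bmono, hm, hm0] at h1 h2 h3
  rw [sl2_eq A, h1, h2, h3]
  simp

variable {n : ℕ} {M : Type*} [AddCommGroup M] [Module F M]
  [LieRingModule (Gal F n) M] [LieModule F (Gal F n) M]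
  {k : ℕ} {a : ℕ → ℕ} {C : ℕ → LieSubmodule F (levi F n) M}

lemma hcen_ne_zero : hcen F n ≠ 0 := fun h => one_ne_zero (congrArg Heis.cen h)

namespace Frame

variable (fr : Frame k a C)

/-- Between block `i` and block `i + 2` only the intermediate block `i + 1` contributes to the
commutator. -/
lemma X_comm (hn : 1 ≤ n) {i : ℕ} (p q : Bin F (2 * n - 1)) (hi : i + 2 ≤ k)
    (v : Bin F (a (i + 2))) :
    fr.X i (i + 1) p (fr.X (i + 1) (i + 2) q v) - fr.X i (i + 1) q (fr.X (i + 1) (i + 2) p v) =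
      (2 * form _ ((toBin _).symm p) ((toBin _).symm q)) • fr.Z i (i + 2) v := by
  have hodd : Odd (2 * n - 1) := ⟨n - 1, by omega⟩
  have h := fr.H_lie i (i + 2) (hvec F n p) (hvec F n q) v
  have single : ∀ x y, ∑ l ∈ Finset.range (k + 1), fr.H i l x (fr.H l (i + 2) y v) =
      fr.H i (i + 1) x (fr.H (i + 1) (i + 2) y v) := by
    intro x y
    refine Finset.sum_eq_single (i + 1) (fun l _ hl => ?_) fun h => ?_
    · rcases Nat.lt_or_ge i l with h | h
      · rw [fr.H_eq_zero (show i + 2 ≤ l by omega)]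
        simp
      · rw [fr.H_eq_zero h]
        rfl
    · exact absurd (Finset.mem_range.2 (by omega)) h
  rw [single, single, lie_hvec, map_smul] at h
  rw [X_apply, X_apply, X_apply, X_apply, ← h,
    form_swap hodd ((toBin _).symm p) ((toBin _).symm q), sub_neg_eq_add, ← two_mul]
  rfl

variable [CharZero F]

lemma lie_hcen_eq_zero (h : ∀ i j, i + 2 ≤ j → j ≤ k → fr.Z i j = 0) (hn : 1 ≤ n) (v : M) :
    ⁅ofHeis F n (hcen F n), v⁆ = 0 := by
  refine fr.ext_π fun i _ => ?_
  rw [fr.π_lie_heis, map_zero]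
  refine Finset.sum_eq_zero fun j hj => ?_
  change fr.Z i j _ = 0
  by_cases hij : i + 2 ≤ j
  · rw [h i j hij (by rw [Finset.mem_range] at hj; omega)]
    rfl
  · rw [fr.Z_eq_zero hn (by omega)]
    rfl

lemma exists_Z_ne_zero (hn : 1 ≤ n) (hM : LieModule.IsFaithful F (Gal F n) M) :
    ∃ i j, i + 2 ≤ j ∧ j ≤ k ∧ fr.Z i j ≠ 0 := by
  by_contra! h
  have h1 : ofHeis F n (hcen F n) = 0 :=
    LieModule.ext_of_isFaithful (R := F) M fun v => by rw [fr.lie_hcen_eq_zero h hn, zero_lie]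
  have h2 : hcen F n = 0 := congrArg LieAlgebra.SemiDirectSum.left h1
  exact hcen_ne_zero h2

/-- If `x` acts as zero, so do its brackets with `V(m)`. As `X 0 1` is injective on `V(m)`, the
`sl(2)`-part of `x` kills `V(m)` and is zero. Then `X 0 1` and `Z 0 2` detect the two remaining
parts. -/
lemma isFaithful (hn : 1 ≤ n) (hX : fr.X 0 1 ≠ 0) (hZ : fr.Z 0 2 ≠ 0) :
    LieModule.IsFaithful F (Gal F n) M := by
  have inj : ∀ p, fr.X 0 1 p = 0 → p = 0 := by
    intro p hp
    by_contra h0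
    refine hX (LinearMap.ker_eq_top.1 (eq_top_of_stable (W := LinearMap.ker (fr.X 0 1)) ?_
      ((Submodule.ne_bot_iff _).2 ⟨p, hp, h0⟩)))
    intro A q hq
    rw [LinearMap.mem_ker] at hq ⊢
    ext1 r
    have h1 := fr.X_bact 0 1 A q r
    rw [hq, LinearMap.zero_apply, LinearMap.zero_apply, map_zero, add_zero] at h1
    rw [← h1]
    rfl
  have inj' : ∀ x : Heis F n, (∀ v : M, ⁅ofHeis F n x, v⁆ = 0) → x.vec = 0 := by
    intro x hx
    have h1 : toBin _ x.vec = 0 := by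
      refine inj _ ?_
      ext1 q
      have h2 := fr.H_eq_X_add_Z 0 1 x q
      rw [H_apply, hx, map_zero, fr.Z_eq_zero hn le_rfl, LinearMap.zero_apply, smul_zero,
        add_zero] at h2
      exact h2.symm
    exact h1
  refine ⟨(injective_iff_map_eq_zero' _).2 fun x => ⟨fun hx => ?_, fun h => by rw [h, map_zero]⟩⟩
  have hx' : ∀ v : M, ⁅x, v⁆ = 0 := fun v => LinearMap.congr_fun hx v
  have hA : x.right = 0 := by
    refine eq_zero_of_bact_eq_zero (m := 2 * n - 1) (by omega) fun p => ?_
    have h1 := inj' ⁅x, ofHeis F n (hvec F n p)⁆.left fun v => ?_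
    · have h2 : ⁅x, ofHeis F n (hvec F n p)⁆.left.vec =
          (toBin _).symm (bact _ x.right p) := by
        simp
        rfl
      rw [h2] at h1
      exact h1
    · have h3 : ofHeis F n ⁅x, ofHeis F n (hvec F n p)⁆.left = ⁅x, ofHeis F n (hvec F n p)⁆ := by
        conv_rhs => rw [gal_eq ⁅x, ofHeis F n (hvec F n p)⁆]
        simp
      rw [h3, lie_lie, hx', hx', lie_zero, sub_zero]
  have hxy : x = ofHeis F n x.left := by
    conv_lhs => rw [gal_eq x, hA, map_zero, add_zero]
  have hvecz : x.left.vec = 0 := inj' x.left fun v => by rw [← hxy, hx']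
  have hcenz : x.left.cen = 0 := by
    by_contra hc
    refine hZ (LinearMap.ext fun q => ?_)
    have h1 := fr.H_eq_X_add_Z 0 2 x.left q
    rw [H_apply, ← hxy, hx', map_zero, hvecz, map_zero, map_zero, LinearMap.zero_apply,
      zero_add, eq_comm, smul_eq_zero] at h1
    exact h1.resolve_left hc
  have hl : x.left = 0 := Heis.ext hvecz hcenz
  rw [hxy, hl, map_zero]

end Frame

end Faithful

/-! ### Isomorphisms in coordinates -/

section Isomorphism

variable {F : Type*} [Field F] {n : ℕ} {M N : Type*} [AddCommGroup M] [Module F M]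
  [LieRingModule (Gal F n) M] [LieModule F (Gal F n) M] [AddCommGroup N] [Module F N]
  [LieRingModule (Gal F n) N] [LieModule F (Gal F n) N]
  {k ℓ : ℕ} {a b : ℕ → ℕ} {C : ℕ → LieSubmodule F (levi F n) M}
  {D : ℕ → LieSubmodule F (levi F n) N}

/-- Modules whose block matrices differ by rescaling the blocks are isomorphic. -/
lemma Frame.nonempty_equiv (fr : Frame k a C) (gr : Frame k a D) (c : ℕ → F) (hc : ∀ i, c i ≠ 0)
    (h : ∀ i j x p, c i • fr.H i j x p = c j • gr.H i j x p) : Nonempty (M ≃ₗ⁅F, Gal F n⁆ N) := by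
  let φ : M →ₗ[F] N := ∑ i ∈ Finset.range (k + 1), c i • (gr.ι i ∘ₗ fr.π i)
  let ψ : N →ₗ[F] M := ∑ i ∈ Finset.range (k + 1), (c i)⁻¹ • (fr.ι i ∘ₗ gr.π i)
  have hφ : ∀ i ≤ k, ∀ v, gr.π i (φ v) = c i • fr.π i v := by
    intro i hi v
    simp only [φ, LinearMap.sum_apply, map_sum, LinearMap.smul_apply, LinearMap.comp_apply,
      map_smul]
    rw [Finset.sum_eq_single i, gr.π_ι i hi]
    · intro j _ hj
      rw [gr.π_ι_ne i j hj.symm, smul_zero]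
    · intro hi'
      exact absurd (Finset.mem_range.2 (by omega)) hi'
  have hψ : ∀ i ≤ k, ∀ v, fr.π i (ψ v) = (c i)⁻¹ • gr.π i v := by
    intro i hi v
    simp only [ψ, LinearMap.sum_apply, map_sum, LinearMap.smul_apply, LinearMap.comp_apply,
      map_smul]
    rw [Finset.sum_eq_single i, fr.π_ι i hi]
    · intro j _ hj
      rw [fr.π_ι_ne i j hj.symm, smul_zero]
    · intro hi'
      exact absurd (Finset.mem_range.2 (by omega)) hi'
  let e : M ≃ₗ[F] N := LinearEquiv.ofLinearMap φ ψ
    (LinearMap.ext fun v => gr.ext_π fun i hi => by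
      rw [LinearMap.comp_apply, hφ i hi, hψ i hi, smul_smul, mul_inv_cancel₀ (hc i), one_smul]
      rfl)
    (LinearMap.ext fun v => fr.ext_π fun i hi => by
      rw [LinearMap.comp_apply, hψ i hi, hφ i hi, smul_smul, inv_mul_cancel₀ (hc i), one_smul]
      rfl)
  refine ⟨{ e with map_lie' := fun {x v} => ?_ }⟩
  change φ ⁅x, v⁆ = ⁅x, φ v⁆
  refine gr.ext_π fun i hi => ?_
  rw [hφ i hi, gal_eq x, add_lie, add_lie, map_add, map_add, fr.π_lie, gr.π_lie, hφ i hi,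
    smul_add, map_smul, fr.π_lie_heis, gr.π_lie_heis, Finset.smul_sum]
  congr 1
  refine Finset.sum_congr rfl fun j hj => ?_
  rw [hφ j (by rw [Finset.mem_range] at hj; omega), map_smul, h]

variable [CharZero F]

/-- A recursive description of the filtration by initial blocks in terms of the action of `𝔥_n`
alone; therefore module homomorphisms preserve it. -/
lemma Frame.π_eq_zero_iff (fr : Frame k a C) (hf : ∀ i, i + 1 ≤ k → fr.X i (i + 1) ≠ 0)
    (r : ℕ) (v : M) : (∀ j, r + 1 ≤ j → fr.π j v = 0) ↔
      ∀ (x : Heis F n) (j), r ≤ j → fr.π j ⁅ofHeis F n x, v⁆ = 0 := by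
  constructor
  · intro h x j hj
    rw [fr.π_lie_heis]
    refine Finset.sum_eq_zero fun j' _ => ?_
    by_cases hj' : j' ≤ j
    · rw [fr.H_eq_zero hj']
      rfl
    · rw [h j' (by omega), map_zero]
  · intro h
    -- Descending induction on `j` from `k + 1`: once the higher components are zero, only the
    -- superdiagonal block reaches block `j - 1`.
    have key : ∀ d j, r + 1 ≤ j → k + 1 ≤ j + d → fr.π j v = 0 := by
      intro d
      induction d with
      | zero => exact fun j _ hj => by rw [fr.π_zero j (by omega), LinearMap.zero_apply]
      | succ d ih =>
        intro j hj hd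
        by_cases hjk : j ≤ k
        · obtain ⟨j, rfl⟩ : ∃ i, j = i + 1 := ⟨j - 1, by omega⟩
          refine bilinear_faithful (fr.X_bact j (j + 1)) (hf j hjk) fun p => ?_
          have h1 := h (hvec F n p) j (by omega)
          rw [fr.π_lie_heis, Finset.sum_eq_single (j + 1)] at h1
          · exact h1
          · intro i _ hi
            rcases Nat.lt_or_ge j i with hji | hji
            · rw [ih i (by omega) (by omega), map_zero]
            · rw [fr.H_eq_zero hji]
              rfl
          · intro hi
            exact absurd (Finset.mem_range.2 (by omega)) hi
        · rw [fr.π_zero j (by omega), LinearMap.zero_apply]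
    exact fun j hj => key (k + 1) j hj (by omega)

lemma Frame.π_map_eq_zero (fr : Frame k a C) (hf : ∀ i, i + 1 ≤ k → fr.X i (i + 1) ≠ 0)
    (gr : Frame ℓ b D) (hg : ∀ i, i + 1 ≤ ℓ → gr.X i (i + 1) ≠ 0) (φ : M →ₗ⁅F, Gal F n⁆ N)
    (r : ℕ) : ∀ v : M, (∀ j, r ≤ j → fr.π j v = 0) → ∀ j, r ≤ j → gr.π j (φ v) = 0 := by
  induction r with
  | zero =>
    intro v hv j _
    have h0 : v = 0 := fr.ext_π fun i _ => by rw [hv i (Nat.zero_le _), map_zero]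
    rw [h0, map_zero, map_zero]
  | succ r ih =>
    intro v hv
    refine (gr.π_eq_zero_iff hg r _).2 fun x => ?_
    rw [← LieModuleHom.map_lie]
    exact ih _ ((fr.π_eq_zero_iff hf r v).1 hv x)

/-- The isomorphism preserves the filtrations and induces a map between the `r`-th blocks. If that
were zero, block `r` would be moved into earlier blocks, and the inverse could not bring it back. -/
lemma Frame.degree_eq (fr : Frame k a C) (hf : ∀ i, i + 1 ≤ k → fr.X i (i + 1) ≠ 0)
    (gr : Frame ℓ b D) (hg : ∀ i, i + 1 ≤ ℓ → gr.X i (i + 1) ≠ 0) (e : M ≃ₗ⁅F, Gal F n⁆ N)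
    {r : ℕ} (hr : r ≤ k) : a r = b r := by
  let T : Bin F (a r) →ₗ[F] Bin F (b r) := gr.π r ∘ₗ (e.toLinearEquiv : M →ₗ[F] N) ∘ₗ fr.ι r
  refine equivariant_degree_eq (T := T) (fun A p => ?_) fun hT => ?_
  · change gr.π r (e (fr.ι r _)) = bact _ A (gr.π r (e (fr.ι r p)))
    rw [fr.ι_bact, ← gr.π_lie]
    exact congrArg (gr.π r) (e.toLieModuleHom.map_lie _ _)
  · set v := fr.ι r (bmono (a r) 0) with hv
    have h1 : ∀ j, r ≤ j → gr.π j (e v) = 0 := by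
      intro j hj
      rcases hj.eq_or_lt with rfl | hj
      · exact LinearMap.congr_fun hT _
      · exact fr.π_map_eq_zero hf gr hg e.toLieModuleHom (r + 1) v
          (fun i hi => fr.π_ι_ne i r (by omega) _) j hj
    have h2 := gr.π_map_eq_zero hg fr hf e.symm.toLieModuleHom r _ h1 r le_rfl
    have h3 : e.symm.toLieModuleHom (e v) = v := e.symm_apply_apply v
    rw [h3, hv, fr.π_ι r hr] at h2
    exact bmono_zero_ne_zero _ h2

end Isomorphism

/-! ### Modules with equal initial blocks -/

section Comparison

variable {F : Type*} [Field F] [CharZero F] {n : ℕ} {M N : Type*} [AddCommGroup M] [Module F M]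
  [LieRingModule (Gal F n) M] [LieModule F (Gal F n) M] [AddCommGroup N] [Module F N]
  [LieRingModule (Gal F n) N] [LieModule F (Gal F n) N]
  {k ℓ : ℕ} {a b : ℕ → ℕ} {C : ℕ → LieSubmodule F (levi F n) M}
  {D : ℕ → LieSubmodule F (levi F n) N}

lemma equivariant_surjective {d e : ℕ} {T : Bin F d →ₗ[F] Bin F e}
    (hT : ∀ A p, T (bact d A p) = bact e A (T p)) (h0 : T ≠ 0) : Function.Surjective T := by
  refine LinearMap.range_eq_top.1 (eq_top_of_stable ?_ fun h => h0 (LinearMap.range_eq_bot.1 h))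
  rintro A _ ⟨p, rfl⟩
  exact ⟨_, hT A p⟩

/-- If the central element acts non-trivially from block `2` to block `0`, then there is no block
`3`: the traces of `X₀₁ X₁₂` and `X₁₂ X₂₃`, normalized by the action of the central element, would
contradict each other. -/
lemma Frame.length_le_two (fr : Frame k a C) (hn : 1 ≤ n)
    (hf : ∀ i, i + 1 ≤ k → fr.X i (i + 1) ≠ 0) (hZ : fr.Z 0 2 ≠ 0) : k ≤ 2 := by
  by_contra! hk
  -- The block `(0, 3)` of the relation that `z` commutes with `V(m)`.
  have comm : ∀ p v, fr.Z 0 2 (fr.X 2 3 p v) = fr.X 0 1 p (fr.Z 1 3 v) := by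
    intro p v
    have h := fr.H_lie 0 3 (hcen F n) (hvec F n p) v
    have h0 : ⁅hcen F n, hvec F n p⁆ = 0 := by
      ext1 <;> simp [hcen, hvec]
    rw [h0, map_zero, LinearMap.zero_apply, eq_comm, sub_eq_zero, Finset.sum_eq_single 2,
      Finset.sum_eq_single 1] at h
    · exact h
    · intro i _ hi
      rcases Nat.eq_zero_or_pos i with rfl | hi0
      · rw [fr.H_eq_zero le_rfl]
        rfl
      · change fr.H 0 i _ (fr.Z i 3 v) = 0
        rw [fr.Z_eq_zero hn (by omega)]
        simp
    · intro hi
      exact absurd (Finset.mem_range.2 (by omega)) hi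
    · intro i _ hi
      rcases Nat.lt_or_ge i 2 with hi2 | hi2
      · change fr.Z 0 i _ = 0
        rw [fr.Z_eq_zero hn (by omega)]
        rfl
      · rw [fr.H_eq_zero (show 3 ≤ i by omega)]
        simp
    · intro hi
      exact absurd (Finset.mem_range.2 (by omega)) hi
  have surj02 := equivariant_surjective (fr.Z_bact 0 2) hZ
  have inj02 : Function.Injective (fr.Z 0 2) :=
    (injective_iff_map_eq_zero _).2 fun p hp => equivariant_injective (fr.Z_bact 0 2) hZ hp
  have hZ' : fr.Z 1 3 ≠ 0 := by
    intro h0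
    refine hf 2 hk (LinearMap.ext₂ fun p v => ?_)
    refine inj02 ?_
    rw [comm, h0]
    simp
  have surj13 := equivariant_surjective (fr.Z_bact 1 3) hZ'
  let J : Bin F (a 2) ≃ₗ[F] Bin F (a 0) := LinearEquiv.ofBijective (fr.Z 0 2) ⟨inj02, surj02⟩
  obtain ⟨p₀, q₀, hω⟩ := exists_form_ne_zero (F := F) (2 * n - 1)
  set p : Bin F (2 * n - 1) := toBin _ p₀ with hp
  set q : Bin F (2 * n - 1) := toBin _ q₀ with hq
  set ω : F := 2 * form _ p₀ q₀ with hωdef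
  have hω0 : ω ≠ 0 := mul_ne_zero two_ne_zero hω
  -- `P x y = X₀₁(x) X₁₂(y) J⁻¹` and `Q x y = X₁₂(x) J⁻¹ X₀₁(y)` satisfy `tr (P x y) = tr (Q y x)`.
  -- Both have antisymmetrization `ω` times the identity, so taking traces gives `ω (dim V(a_0) +
  -- dim V(a_1)) = 0`.
  let P : Bin F (2 * n - 1) → Bin F (2 * n - 1) → Bin F (a 0) →ₗ[F] Bin F (a 0) := fun x y =>
    fr.X 0 1 x ∘ₗ (fr.X 1 2 y ∘ₗ (J.symm : Bin F (a 0) →ₗ[F] Bin F (a 2)))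
  let Q : Bin F (2 * n - 1) → Bin F (2 * n - 1) → Bin F (a 1) →ₗ[F] Bin F (a 1) := fun x y =>
    (fr.X 1 2 x ∘ₗ (J.symm : Bin F (a 0) →ₗ[F] Bin F (a 2))) ∘ₗ fr.X 0 1 y
  have hP : P p q = P q p + ω • LinearMap.id := by
    ext1 v
    obtain ⟨w, rfl⟩ := surj02 v
    have h1 : J.symm (fr.Z 0 2 w) = w := J.symm_apply_apply w
    change fr.X 0 1 p (fr.X 1 2 q (J.symm (fr.Z 0 2 w))) =
      fr.X 0 1 q (fr.X 1 2 p (J.symm (fr.Z 0 2 w))) + ω • fr.Z 0 2 w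
    rw [h1]
    have h2 := fr.X_comm hn (i := 0) p q (by omega) w
    rw [sub_eq_iff_eq_add'] at h2
    exact h2
  have hQ : Q p q = Q q p + ω • LinearMap.id := by
    ext1 v
    obtain ⟨w, rfl⟩ := surj13 v
    have h1 : ∀ x, J.symm (fr.X 0 1 x (fr.Z 1 3 w)) = fr.X 2 3 x w := by
      intro x
      rw [← comm]
      exact J.symm_apply_apply _
    change fr.X 1 2 p (J.symm (fr.X 0 1 q (fr.Z 1 3 w))) =
      fr.X 1 2 q (J.symm (fr.X 0 1 p (fr.Z 1 3 w))) + ω • fr.Z 1 3 w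
    rw [h1, h1]
    have h2 := fr.X_comm hn (i := 1) p q (by omega) w
    rw [sub_eq_iff_eq_add'] at h2
    exact h2
  have htr : ∀ x y, LinearMap.trace F _ (P x y) = LinearMap.trace F _ (Q y x) := fun x y =>
    LinearMap.trace_comp_comm' _ _
  have h1 := congrArg (LinearMap.trace F _) hP
  have h2 := congrArg (LinearMap.trace F _) hQ
  rw [map_add, map_smul, LinearMap.trace_id, htr, htr, h2, map_add, map_smul,
    LinearMap.trace_id] at h1
  have h3 : ω * ((Module.finrank F (Bin F (a 1)) + Module.finrank F (Bin F (a 0)) : ℕ) : F) =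
      0 := by
    simp only [smul_eq_mul] at h1
    push_cast
    linear_combination -h1
  have h4 : Module.finrank F (Bin F (a 1)) + Module.finrank F (Bin F (a 0)) = 0 := by
    exact_mod_cast (mul_eq_zero.1 h3).resolve_left hω0
  have : Nontrivial (Bin F (a 0)) := ⟨⟨bmono _ 0, 0, bmono_zero_ne_zero _⟩⟩
  have h5 := Module.finrank_pos (R := F) (M := Bin F (a 0))
  omega

lemma Frame.eq_of_Z_ne_zero (fr : Frame k a C) (hZ : fr.Z 0 2 ≠ 0) : a 2 = a 0 :=
  equivariant_degree_eq (fr.Z_bact 0 2) hZ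

lemma Frame.exists_X_eq_smul (fr : Frame k a C) (gr : Frame ℓ a D) {i j : ℕ} (h : fr.X i j ≠ 0)
    (h' : gr.X i j ≠ 0) : ∃ c : F, c ≠ 0 ∧ gr.X i j = c • fr.X i j := by
  obtain ⟨c, hc⟩ := bilinear_unique (fr.X_bact i j) (gr.X_bact i j) h
  refine ⟨c, fun h0 => h' ?_, hc⟩
  rw [hc, h0, zero_smul]

/-- The block `Z 0 2` is a commutator, bilinear in the two superdiagonal blocks. -/
lemma Frame.Z_eq_smul (fr : Frame k a C) (gr : Frame ℓ a D) (hn : 1 ≤ n) (hk : 2 ≤ k)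
    (hℓ : 2 ≤ ℓ) {s r : F} (h₀ : gr.X 0 1 = s • fr.X 0 1) (h₁ : gr.X 1 2 = r • fr.X 1 2) :
    gr.Z 0 2 = (s * r) • fr.Z 0 2 := by
  obtain ⟨p, q, hω⟩ := exists_form_ne_zero (F := F) (2 * n - 1)
  have hω0 : (2 * form _ p q : F) ≠ 0 := mul_ne_zero two_ne_zero hω
  ext1 v
  have h1 := fr.X_comm hn (i := 0) (toBin _ p) (toBin _ q) hk v
  have h2 := gr.X_comm hn (i := 0) (toBin _ p) (toBin _ q) hℓ v
  simp only [LinearEquiv.symm_apply_apply] at h1 h2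
  rw [h₀, h₁] at h2
  simp only [LinearMap.smul_apply, map_smul, smul_smul] at h2
  rw [← smul_sub, h1, smul_comm] at h2
  rw [LinearMap.smul_apply, mul_comm]
  exact (smul_right_injective _ hω0 h2).symm

/-- Uniserial modules of length three with the same blocks on which the central element acts
non-trivially are isomorphic. -/
lemma Frame.nonempty_equiv_of_eq (fr : Frame 2 a C) (gr : Frame 2 a D) (hn : 1 ≤ n)
    (hf : ∀ i, i + 1 ≤ 2 → fr.X i (i + 1) ≠ 0) (hg : ∀ i, i + 1 ≤ 2 → gr.X i (i + 1) ≠ 0)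
    (hZ : fr.Z 0 2 ≠ 0) : Nonempty (M ≃ₗ⁅F, Gal F n⁆ N) := by
  obtain ⟨s, hs, h₀⟩ := fr.exists_X_eq_smul gr (hf 0 (by omega)) (hg 0 (by omega))
  obtain ⟨r, hr, h₁⟩ := fr.exists_X_eq_smul gr (hf 1 (by omega)) (hg 1 (by omega))
  have hz := fr.Z_eq_smul gr hn le_rfl le_rfl h₀ h₁
  have hpar : (a 0 + a 2) % 2 = 0 := by
    rw [fr.eq_of_Z_ne_zero hZ]
    omega
  -- The ratio of consecutive factors is the scalar of the superdiagonal block between them; the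
  -- block `(0, 2)` then matches because `Z` scales by `s * r` and `X 0 2` is zero by parity.
  refine fr.nonempty_equiv gr (fun i => match i with | 0 => s * r | 1 => r | _ + 2 => 1) ?_ ?_
  · rintro (_ | _ | i)
    · exact mul_ne_zero hs hr
    · exact hr
    · exact one_ne_zero
  · intro i j x p
    by_cases hij : j ≤ i
    · rw [fr.H_eq_zero hij, gr.H_eq_zero hij]
      simp
    by_cases hj : 2 < j
    · rw [fr.H_eq_zero_of_lt hj, gr.H_eq_zero_of_lt hj]
      simp
    rw [fr.H_eq_X_add_Z, gr.H_eq_X_add_Z]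
    obtain ⟨rfl, rfl⟩ | ⟨rfl, rfl⟩ | ⟨rfl, rfl⟩ : (i = 0 ∧ j = 1) ∨ (i = 1 ∧ j = 2) ∨
      (i = 0 ∧ j = 2) := by omega
    · rw [fr.Z_eq_zero hn le_rfl, gr.Z_eq_zero hn le_rfl, h₀]
      simp [smul_smul, mul_comm]
    · rw [fr.Z_eq_zero hn le_rfl, gr.Z_eq_zero hn le_rfl, h₁]
      simp
    · rw [fr.X_eq_zero_of_parity hn hpar, gr.X_eq_zero_of_parity hn hpar, hz]
      simp [smul_smul, mul_comm, mul_left_comm]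

end Comparison

/-! ### Invariants in `V(a) ⊗ V(a)` and the space `S_2` -/

section Second

variable {F : Type*} [Field F]

lemma actT_add {a b : ℕ} (A B : SL2 F) (u : Bin F a ⊗[F] Bin F b) :
    actT a b (A + B) u = actT a b A u + actT a b B u := by
  induction u using TensorProduct.induction_on with
  | zero => simp
  | tmul p q =>
    simp only [actT_tmul, bact_add, TensorProduct.add_tmul, TensorProduct.tmul_add]
    abel
  | add u v hu hv =>
    simp only [map_add, hu, hv]
    abel

variable [CharZero F]

lemma actT_eq_zero_of_highestWeight_zero {a b : ℕ} {u : Bin F a ⊗[F] Bin F b}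
    (he : actT a b (eMat F) u = 0) (hh : actT a b (hMat F) u = 0) (A : SL2 F) :
    actT a b A u = 0 := by
  have hf : actT a b (fMat F) u = 0 := by
    by_contra h0
    have h1 : actT a b (hMat F) (actT a b (fMat F) u) = (-2 : F) • actT a b (fMat F) u := by
      have h := actT_lie (hMat F) (fMat F) u
      rw [lie_h_f, actT_smul, hh, map_zero, sub_zero] at h
      exact h.symm
    have h2 : actT a b (eMat F) (actT a b (fMat F) u) = 0 := by
      rw [actT_e_f, he, hh, map_zero, add_zero]
    obtain ⟨l, hl, hl', h3, -⟩ := highestWeight_shape h2 h1 h0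
    have h4 : ((2 * l : ℕ) : F) = (a + b + 2 : ℕ) := by
      push_cast
      linear_combination h3
    have h5 : 2 * l = a + b + 2 := by exact_mod_cast h4
    omega
  rw [sl2_eq A, actT_add, actT_add, actT_smul, actT_smul, actT_smul, he, hf, hh]
  simp

/-- The witness is the expansion of the `a`-th power of the determinant `X₀ ⊗ X₁ - X₁ ⊗ X₀`. -/
lemma exists_invariant {a b : ℕ} (h : a = b) :
    ∃ w : Bin F a ⊗[F] Bin F b, w ≠ 0 ∧ ∀ A, actT a b A w = 0 := by
  subst h
  set w : Bin F a ⊗[F] Bin F a := ∑ i ∈ Finset.range (a + 1),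
    ((-1) ^ i * (a.choose i : F)) • (bmono a i ⊗ₜ[F] bmono a (a - i)) with hw
  have hcf : ∀ i j, cf₂ a a i j w = if i + j = a then (-1) ^ i * (a.choose i : F) else 0 := by
    intro i j
    rw [hw, map_sum]
    simp only [map_smul, cf₂_tmul, smul_eq_mul]
    split_ifs with h
    · rw [Finset.sum_eq_single i]
      · rw [show a - i = j by omega, bcf_bmono (by omega), bcf_bmono (by omega)]
        simp
      · intro i' hi _
        rw [Finset.mem_range] at hi
        rw [bcf_bmono (by omega), if_neg (by omega), zero_mul, mul_zero]
      · intro hi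
        exact absurd (Finset.mem_range.2 (by omega)) hi
    · refine Finset.sum_eq_zero fun i' hi' => ?_
      rw [Finset.mem_range] at hi'
      by_cases h1 : i = i'
      · rw [bcf_bmono (i := a - i') (by omega), if_neg (by omega), mul_zero, mul_zero]
      · rw [bcf_bmono (by omega), if_neg (by omega), zero_mul, mul_zero]
  refine ⟨w, fun h0 => ?_, actT_eq_zero_of_highestWeight_zero ?_ ?_⟩
  · have h1 := hcf 0 a
    rw [h0, map_zero] at h1
    simp at h1
  · refine tensor_ext fun i j => ?_
    rw [actT_apply, map_add, cf₂_actL_e, cf₂_actR_e, hcf, hcf, map_zero]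
    by_cases h : i + j + 1 = a
    · rw [if_pos (by omega), if_pos (by omega)]
      have h1 := Nat.choose_succ_right_eq a i
      have h2 : a - i = j + 1 := by omega
      rw [h2] at h1
      have h3 : (a.choose (i + 1) : F) * (i + 1) = a.choose i * (j + 1) := by exact_mod_cast h1
      rw [pow_succ]
      linear_combination (-(-1) ^ i) * h3
    · rw [if_neg (by omega), if_neg (by omega)]
      simp
  · refine tensor_ext fun i j => ?_
    rw [actT_apply, map_add, cf₂_actL_h, cf₂_actR_h, hcf, map_zero]
    split_ifs with h
    · have h1 : (a : F) = i + j := by exact_mod_cast h.symm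
      rw [h1]
      ring
    · simp

/-- An equivariant map is determined by the image of `X₀^m`, which satisfies the equations of a
highest weight vector of weight `m`; those are unique up to a scalar. -/
lemma equivariant_proportional {m a b : ℕ} {P Q : Bin F m →ₗ[F] Bin F a ⊗[F] Bin F b}
    (hP : ∀ A p, actT a b A (P p) = P (bact m A p)) (hQ : ∀ A p, actT a b A (Q p) = Q (bact m A p))
    (h0 : Q ≠ 0) : ∃ c : F, ∀ p, P p = c • Q p := by
  have top : ∀ {R : Bin F m →ₗ[F] Bin F a ⊗[F] Bin F b},
      (∀ A p, actT a b A (R p) = R (bact m A p)) → R (bmono m 0) = 0 → R = 0 := by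
    intro R hR h
    refine LinearMap.ker_eq_top.1 (eq_top_of_f_stable (fun p hp => ?_) h)
    rw [LinearMap.mem_ker] at hp ⊢
    rw [← hR, hp, map_zero]
  have hw : ∀ {R : Bin F m →ₗ[F] Bin F a ⊗[F] Bin F b},
      (∀ A p, actT a b A (R p) = R (bact m A p)) → actT a b (eMat F) (R (bmono m 0)) = 0 ∧
        actT a b (hMat F) (R (bmono m 0)) = (m : F) • R (bmono m 0) := by
    intro R hR
    rw [hR, hR, bact_e_bmono_zero, bact_h_bmono (Nat.zero_le _), map_zero, map_smul]
    simp
  obtain ⟨c, hc⟩ := highestWeight_unique (hw hQ).1 (hw hQ).2 (fun h => h0 (top hQ h)) (hw hP).1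
    (hw hP).2
  refine ⟨c, fun p => ?_⟩
  have h1 : P + (-c) • Q = 0 := by
    refine top (fun A p => ?_) ?_
    · simp only [LinearMap.add_apply, LinearMap.smul_apply, map_add, map_smul, hP, hQ]
    · rw [LinearMap.add_apply, LinearMap.smul_apply, hc, ← add_smul, add_neg_cancel, zero_smul]
  have h2 := LinearMap.congr_fun h1 p
  rw [LinearMap.add_apply, LinearMap.smul_apply, LinearMap.zero_apply] at h2
  rw [eq_neg_of_add_eq_zero_left h2, neg_smul, neg_neg]

variable {n : ℕ} {M N : Type*} [AddCommGroup M] [Module F M]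
  [LieRingModule (Gal F n) M] [LieModule F (Gal F n) M] [AddCommGroup N] [Module F N]
  [LieRingModule (Gal F n) N] [LieModule F (Gal F n) N]
  {k ℓ : ℕ} {a b : ℕ → ℕ} {C : ℕ → LieSubmodule F (levi F n) M}
  {D : ℕ → LieSubmodule F (levi F n) N} (fr : Frame k a C) (gr : Frame ℓ b D)

/-- The map `p ↦ (f p ⊗ 1) w`. -/
def rMap {m a b c : ℕ} (f : Bin F m →ₗ[F] Bin F b →ₗ[F] Bin F c) (w : Bin F b ⊗[F] Bin F a) :
    Bin F m →ₗ[F] Bin F c ⊗[F] Bin F a :=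
  (LinearMap.applyₗ w ∘ₗ LinearMap.rTensorHom (R := F) (M := Bin F a)) ∘ₗ f

/-- The map `p ↦ (1 ⊗ f p) w`. -/
def lMap {m a b c : ℕ} (f : Bin F m →ₗ[F] Bin F b →ₗ[F] Bin F c) (w : Bin F a ⊗[F] Bin F b) :
    Bin F m →ₗ[F] Bin F a ⊗[F] Bin F c :=
  (LinearMap.applyₗ w ∘ₗ LinearMap.lTensorHom (R := F) (M := Bin F a)) ∘ₗ f

lemma proportional_on_invariants {m a₀ a₁ b₀ b₁ : ℕ}
    {f : Bin F m →ₗ[F] Bin F a₁ →ₗ[F] Bin F a₀} {g : Bin F m →ₗ[F] Bin F b₁ →ₗ[F] Bin F b₀}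
    (hf : ∀ A p q, bact a₀ A (f p q) = f (bact m A p) q + f p (bact a₁ A q))
    (hg : ∀ A p q, bact b₀ A (g p q) = g (bact m A p) q + g p (bact b₁ A q))
    {w : Bin F a₁ ⊗[F] Bin F b₀} {u : Bin F a₀ ⊗[F] Bin F b₁}
    (hw : ∀ A, actT a₁ b₀ A w = 0) (hu : ∀ A, actT a₀ b₁ A u = 0) :
    (f ≠ 0 → w ≠ 0 → ∃ c : F, ∀ p, (g p).lTensor (Bin F a₀) u = c • (f p).rTensor (Bin F b₀) w) ∧
    (g ≠ 0 → u ≠ 0 → ∃ c : F, ∀ p,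
      (f p).rTensor (Bin F b₀) w = c • (g p).lTensor (Bin F a₀) u) := by
  have h1 : ∀ A p, actT a₀ b₀ A (rMap f w p) = rMap f w (bact m A p) := by
    intro A p
    have h := actT_rTensor hf A p w
    rw [hw, map_zero, add_zero] at h
    exact h
  have h2 : ∀ A p, actT a₀ b₀ A (lMap g u p) = lMap g u (bact m A p) := by
    intro A p
    have h := actT_lTensor hg A p u
    rw [hu, map_zero, add_zero] at h
    exact h
  refine ⟨fun hf0 hw0 => equivariant_proportional h2 h1 fun h => hw0 ?_,
    fun hg0 hu0 => equivariant_proportional h1 h2 fun h => hu0 ?_⟩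
  · exact rTensor_faithful hf hf0 fun p => LinearMap.congr_fun h p
  · exact lTensor_faithful hg hg0 fun p => LinearMap.congr_fun h p

/-- Keep the invariant in the middle block and rescale those in the two outer blocks so that the
equations for both adjacent pairs hold. -/
lemma S_two_ne_bot (hn : 1 ≤ n) (hk : 2 ≤ k) (hℓ : 2 ≤ ℓ) (h02 : a 0 = b 2) (h11 : a 1 = b 1)
    (h20 : a 2 = b 0) (ha : a 2 = a 0) (hf : fr.X 1 2 ≠ 0) (hg : gr.X 1 2 ≠ 0) :
    S C D 2 ≠ ⊥ := by
  obtain ⟨w₀, hw₀, hi₀⟩ := exists_invariant (F := F) h02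
  obtain ⟨w₁, hw₁, hi₁⟩ := exists_invariant (F := F) h11
  obtain ⟨w₂, hw₂, hi₂⟩ := exists_invariant (F := F) h20
  obtain ⟨c, hc⟩ := (proportional_on_invariants (fr.X_bact 0 1) (gr.X_bact 1 2) hi₁ hi₀).2 hg hw₀
  obtain ⟨d, hd⟩ := (proportional_on_invariants (fr.X_bact 1 2) (gr.X_bact 0 1) hi₂ hi₁).1 hf hw₂
  set u := emb fr gr 0 2 ((-c) • w₀) + emb fr gr 1 1 w₁ + emb fr gr 2 0 ((-d) • w₂) with hu
  have u0 : comp fr gr 0 2 u = (-c) • w₀ := by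
    rw [hu, map_add, map_add, comp_emb fr gr (by omega) (by omega),
      comp_emb_of_ne fr gr (by omega), comp_emb_of_ne fr gr (by omega), add_zero, add_zero]
  have u1 : comp fr gr 1 1 u = w₁ := by
    rw [hu, map_add, map_add, comp_emb fr gr (by omega) (by omega),
      comp_emb_of_ne fr gr (by omega), comp_emb_of_ne fr gr (by omega), add_zero, zero_add]
  have u2 : comp fr gr 2 0 u = (-d) • w₂ := by
    rw [hu, map_add, map_add, comp_emb fr gr (by omega) (by omega),
      comp_emb_of_ne fr gr (by omega), comp_emb_of_ne fr gr (by omega), zero_add, zero_add]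
  have un : ∀ i j, i + j ≠ 2 → comp fr gr i j u = 0 := by
    intro i j hij
    rw [hu, map_add, map_add, comp_emb_of_ne fr gr (by omega),
      comp_emb_of_ne fr gr (by omega), comp_emb_of_ne fr gr (by omega), add_zero, add_zero]
  have hvec0 : ∀ p, ⁅ofHeis F n (hvec F n p), u⁆ = 0 := by
    intro p
    refine eq_of_comp_eq fr gr fun i j => ?_
    rw [map_zero]
    by_cases hij : i + j < 2
    · obtain ⟨rfl, rfl⟩ | ⟨rfl, rfl⟩ | ⟨rfl, rfl⟩ : (i = 0 ∧ j = 0) ∨ (i = 0 ∧ j = 1) ∨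
        (i = 1 ∧ j = 0) := by omega
      · rw [comp_lie_heis_of_mem fr gr un _ (i' := 2) (j' := 2) rfl rfl]
        change (fr.X 0 2 p).rTensor _ _ + (gr.X 0 2 p).lTensor _ _ = 0
        -- In block `(0, 0)` only `X 0 2` could contribute, and it vanishes because `a 0 = a 2` and
        -- `b 0 = b 2` while `m` is odd.
        rw [fr.X_eq_zero_of_parity hn (by omega), gr.X_eq_zero_of_parity hn (by omega)]
        simp
      · rw [comp_lie_heis_of_mem fr gr un _ (i' := 1) (j' := 2) rfl rfl, u1, u0, map_smul]
        have h := hc p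
        change (fr.X 0 1 p).rTensor _ _ + (-c) • (gr.X 1 2 p).lTensor _ _ = 0
        rw [h, neg_smul, add_neg_cancel]
      · rw [comp_lie_heis_of_mem fr gr un _ (i' := 2) (j' := 1) rfl rfl, u1, u2, map_smul]
        have h := hd p
        change (-d) • (fr.X 1 2 p).rTensor _ _ + (gr.X 0 1 p).lTensor _ _ = 0
        rw [h, neg_smul, neg_add_cancel]
    · rw [comp_lie_heis, Finset.sum_eq_zero, Finset.sum_eq_zero, add_zero]
      · intro j' _
        by_cases hj : j' ≤ j
        · rw [gr.H_eq_zero hj]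
          simp
        · rw [un i j' (by omega), map_zero]
      · intro i' _
        by_cases hi : i' ≤ i
        · rw [fr.H_eq_zero hi]
          simp
        · rw [un i' j (by omega), map_zero]
  have hmem : u ∈ S C D 2 := by
    refine ⟨(mem_iSup_tensorBlock_iff fr gr 2 u).2 un, fun x => ?_⟩
    -- Being a commutator of elements of `V(m)`, the central element kills `u` as well.
    obtain ⟨p, q, e, he⟩ := exists_hcen_eq (F := F) hn
    rw [heis_eq x, map_add, add_lie, hvec0, map_smul, he, map_smul, LieHom.map_lie, smul_lie,
      smul_lie, lie_lie, hvec0, hvec0]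
    simp
  intro hbot
  rw [hbot] at hmem
  have h0 : u = 0 := hmem
  rw [h0, map_zero] at u1
  exact hw₁ u1.symm

end Second

/-! ### Coordinates on `E(a, b)` and the space `S_1` -/

section First

variable {F : Type*} [Field F] {n : ℕ}

lemma act_zero (a : ℕ) (p : V F a) : act a (0 : SL2 F) p = 0 := by
  have h := act_smul a (0 : F) 0 p
  rwa [zero_smul, zero_smul] at h

variable (F n) in
/-- The standard coordinates on `E(a 0, a 1)`. -/
def E.coordinates (a : ℕ → ℕ) : Coordinates 1 a
    (E.block n (a 0) (a 1) : ℕ → LieSubmodule F (levi F n) (E F (a 0) (a 1))) where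
  ι
    | 0 =>
      { toFun := fun p => (((toBin (a 0)).symm p, 0) : V F (a 0) × V F (a 1))
        map_add' := fun p q => Prod.ext rfl (add_zero (0 : V F (a 1))).symm
        map_smul' := fun c p => Prod.ext rfl (smul_zero (A := V F (a 1)) c).symm }
    | 1 =>
      { toFun := fun p => ((0, (toBin (a 1)).symm p) : V F (a 0) × V F (a 1))
        map_add' := fun p q => Prod.ext (add_zero (0 : V F (a 0))).symm rfl
        map_smul' := fun c p => Prod.ext (smul_zero (A := V F (a 0)) c).symm rfl }
    | _ + 2 => 0
  π
    | 0 =>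
      { toFun := fun v => toBin (a 0) v.1
        map_add' := fun _ _ => rfl
        map_smul' := fun _ _ => rfl }
    | 1 =>
      { toFun := fun v => toBin (a 1) v.2
        map_add' := fun _ _ => rfl
        map_smul' := fun _ _ => rfl }
    | _ + 2 => 0
  ι_bact := by
    rintro (_ | _ | i) A p
    · refine Prod.ext ?_ ?_
      · change act (a 0) A ((toBin (a 0)).symm p) =
          act (a 0) A ((toBin (a 0)).symm p) + pairing _ (a 1) (a 0) 0 0
        rw [map_zero, add_zero]
      · exact (map_zero (act (a 1) A)).symm
    · refine Prod.ext ?_ ?_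
      · change 0 = act (a 0) A 0 + pairing _ (a 1) (a 0) 0 ((toBin (a 1)).symm p)
        rw [map_zero, map_zero, LinearMap.zero_apply, add_zero]
      · rfl
    · exact (lie_zero _).symm
  π_lie := by
    rintro (_ | _ | i) A v
    · change act (a 0) A v.1 + pairing _ (a 1) (a 0) 0 v.2 = act (a 0) A v.1
      rw [map_zero, LinearMap.zero_apply, add_zero]
    · rfl
    · exact (map_zero (bact (a (i + 2)) A)).symm
  π_ι := by
    rintro (_ | _ | i) hi p
    · rfl
    · rfl
    · omega
  π_ι_ne := by
    rintro (_ | _ | i) (_ | _ | j) hij p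
    · exact absurd rfl hij
    · rfl
    · rfl
    · rfl
    · exact absurd rfl hij
    · rfl
    · rfl
    · rfl
    · rfl
  ι_zero := by
    rintro (_ | _ | i) hi
    · omega
    · omega
    · rfl
  π_zero := by
    rintro (_ | _ | i) hi
    · omega
    · omega
    · rfl
  sum_ι_π v := by
    rw [Finset.sum_range_succ, Finset.sum_range_one]
    exact Prod.ext (add_zero v.1) (zero_add v.2)
  range_ι := by
    rintro (_ | _ | i)
    · apply le_antisymm
      · rintro _ ⟨p, rfl⟩
        rfl
      · intro v hv
        have hv' : v.2 = 0 := hv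
        exact ⟨toBin (a 0) v.1, Prod.ext rfl hv'.symm⟩
    · apply le_antisymm
      · rintro _ ⟨p, rfl⟩
        rfl
      · intro v hv
        have hv' : v.1 = 0 := hv
        exact ⟨toBin (a 1) v.2, Prod.ext hv'.symm rfl⟩
    · exact LinearMap.range_zero

variable (F n) in
/-- The standard frame of `E(a 0, a 1)`. -/
def E.frame (a : ℕ → ℕ) : Frame 1 a
    (E.block n (a 0) (a 1) : ℕ → LieSubmodule F (levi F n) (E F (a 0) (a 1))) where
  toCoordinates := E.coordinates F n a
  upper := by
    rintro (_ | _ | i) (_ | _ | j) hij x p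
    · change act (a 0) 0 ((toBin (a 0)).symm p) + pairing _ (a 1) (a 0) x.vec 0 = 0
      rw [act_zero, map_zero, add_zero]
    · omega
    · omega
    · change act (a 1) 0 0 = 0
      rw [map_zero]
    · change act (a 1) 0 ((toBin (a 1)).symm p) = 0
      rw [act_zero]
    · omega
    · rfl
    · rfl
    · rfl

lemma E.frame_X (a : ℕ → ℕ) (p : Bin F (2 * n - 1)) (q : Bin F (a 1)) :
    (E.frame F n a).X 0 1 p q =
      toBin (a 0) (pairing (2 * n - 1) (a 1) (a 0) ((toBin _).symm p) ((toBin _).symm q)) := by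
  change act (a 0) 0 0 + pairing _ (a 1) (a 0) ((toBin _).symm p) ((toBin _).symm q) = _
  rw [map_zero, zero_add]
  rfl

variable {M N M' N' : Type*}
  [AddCommGroup M] [Module F M] [LieRingModule (Gal F n) M]
  [AddCommGroup N] [Module F N] [LieRingModule (Gal F n) N]
  [AddCommGroup M'] [Module F M'] [LieRingModule (Gal F n) M']
  [AddCommGroup N'] [Module F N'] [LieRingModule (Gal F n) N']
  {k ℓ k' ℓ' : ℕ} {a b : ℕ → ℕ} {C : ℕ → LieSubmodule F (levi F n) M}
  {D : ℕ → LieSubmodule F (levi F n) N} {C' : ℕ → LieSubmodule F (levi F n) M'}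
  {D' : ℕ → LieSubmodule F (levi F n) N'}
  (fr : Frame k a C) (gr : Frame ℓ b D) (fr' : Frame k' a C') (gr' : Frame ℓ' b D')

/-- The map `M ⊗ N → M' ⊗ N'` that rescales the blocks of total degree one. -/
def firstMap (x y : F) : M ⊗[F] N →ₗ[F] M' ⊗[F] N' :=
  x • (emb fr' gr' 1 0 ∘ₗ comp fr gr 1 0) + y • (emb fr' gr' 0 1 ∘ₗ comp fr gr 0 1)

variable (hk' : 1 ≤ k') (hℓ' : 1 ≤ ℓ')

include hk' hℓ' in
lemma comp_firstMap (x y : F) (u : M ⊗[F] N) :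
    comp fr' gr' 1 0 (firstMap fr gr fr' gr' x y u) = x • comp fr gr 1 0 u ∧
    comp fr' gr' 0 1 (firstMap fr gr fr' gr' x y u) = y • comp fr gr 0 1 u ∧
    ∀ i j, i + j ≠ 1 → comp fr' gr' i j (firstMap fr gr fr' gr' x y u) = 0 := by
  simp only [firstMap, LinearMap.add_apply, LinearMap.smul_apply, LinearMap.comp_apply, map_add,
    map_smul]
  refine ⟨?_, ?_, fun i j hij => ?_⟩
  · rw [comp_emb fr' gr' hk' (Nat.zero_le _), comp_emb_of_ne fr' gr' (by omega), smul_zero,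
      add_zero]
  · rw [comp_emb fr' gr' (Nat.zero_le _) hℓ', comp_emb_of_ne fr' gr' (by omega), smul_zero,
      zero_add]
  · rw [comp_emb_of_ne fr' gr' (by omega), comp_emb_of_ne fr' gr' (by omega), smul_zero, smul_zero,
      add_zero]

variable [LieModule F (Gal F n) M] [LieModule F (Gal F n) N]

include hk' hℓ' in
lemma firstMap_lie [LieModule F (Gal F n) M'] [LieModule F (Gal F n) N'] (x y : F) (A : SL2 F)
    (u : M ⊗[F] N) :
    firstMap fr gr fr' gr' x y ⁅ofSL2 F n A, u⁆ = ⁅ofSL2 F n A, firstMap fr gr fr' gr' x y u⁆ := by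
  obtain ⟨h1, h2, h3⟩ := comp_firstMap fr gr fr' gr' hk' hℓ' x y u
  obtain ⟨k1, k2, k3⟩ := comp_firstMap fr gr fr' gr' hk' hℓ' x y ⁅ofSL2 F n A, u⁆
  refine eq_of_comp_eq fr' gr' fun i j => ?_
  rw [comp_lie fr' gr']
  by_cases hij : i + j = 1
  · obtain ⟨rfl, rfl⟩ | ⟨rfl, rfl⟩ : (i = 1 ∧ j = 0) ∨ (i = 0 ∧ j = 1) := by omega
    · rw [k1, h1, comp_lie, map_smul]
    · rw [k2, h2, comp_lie, map_smul]
  · rw [k3 i j hij, h3 i j hij, map_zero]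

variable [CharZero F]

lemma E.frame_X_ne_zero {a : ℕ → ℕ} (h : Triangle (2 * n - 1) (a 1) (a 0)) :
    (E.frame F n a).X 0 1 ≠ 0 := by
  intro h0
  refine pairing_ne_zero (F := F) h (LinearMap.ext₂ fun p q => ?_)
  have h1 := E.frame_X (F := F) (n := n) a (toBin _ p) (toBin _ q)
  rw [h0] at h1
  exact h1.symm

/-- In total degree one the only equation is in block `(0, 0)`, and `z` does not contribute to it
because `Z 0 1 = 0`. -/
lemma mem_S_one_iff (hn : 1 ≤ n) (u : M ⊗[F] N) : u ∈ S C D 1 ↔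
    (∀ i j, i + j ≠ 1 → comp fr gr i j u = 0) ∧ ∀ p,
      (fr.X 0 1 p).rTensor (Bin F (b 0)) (comp fr gr 1 0 u) +
        (gr.X 0 1 p).lTensor (Bin F (a 0)) (comp fr gr 0 1 u) = 0 := by
  rw [mem_S_iff fr gr]
  refine and_congr_right fun hu => ⟨fun h p => h 0 0 1 1 rfl rfl one_pos _, fun h => ?_⟩
  intro i j i' j' hi hj hlt x
  obtain ⟨rfl, rfl, rfl, rfl⟩ : i = 0 ∧ j = 0 ∧ i' = 1 ∧ j' = 1 := by omega
  have h1 : fr.H 0 1 x = fr.X 0 1 (toBin _ x.vec) := LinearMap.ext fun p => by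
    rw [fr.H_eq_X_add_Z, fr.Z_eq_zero hn le_rfl, LinearMap.zero_apply, smul_zero, add_zero]
  have h2 : gr.H 0 1 x = gr.X 0 1 (toBin _ x.vec) := LinearMap.ext fun p => by
    rw [gr.H_eq_X_add_Z, gr.Z_eq_zero hn le_rfl, LinearMap.zero_apply, smul_zero, add_zero]
  rw [h1, h2]
  exact h _

include hk' hℓ' in
lemma firstMap_firstMap (hn : 1 ≤ n) (hk : 1 ≤ k) (hℓ : 1 ≤ ℓ) {x y x' y' : F} (hx : x' * x = 1)
    (hy : y' * y = 1) {u : M ⊗[F] N} (hu : u ∈ S C D 1) :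
    firstMap fr' gr' fr gr x' y' (firstMap fr gr fr' gr' x y u) = u := by
  obtain ⟨h1, h2, h3⟩ := comp_firstMap fr gr fr' gr' hk' hℓ' x y u
  obtain ⟨k1, k2, k3⟩ := comp_firstMap fr' gr' fr gr hk hℓ x' y' (firstMap fr gr fr' gr' x y u)
  refine eq_of_comp_eq fr gr fun i j => ?_
  by_cases hij : i + j = 1
  · obtain ⟨rfl, rfl⟩ | ⟨rfl, rfl⟩ : (i = 1 ∧ j = 0) ∨ (i = 0 ∧ j = 1) := by omega
    · rw [k1, h1, smul_smul, hx, one_smul]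
    · rw [k2, h2, smul_smul, hy, one_smul]
  · rw [k3 i j hij, ((mem_S_one_iff fr gr hn u).1 hu).1 i j hij]

variable [LieModule F (Gal F n) M'] [LieModule F (Gal F n) N']

include hk' hℓ' in
-- The scalars are crossed: the component in block `(1, 0)` is scaled by the factor of the second
-- module and the other by that of the first, so the whole equation is multiplied by `x * y`.
lemma firstMap_mem (hn : 1 ≤ n) {x y : F} (hx : fr'.X 0 1 = y • fr.X 0 1)
    (hy : gr'.X 0 1 = x • gr.X 0 1) {u : M ⊗[F] N} (hu : u ∈ S C D 1) :
    firstMap fr gr fr' gr' x y u ∈ S C' D' 1 := by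
  obtain ⟨h1, h2, h3⟩ := comp_firstMap fr gr fr' gr' hk' hℓ' x y u
  refine (mem_S_one_iff fr' gr' hn _).2 ⟨h3, fun p => ?_⟩
  have h4 := ((mem_S_one_iff fr gr hn u).1 hu).2 p
  rw [h1, h2, hx, hy, LinearMap.smul_apply, LinearMap.smul_apply, LinearMap.rTensor_smul,
    LinearMap.lTensor_smul, LinearMap.smul_apply, LinearMap.smul_apply, map_smul, map_smul,
    smul_smul, smul_smul, mul_comm y x, ← smul_add, h4, smul_zero]

/-- `S_1` only depends on the first two blocks. -/
lemma nonempty_S_one_equiv (hn : 1 ≤ n) (hk : 1 ≤ k) (hℓ : 1 ≤ ℓ) (hk' : 1 ≤ k') (hℓ' : 1 ≤ ℓ')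
    (hf : fr.X 0 1 ≠ 0) (hg : gr.X 0 1 ≠ 0) (hf' : fr'.X 0 1 ≠ 0) (hg' : gr'.X 0 1 ≠ 0) :
    Nonempty (S C D 1 ≃ₗ⁅F, levi F n⁆ S C' D' 1) := by
  obtain ⟨y, hy, hy'⟩ := fr.exists_X_eq_smul fr' hf hf'
  obtain ⟨x, hx, hx'⟩ := gr.exists_X_eq_smul gr' hg hg'
  have hy'' : fr.X 0 1 = y⁻¹ • fr'.X 0 1 := by rw [hy', smul_smul, inv_mul_cancel₀ hy, one_smul]
  have hx'' : gr.X 0 1 = x⁻¹ • gr'.X 0 1 := by rw [hx', smul_smul, inv_mul_cancel₀ hx, one_smul]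
  let φ : S C D 1 →ₗ[F] S C' D' 1 := LinearMap.restrict (p := (S C D 1).toSubmodule)
    (q := (S C' D' 1).toSubmodule) (firstMap fr gr fr' gr' x y)
    fun u hu => firstMap_mem fr gr fr' gr' hk' hℓ' hn hy' hx' hu
  let ψ : S C' D' 1 →ₗ[F] S C D 1 := LinearMap.restrict (p := (S C' D' 1).toSubmodule)
    (q := (S C D 1).toSubmodule) (firstMap fr' gr' fr gr x⁻¹ y⁻¹)
    fun u hu => firstMap_mem fr' gr' fr gr hk hℓ hn hy'' hx'' hu
  let e : S C D 1 ≃ₗ[F] S C' D' 1 := LinearEquiv.ofLinearMap φ ψ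
    (LinearMap.ext fun u => Subtype.ext (firstMap_firstMap fr' gr' fr gr hk hℓ hn hk' hℓ'
      (mul_inv_cancel₀ hx) (mul_inv_cancel₀ hy) u.2))
    (LinearMap.ext fun u => Subtype.ext (firstMap_firstMap fr gr fr' gr' hk' hℓ' hn hk hℓ
      (inv_mul_cancel₀ hx) (inv_mul_cancel₀ hy) u.2))
  refine ⟨{ e with map_lie' := fun {A u} => ?_ }⟩
  obtain ⟨_, A, rfl⟩ := A
  exact Subtype.ext (firstMap_lie fr gr fr' gr' hk' hℓ' x y A u)

end First

/-! ### The space `S_2` for faithful modules -/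

section Main

variable {F : Type*} [Field F] [CharZero F] {n : ℕ} {M N : Type*} [AddCommGroup M] [Module F M]
  [LieRingModule (Gal F n) M] [LieModule F (Gal F n) M] [AddCommGroup N] [Module F N]
  [LieRingModule (Gal F n) N] [LieModule F (Gal F n) N]
  {k ℓ : ℕ} {a b : ℕ → ℕ} {C : ℕ → LieSubmodule F (levi F n) M}
  {D : ℕ → LieSubmodule F (levi F n) N} (fr : Frame k a C) (gr : Frame ℓ b D)
  (hf : ∀ i, i + 1 ≤ k → fr.X i (i + 1) ≠ 0) (hg : ∀ j, j + 1 ≤ ℓ → gr.X j (j + 1) ≠ 0)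

include hf hg in
-- Otherwise the equation for `z` in block `(0, 0)` reads `(Z ⊗ 1) u_20 = 0` with `Z` injective, so
-- the component `u_20` and with it `u` would vanish.
lemma Z_ne_zero_of_S_two_ne_bot (hZ : fr.Z 0 2 ≠ 0) (h : S C D 2 ≠ ⊥) : gr.Z 0 2 ≠ 0 := by
  intro h0
  refine h ((LieSubmodule.eq_bot_iff _).2 fun u hu =>
    eq_zero_of_comp_eq_zero fr gr hf hg hu (add_zero 2) ?_)
  have h1 : (fr.Z 0 2).rTensor _ (comp fr gr 2 0 u) + (gr.Z 0 2).lTensor _ (comp fr gr 0 2 u) = 0 :=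
    ((mem_S_iff fr gr 2 u).1 hu).2 0 0 2 2 rfl rfl (by omega) (hcen F n)
  rw [h0, LinearMap.lTensor_zero, LinearMap.zero_apply, add_zero] at h1
  have hinj : Function.Injective (fr.Z 0 2) :=
    (injective_iff_map_eq_zero _).2 fun p hp => equivariant_injective (fr.Z_bact 0 2) hZ hp
  exact (injective_iff_map_eq_zero _).1
    (Module.Flat.rTensor_preserves_injective_linearMap (M := Bin F (b 0)) _ hinj) _ h1

include hf hg in
lemma weight_eq_zero_of_S_two_ne_bot (hn : 1 ≤ n) (hZ : fr.Z 0 2 ≠ 0) (h : S C D 2 ≠ ⊥) :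
    (∀ i ≤ 2, a i = b i) ∧
      ∀ u ∈ S C D 2, ∀ μ : F, IsHighestWeightVector n μ u → μ = 0 := by
  obtain ⟨hk, hℓ⟩ : 2 ≤ k ∧ 2 ≤ ℓ := by
    by_contra hc
    exact h (S_eq_bot fr gr hf hg (by omega))
  have ha := fr.eq_of_Z_ne_zero hZ
  have hb := gr.eq_of_Z_ne_zero (Z_ne_zero_of_S_two_ne_bot fr gr hf hg hZ h)
  have key : ∀ u ∈ S C D 2, ∀ μ : ℕ, IsHighestWeightVector n (μ : F) u →
      μ = 0 ∧ a 0 = b 0 ∧ a 1 = b 1 := by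
    intro u hu μ hw
    have h1 := isLink_of_mem fr gr hf hg hn hu (i := 0) (j := 1) rfl (by omega) hℓ hw
    have h2 := isLink_of_mem fr gr hf hg hn hu (i := 1) (j := 0) rfl hk (by omega) hw
    simp only [zero_add, Nat.reduceAdd, ha, hb] at h1 h2
    exact h1.eq_of_double h2 (by omega)
  obtain ⟨u, hu, μ, hw⟩ := exists_isHighestWeightVector fr gr hf hg h
  obtain ⟨μ, rfl⟩ := exists_weight fr gr hf hg hu hw
  obtain ⟨-, h0, h1⟩ := key u hu μ hw
  refine ⟨fun i hi => ?_, fun v hv ν hwv => ?_⟩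
  · obtain rfl | rfl | rfl : i = 0 ∨ i = 1 ∨ i = 2 := by omega
    · exact h0
    · exact h1
    · rw [ha, hb, h0]
  · obtain ⟨ν, rfl⟩ := exists_weight fr gr hf hg hv hwv
    rw [(key v hv ν hwv).1, Nat.cast_zero]

include hf hg in
-- A highest weight vector of weight `0` is `sl(2)`-invariant, so the line it spans is a submodule
-- and, by irreducibility, all of `S_2`.
lemma nonempty_S_two_equiv (hn : 1 ≤ n) (hZ : fr.Z 0 2 ≠ 0) (h : S C D 2 ≠ ⊥) :
    Nonempty (S C D 2 ≃ₗ⁅F, levi F n⁆ V F 0) := by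
  obtain ⟨u, hu, μ, hw⟩ := exists_isHighestWeightVector fr gr hf hg h
  obtain rfl := (weight_eq_zero_of_S_two_ne_bot fr gr hf hg hn hZ h).2 u hu μ hw
  have hinv : ∀ A, ⁅ofSL2 F n A, u⁆ = 0 := by
    intro A
    have h1 := (isHighestWeightVector_iff fr gr hw.1).1 hw
    refine eq_of_comp_eq fr gr fun i j => ?_
    rw [comp_lie, map_zero]
    exact actT_eq_zero_of_highestWeight_zero (h1 i j).1 (by rw [(h1 i j).2, zero_smul]) A
  have hirr := S_isIrreducible fr gr hf hg hn one_le_two h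
  let j : Bin F 0 →ₗ[F] S C D 2 := LinearMap.toSpanSingleton F _ (⟨u, hu⟩ : S C D 2) ∘ₗ bcf 0 0
  have hj : ∀ p, ((j p : S C D 2) : M ⊗[F] N) = bcf 0 0 p • u := fun _ => rfl
  have hact : ∀ A p, bact 0 A p = (0 : Bin F 0) := by
    intro A p
    refine Bin_ext fun i hi => ?_
    obtain rfl : i = 0 := by omega
    rw [sl2_eq A, bact_add, bact_add, bact_smul, bact_smul, bact_smul]
    simp [bcf_bact_e, bcf_bact_h, bcf_bact_f_zero, bcf_eq_zero]
  let K : LieSubmodule F (levi F n) (S C D 2) :=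
    { toSubmodule := LinearMap.range j
      lie_mem := by
        rintro ⟨_, A, rfl⟩ _ ⟨p, rfl⟩
        refine ⟨0, Subtype.ext ?_⟩
        rw [map_zero]
        change 0 = ⁅ofSL2 F n A, bcf 0 0 p • u⁆
        rw [lie_smul, hinv, smul_zero] }
  have hK : K = ⊤ := by
    refine (eq_bot_or_eq_top K).resolve_left fun h0 => hw.1 ?_
    have h1 : j (bmono 0 0) ∈ K := ⟨_, rfl⟩
    rw [h0] at h1
    have h2 := congrArg Subtype.val (show j (bmono 0 0) = 0 from h1)
    rw [hj, bcf_bmono le_rfl, if_pos rfl, one_smul] at h2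
    exact h2
  have hbij : Function.Bijective j := by
    refine ⟨(injective_iff_map_eq_zero _).2 fun p hp => ?_, fun v => ?_⟩
    · have h1 := congrArg Subtype.val hp
      rw [hj] at h1
      refine Bin_ext fun i hi => ?_
      obtain rfl : i = 0 := by omega
      rw [map_zero]
      exact (smul_eq_zero.1 h1).resolve_right hw.1
    · have h1 : v ∈ K := by
        rw [hK]
        trivial
      exact h1
  let e : V F 0 ≃ₗ[F] S C D 2 := (toBin 0).trans (LinearEquiv.ofBijective j hbij)
  have e' : V F 0 ≃ₗ⁅F, levi F n⁆ S C D 2 :=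
    { e with
      map_lie' := fun {A p} => by
        obtain ⟨_, A, rfl⟩ := A
        refine Subtype.ext ?_
        have h1 : toBin 0 (act 0 A p) = 0 := hact A (toBin 0 p)
        change bcf 0 0 (toBin 0 (act 0 A p)) • u = ⁅ofSL2 F n A, bcf 0 0 (toBin 0 p) • u⁆
        rw [h1, map_zero, zero_smul, lie_smul, hinv, smul_zero] }
  exact ⟨e'.symm⟩

end Main

end Galilean

end

/-! ### The proposition -/

open Galilean in
theorem proposition4p6 {F : Type*} [Field F] [CharZero F] (n : ℕ) (hn : 1 ≤ n)
    {V₁ V₂ : Type*}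
    [AddCommGroup V₁] [Module F V₁] [LieRingModule (Gal F n) V₁] [LieModule F (Gal F n) V₁]
    [AddCommGroup V₂] [Module F V₂] [LieRingModule (Gal F n) V₂] [LieModule F (Gal F n) V₂]
    [FiniteDimensional F V₁] [FiniteDimensional F V₂]
    (hV₁ : IsStandardFaithful F n V₁) (hV₂ : IsUniserial F (Gal F n) V₂)
    (a : ℕ → ℕ) (C : ℕ → LieSubmodule F (levi F n) V₁) (hC : IsSocleDecomposition 2 a C)
    (ℓ : ℕ) (hℓ : 1 ≤ ℓ)
    (b : ℕ → ℕ) (D : ℕ → LieSubmodule F (levi F n) V₂) (hD : IsSocleDecomposition ℓ b D) :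
    S C D 0 = tensorBlock (C 0) (D 0) ∧
    (∀ t, min 2 ℓ < t → S C D t = ⊥) ∧
    (∀ t, t = 1 ∨ t = 2 → S C D t ≠ ⊥ →
      LieModule.IsIrreducible F (levi F n) (S C D t) ∧
      ∀ (μ : F) (v : V₁ ⊗[F] V₂), v ∈ S C D t → IsHighestWeightVector n μ v →
        ∃ u : ℕ → V₁ ⊗[F] V₂, v = ∑ i ∈ Finset.range (t + 1), u i ∧
          ∀ i ≤ t, u i ∈ tensorBlock (C i) (D (t - i)) ∧ IsHighestWeightVector n μ (u i)) ∧
    (¬ LieModule.IsFaithful F (Gal F n) V₂ → S C D 2 = ⊥) ∧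
    Nonempty (S C D 1 ≃ₗ⁅F, levi F n⁆
      S (E.block n (a 0) (a 1) : ℕ → LieSubmodule F (levi F n) (E F (a 0) (a 1)))
        (E.block n (b 0) (b 1) : ℕ → LieSubmodule F (levi F n) (E F (b 0) (b 1))) 1) ∧
    (IsStandardFaithful F n V₂ →
      (S C D 2 ≠ ⊥ ↔ Nonempty (V₁ ≃ₗ⁅F, Gal F n⁆ V₂)) ∧
      (S C D 2 ≠ ⊥ ↔ ∀ i ≤ 2, a i = b i) ∧
      (S C D 2 ≠ ⊥ → Nonempty (S C D 2 ≃ₗ⁅F, levi F n⁆ V F 0))) := by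
  obtain ⟨fr⟩ := exists_frame hn hC
  obtain ⟨gr⟩ := exists_frame hn hD
  have hf : ∀ i, i + 1 ≤ 2 → fr.X i (i + 1) ≠ 0 := fun i => fr.X_ne_zero hn hC
  have hg : ∀ j, j + 1 ≤ ℓ → gr.X j (j + 1) ≠ 0 := fun j => gr.X_ne_zero hn hD
  have hZ : fr.Z 0 2 ≠ 0 := by
    obtain ⟨i, j, hij, hj, h⟩ := fr.exists_Z_ne_zero hn hV₁.2.1
    -- With three blocks, `(0, 2)` is the only place where the central element can act.
    obtain ⟨rfl, rfl⟩ : i = 0 ∧ j = 2 := by omega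
    exact h
  have hf' := E.frame_X_ne_zero (F := F) (bilinear_triangle (fr.X_bact 0 1) (hf 0 (by omega)))
  have hg' := E.frame_X_ne_zero (F := F) (bilinear_triangle (gr.X_bact 0 1) (hg 0 hℓ))
  refine ⟨S_zero fr gr, fun t => S_eq_bot fr gr hf hg, fun t ht h =>
    ⟨S_isIrreducible fr gr hf hg hn (by omega) h, fun μ v => exists_components fr gr hf hg⟩,
    fun hne => ?_,
    nonempty_S_one_equiv fr gr (E.frame F n a) (E.frame F n b) hn one_le_two hℓ le_rfl le_rfl
      (hf 0 (by omega)) (hg 0 hℓ) hf' hg', fun hst => ?_⟩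
  · by_contra h
    exact hne (gr.isFaithful hn (hg 0 hℓ) (Z_ne_zero_of_S_two_ne_bot fr gr hf hg hZ h))
  · have to_eq : S C D 2 ≠ ⊥ → ∀ i ≤ 2, a i = b i := fun h =>
      (weight_eq_zero_of_S_two_ne_bot fr gr hf hg hn hZ h).1
    have to_iso : (∀ i ≤ 2, a i = b i) → Nonempty (V₁ ≃ₗ⁅F, Gal F n⁆ V₂) ∧ S C D 2 ≠ ⊥ := by
      intro h
      have h2 : 2 ≤ ℓ := by
        obtain ⟨i, j, hij, hj, -⟩ := gr.exists_Z_ne_zero hn hst.2.1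
        omega
      -- The decomposition of `V₁` is relabelled by `b`, so that blocks of both modules are maps
      -- between the same spaces and can be compared.
      have hC' : IsSocleDecomposition 2 b C :=
        { hC with equiv := fun i hi => h i hi ▸ hC.equiv i hi }
      obtain ⟨fr'⟩ := exists_frame hn hC'
      have hX : ∀ i, i + 1 ≤ 2 → fr'.X i (i + 1) ≠ 0 := fun i => fr'.X_ne_zero hn hC'
      have hZ' : fr'.Z 0 2 ≠ 0 := by
        obtain ⟨i, j, hij, hj, h⟩ := fr'.exists_Z_ne_zero hn hV₁.2.1
        obtain ⟨rfl, rfl⟩ : i = 0 ∧ j = 2 := by omega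
        exact h
      obtain ⟨s, hs, h₀⟩ := fr'.exists_X_eq_smul gr (hX 0 (by omega)) (hg 0 hℓ)
      obtain ⟨r, hr, h₁⟩ := fr'.exists_X_eq_smul gr (hX 1 (by omega)) (hg 1 h2)
      have hZ₂ : gr.Z 0 2 ≠ 0 := by
        rw [fr'.Z_eq_smul gr hn le_rfl h2 h₀ h₁]
        exact smul_ne_zero (mul_ne_zero hs hr) hZ'
      obtain rfl : ℓ = 2 := le_antisymm (gr.length_le_two hn hg hZ₂) h2
      have hb := fr'.eq_of_Z_ne_zero hZ'
      exact ⟨fr'.nonempty_equiv_of_eq gr hn hX hg hZ', S_two_ne_bot fr' gr hn le_rfl le_rfl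
        hb.symm rfl hb hb (hX 1 (by omega)) (hg 1 (by omega))⟩
    have iso_to : Nonempty (V₁ ≃ₗ⁅F, Gal F n⁆ V₂) → ∀ i ≤ 2, a i = b i := fun ⟨e⟩ _ hi =>
      fr.degree_eq hf gr hg e hi
    exact ⟨⟨fun h => (to_iso (to_eq h)).1, fun h => (to_iso (iso_to h)).2⟩,
      ⟨to_eq, fun h => (to_iso h).2⟩, nonempty_S_two_equiv fr gr hf hg hn hZ⟩
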